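/- Let $H$ and $M$ be probability distributions on $\mathbb R^2$ with continuous marginal distribution functions, let $Z^{(1)}_i=(X^{(1)}_i,Y^{(1)}_i)$, $i\ge 1$, be i.i.d. with law $H$ and $Z^{(2)}_j=(X^{(2)}_j,Y^{(2)}_j)$, $j\ge 1$, be i.i.d. with law $M$, the two samples being independent. For $(X,Y)$ with marginal distribution functions $F,G$ write $\gamma(X,Y)=\operatorname{cov}(X,G(Y))/\operatorname{cov}(X,F(X))$, and put $\delta_1=\gamma(X^{(1)}_1,Y^{(1)}_1)-\gamma(X^{(2)}_1,Y^{(2)}_1)$ and $\delta_2=\gamma(Y^{(1)}_1,X^{(1)}_1)-\gamma(Y^{(2)}_1,X^{(2)}_1)$. For $z=(x,y)$ and $z'=(x',y')$ let $h_1(z,z')=\frac14[(x-x')I(y>y')+(x'-x)I(y'>y)]$ and $h_2(z,z')=\frac14|x-x'|$, let $h_1',h_2'$ be $h_1,h_2$ with the two coordinates of each argument exchanged, and let $\mathbf H(z_1,z_2,w_1,w_2)\in\mathbb R^2$ have the components $$h_2(z_1,z_2)h_2(w_1,w_2)\delta_1-h_1(z_1,z_2)h_2(w_1,w_2)+h_2(z_1,z_2)h_1(w_1,w_2),$$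 $$h_2'(z_1,z_2)h_2'(w_1,w_2)\delta_2-h_1'(z_1,z_2)h_2'(w_1,w_2)+h_2'(z_1,z_2)h_1'(w_1,w_2).$$ For sample sizes $n_1,n_2$ and $n=n_1+n_2$ let $$U_{n_1,n_2}=\binom{n_1}{2}^{-1}\binom{n_2}{2}^{-1}\sum_{1\le i_1<i_2\le n_1}\ \sum_{1\le j_1<j_2\le n_2}\mathbf H\bigl(Z^{(1)}_{i_1},Z^{(1)}_{i_2},Z^{(2)}_{j_1},Z^{(2)}_{j_2}\bigr),$$ and let $\hat V_i=nU_{n_1,n_2}-(n-1)U^{(-i)}$, $i=1,\dots,n$, be the jackknife pseudo-values, where $U^{(-i)}$ is the same functional computed without the $i$-th observation of the pooled sample $Z^{(1)}_1,\dots,Z^{(1)}_{n_1},Z^{(2)}_1,\dots,Z^{(2)}_{n_2}$. The jackknife empirical likelihood ratio is $$R(\delta_1,\delta_2)=\max\Bigl\{\prod_{i=1}^n(np_i):\ p_i\ge 0,\ \sum_{i=1}^n p_i=1,\ \sum_{i=1}^n p_i\hat V_i=0\Bigr\},$$ with $R=0$ if there is no such $p$, and $-2\log 0=+\infty$. Let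 $g_{1,0}(z)=\mathbb E\,\mathbf H(z,Z^{(1)}_2,Z^{(2)}_1,Z^{(2)}_2)$ and $g_{0,1}(w)=\mathbb E\,\mathbf H(Z^{(1)}_1,Z^{(1)}_2,w,Z^{(2)}_2)$. Assume that 1. $\mathbb E[X^{(j)}_1]^2<\infty$ and $\mathbb E[Y^{(j)}_1]^2<\infty$ for $j=1,2$; 2. the $2\times 2$ covariance matrices of $g_{1,0}(Z^{(1)}_1)$ and of $g_{0,1}(Z^{(2)}_1)$ are positive definite; 3. $n=n_1+n_2\to\infty$ and $n_1/n_2\to r$ with $0<r<\infty$. Then $$-2\log R(\delta_1,\delta_2)\xrightarrow{d}\chi^2_2\quad\text{as } n\to\infty.$$ -/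

import Mathlib

open MeasureTheory ProbabilityTheory Filter Topology

noncomputable section

namespace GiniJEL

/-- The Gini correlation `γ(X, Y) = cov(X, G(Y)) / cov(X, F(X))` of a pair `(X, Y)` with law `P`,
where `F` and `G` are the distribution functions of `X` and `Y`. -/
def giniCorr (P : Measure (ℝ × ℝ)) : ℝ :=
  cov[fun z => z.1, fun z => cdf (P.map Prod.snd) z.2; P] /
    cov[fun z => z.1, fun z => cdf (P.map Prod.fst) z.1; P]

/-- The differences `(δ₁, δ₂)` between two laws of the Gini correlations `γ(X, Y)` and `γ(Y, X)`. -/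
def giniDiff (P Q : Measure (ℝ × ℝ)) : Fin 2 → ℝ :=
  ![giniCorr P - giniCorr Q, giniCorr (P.map Prod.swap) - giniCorr (Q.map Prod.swap)]

/-- The kernel `h₁`. -/
def h₁ (z w : ℝ × ℝ) : ℝ :=
  1 / 4 * ((if w.2 < z.2 then z.1 - w.1 else 0) + (if z.2 < w.2 then w.1 - z.1 else 0))

/-- The kernel `h₂`. -/
def h₂ (z w : ℝ × ℝ) : ℝ :=
  1 / 4 * |z.1 - w.1|

/-- The kernel `h₁'`: `h₁` with the roles of the two coordinates exchanged. -/
def h₁' (z w : ℝ × ℝ) : ℝ := h₁ z.swap w.swap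

/-- The kernel `h₂'`: `h₂` with the roles of the two coordinates exchanged. -/
def h₂' (z w : ℝ × ℝ) : ℝ := h₂ z.swap w.swap

/-- The vector kernel of size `(2, 2)`: `z₁, z₂` come from the first sample and `w₁, w₂` from the
second one, and `d` is the pair of differences. -/
def kernelH (d : Fin 2 → ℝ) (z₁ z₂ w₁ w₂ : ℝ × ℝ) : Fin 2 → ℝ :=
  ![h₂ z₁ z₂ * h₂ w₁ w₂ * d 0 - h₁ z₁ z₂ * h₂ w₁ w₂ + h₂ z₁ z₂ * h₁ w₁ w₂,
    h₂' z₁ z₂ * h₂' w₁ w₂ * d 1 - h₁' z₁ z₂ * h₂' w₁ w₂ + h₂' z₁ z₂ * h₁' w₁ w₂]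

/-- The projection `g_{1,0}(z) = E H(z, Z₂, W₁, W₂)`, with `Z₂ ∼ P` and `W₁, W₂ ∼ Q` independent. -/
def g₁₀ (P Q : Measure (ℝ × ℝ)) (d : Fin 2 → ℝ) (z : ℝ × ℝ) : Fin 2 → ℝ :=
  ∫ v : (ℝ × ℝ) × (ℝ × ℝ) × (ℝ × ℝ), kernelH d z v.1 v.2.1 v.2.2 ∂(P.prod (Q.prod Q))

/-- The projection `g_{0,1}(w) = E H(Z₁, Z₂, w, W₂)`, with `Z₁, Z₂ ∼ P` and `W₂ ∼ Q` independent. -/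
def g₀₁ (P Q : Measure (ℝ × ℝ)) (d : Fin 2 → ℝ) (w : ℝ × ℝ) : Fin 2 → ℝ :=
  ∫ v : (ℝ × ℝ) × (ℝ × ℝ) × (ℝ × ℝ), kernelH d v.1 v.2.1 w v.2.2 ∂(P.prod (P.prod Q))

/-- The covariance matrix of the random vector `f` under `P`. -/
def covMatrix (P : Measure (ℝ × ℝ)) (f : ℝ × ℝ → Fin 2 → ℝ) : Matrix (Fin 2) (Fin 2) ℝ :=
  Matrix.of fun a b => cov[fun z => f z a, fun z => f z b; P]

/-- The two-sample `U`-statistic type functional computed from the observations `z i`, `i ∈ A`, of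
the first sample and `w j`, `j ∈ B`, of the second one. -/
def twoSampleU (d : Fin 2 → ℝ) {m₁ m₂ : ℕ} (z : Fin m₁ → ℝ × ℝ) (w : Fin m₂ → ℝ × ℝ)
    (A : Finset (Fin m₁)) (B : Finset (Fin m₂)) : Fin 2 → ℝ :=
  ((A.card.choose 2 : ℝ)⁻¹ * (B.card.choose 2 : ℝ)⁻¹) •
    ∑ i₁ ∈ A, ∑ i₂ ∈ A with i₁ < i₂, ∑ j₁ ∈ B, ∑ j₂ ∈ B with j₁ < j₂,
      kernelH d (z i₁) (z i₂) (w j₁) (w j₂)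

/-- The jackknife pseudo-values `n T_n - (n - 1) T_{n-1}^{(-i)}` of the pooled sample of size
`n = m₁ + m₂`; the pooled sample is indexed by `Fin m₁ ⊕ Fin m₂`. -/
def pseudoValue (d : Fin 2 → ℝ) {m₁ m₂ : ℕ} (z : Fin m₁ → ℝ × ℝ) (w : Fin m₂ → ℝ × ℝ) :
    Fin m₁ ⊕ Fin m₂ → Fin 2 → ℝ
  | Sum.inl i => ((m₁ : ℝ) + m₂) • twoSampleU d z w Finset.univ Finset.univ -
      ((m₁ : ℝ) + m₂ - 1) • twoSampleU d z w (Finset.univ.erase i) Finset.univ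
  | Sum.inr j => ((m₁ : ℝ) + m₂) • twoSampleU d z w Finset.univ Finset.univ -
      ((m₁ : ℝ) + m₂ - 1) • twoSampleU d z w Finset.univ (Finset.univ.erase j)

/-- The probability weights `p` on `ι` under which the vectors `V i` have mean zero. -/
def feasibleWeights {ι : Type*} [Fintype ι] (V : ι → Fin 2 → ℝ) : Set (ι → ℝ) :=
  {p | (∀ i, 0 ≤ p i) ∧ ∑ i, p i = 1 ∧ ∑ i, p i • V i = 0}

/-- The empirical likelihood ratio for mean zero of the vectors `V i`: the largest value of
`∏ i, n p i` over the feasible weights (attained if there are any), and `0` if there are none. -/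
def elRatio {ι : Type*} [Fintype ι] (V : ι → Fin 2 → ℝ) : ℝ :=
  sSup ((fun p : ι → ℝ => ∏ i, ((Fintype.card ι : ℝ) * p i)) '' feasibleWeights V)

/-- The supremum in `elRatio` is a maximum. -/
theorem elRatio_isGreatest {ι : Type*} [Fintype ι] (V : ι → Fin 2 → ℝ)
    (h : (feasibleWeights V).Nonempty) :
    IsGreatest ((fun p : ι → ℝ => ∏ i, ((Fintype.card ι : ℝ) * p i)) '' feasibleWeights V)
      (elRatio V) := by
  have hc : IsClosed (feasibleWeights V) := by
    have h1 : IsClosed {p : ι → ℝ | ∀ i, 0 ≤ p i} := by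
      simp only [Set.ofPred_forall]
      exact isClosed_iInter fun i => isClosed_le continuous_const (continuous_apply i)
    have h2 : IsClosed {p : ι → ℝ | ∑ i, p i = 1} :=
      isClosed_eq (by fun_prop) continuous_const
    have h3 : IsClosed {p : ι → ℝ | ∑ i, p i • V i = 0} :=
      isClosed_eq (by fun_prop) continuous_const
    exact h1.inter (h2.inter h3)
  have hsub : feasibleWeights V ⊆ stdSimplex ℝ ι := fun p hp => ⟨hp.1, hp.2.1⟩
  have hk : IsCompact (feasibleWeights V) := (isCompact_stdSimplex ℝ ι).of_isClosed_subset hc hsub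
  exact (hk.image (by fun_prop)).isGreatest_sSup (h.image _)

/-- The statistic `-2 log R`, which is `+∞` if `R = 0`. -/
def negTwoLog (R : ℝ) : EReal :=
  if 0 < R then ((-2 * Real.log R : ℝ) : EReal) else ⊤

/-- The jackknife empirical likelihood ratio `R(d)` for the pair `d` of differences, computed from
the samples `z` and `w`. -/
def jelRatio (d : Fin 2 → ℝ) {m₁ m₂ : ℕ} (z : Fin m₁ → ℝ × ℝ) (w : Fin m₂ → ℝ × ℝ) : ℝ :=
  elRatio (pseudoValue d z w)

/-- The chi-square distribution with `k` degrees of freedom: the law of the sum of the squares of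
`k` independent standard normal variables. -/
def chiSquare (k : ℕ) : Measure ℝ :=
  (Measure.pi fun _ : Fin k => gaussianReal 0 1).map fun x => ∑ i, x i ^ 2

instance (k : ℕ) : IsProbabilityMeasure (chiSquare k) :=
  Measure.isProbabilityMeasure_map
    (Finset.measurable_sum _ fun i _ => (measurable_pi_apply i).pow_const 2).aemeasurable

end GiniJEL

end

/-! The argument is Owen's proof of Wilks' theorem for the empirical likelihood, fed with a
Hoeffding expansion of the jackknife pseudo-values.

Deterministic core. Let `V i` be `N` vectors, `m` their sum divided by `√N` and `S` their matrix of
second moments. If all `l ⬝ᵥ V i` are small for `l = S⁻¹ m / √N`, then `-2 log R` is close to the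
quadratic form of `S⁻¹` at `m`. The upper bound on `R` is convex duality with multiplier `l`
(`prod_le_exp_neg_sum_log`). The lower bound comes from the explicit weights proportional to `1 - l
⬝ᵥ V i`, the linearization of the optimal weights proportional to `1 / (1 + l ⬝ᵥ V i)`
(`elRatio_pos_and_abs_sub_le`). Hence the chi-square limit follows from three facts: `m` is
asymptotically normal with covariance `C`, `S` tends in probability to the same `C`, and the largest
`V i` is of smaller order than `√N` (`tendstoInDistribution_negTwoLog_elRatio`).

Why both limits are the same `C`. Each component of the kernel is the form `gform`, linear in the
pair of Gini kernels of the first sample and linear in that of the second. The two-sample statistic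
is therefore `gform` evaluated at one-sample U-statistics (`twoSampleU_apply`). The mean of a Gini
kernel is a Gini covariance (`kmean_giniKernel`), so at the true differences `gform` vanishes at the
means (`gform_giniDiff`). A pseudo-value is the statistic plus a multiple of centered row means
(`pseudoValue_inl`, `pseudoValue_inr`). In quadratic mean it is close to `2 / ρ₁` times `g₁₀`,
respectively `2 / ρ₂` times `g₀₁`, at its observation, where `ρ₁`, `ρ₂` are the limiting sample
proportions. The second moments thus tend to `C = (4 / ρ₁) cov g₁₀ + (4 / ρ₂) cov g₀₁`. The
normalized sum of the pseudo-values is `√n` times the statistic, whose Hoeffding expansion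
(`tendsto_scaledSum_sub`) has exactly this covariance in the limit.

Convergence in probability is handled along almost surely convergent subsequences
(`tendstoInMeasure_of_forall_subseq`). The limit computations for pseudo-values then concern a fixed
array of points satisfying the needed limit theorems (`IsTypical`). -/

namespace GiniJEL

/-! ### Empirical likelihood: duality, quadratic approximation, measurability. -/

/-- A third order bound for the logarithm near `1`. -/
lemma abs_log_one_add_sub_le {ε x : ℝ} (hε : ε ≤ 1 / 2) (hx : |x| ≤ ε) :
    |Real.log (1 + x) - x + x ^ 2 / 2| ≤ 2 * ε * x ^ 2 := by
  -- The series remainder after two terms is at most `|x| ^ 3 / (1 - |x|)`, and `1 - |x| ≥ 1 / 2`;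
  -- this is where the factor `2` comes from.
  have h := Real.abs_log_sub_add_sum_range_le (x := -x) (by rw [abs_neg]; linarith) 2
  simp only [Finset.sum_range_succ, Finset.sum_range_zero, abs_neg] at h
  have e : Real.log (1 + x) - x + x ^ 2 / 2 =
      0 + (-x) ^ (0 + 1) / ((0 : ℕ) + 1) + (-x) ^ (1 + 1) / ((1 : ℕ) + 1) + Real.log (1 - -x) := by
    rw [sub_neg_eq_add]; push_cast; ring
  rw [e]
  refine h.trans ?_
  rw [div_le_iff₀ (by linarith)]
  have h3 : |x| ^ (2 + 1) = |x| * x ^ 2 := by rw [pow_succ, sq_abs]; ring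
  rw [h3]
  nlinarith [sq_nonneg x, abs_nonneg x, mul_nonneg (sub_nonneg.2 hx) (sq_nonneg x),
    mul_nonneg (mul_nonneg ((abs_nonneg x).trans hx) (sq_nonneg x))
      (by linarith : 0 ≤ 1 - 2 * |x|)]

variable {ι : Type*} [Fintype ι]

lemma elRatio_nonneg (V : ι → Fin 2 → ℝ) : 0 ≤ elRatio V := by
  refine Real.sSup_nonneg ?_
  rintro _ ⟨p, hp, rfl⟩
  exact Finset.prod_nonneg fun i _ => mul_nonneg (Nat.cast_nonneg _) (hp.1 i)

/-- Weak duality for the empirical likelihood: every `l` with `1 + l ⬝ᵥ V i > 0` bounds the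
likelihood of all feasible weights. -/
lemma prod_le_exp_neg_sum_log [Nonempty ι] {V : ι → Fin 2 → ℝ} {p : ι → ℝ}
    (hp : p ∈ feasibleWeights V) (l : Fin 2 → ℝ) (hl : ∀ i, 0 < 1 + l ⬝ᵥ V i) :
    ∏ i, ((Fintype.card ι : ℝ) * p i) ≤ Real.exp (-∑ i, Real.log (1 + l ⬝ᵥ V i)) := by
  obtain ⟨hp0, hp1, hp2⟩ := hp
  set N : ℝ := (Fintype.card ι : ℝ)
  have hN : 0 ≤ N := Nat.cast_nonneg _
  have hz : ∑ i, p i * (l ⬝ᵥ V i) = 0 := by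
    have : l ⬝ᵥ ∑ i, p i • V i = 0 := by rw [hp2, dotProduct_zero]
    rw [dotProduct_sum] at this
    simpa [dotProduct_smul] using this
  have hcard : ∑ _i : ι, (1 : ℝ) = N := by simp [N]
  -- Each factor satisfies `t ≤ exp (t - 1)`, and the two constraints on `p` make the exponents sum
  -- to zero.
  have key : ∏ i, (N * p i * (1 + l ⬝ᵥ V i)) ≤ 1 := by
    calc ∏ i, (N * p i * (1 + l ⬝ᵥ V i))
        ≤ ∏ i, Real.exp (N * p i * (1 + l ⬝ᵥ V i) - 1) := by
          refine Finset.prod_le_prod (fun i _ => ?_) (fun i _ => ?_)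
          · exact mul_nonneg (mul_nonneg hN (hp0 i)) (hl i).le
          · linarith [Real.add_one_le_exp (N * p i * (1 + l ⬝ᵥ V i) - 1)]
      _ = Real.exp (∑ i, (N * p i * (1 + l ⬝ᵥ V i) - 1)) := (Real.exp_sum _ _).symm
      _ = 1 := by
          rw [Real.exp_eq_one_iff, Finset.sum_sub_distrib, hcard]
          have : ∀ i, N * p i * (1 + l ⬝ᵥ V i) = N * p i + N * (p i * (l ⬝ᵥ V i)) := by
            intro i; ring
          simp_rw [this]
          rw [Finset.sum_add_distrib, ← Finset.mul_sum, ← Finset.mul_sum, hp1, hz]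
          ring
  rw [Finset.prod_mul_distrib] at key
  have hpos : 0 < ∏ i, (1 + l ⬝ᵥ V i) := Finset.prod_pos fun i _ => hl i
  rw [Real.exp_neg, Real.exp_sum]
  simp_rw [Real.exp_log (hl _)]
  rwa [← one_div, le_div_iff₀ hpos]

/-- Quadratic approximation of the empirical log-likelihood ratio: if `l` solves
`∑ (l ⬝ᵥ V i) V i = ∑ V i` and all `l ⬝ᵥ V i` are small, then `-2 log R` is close to
`∑ l ⬝ᵥ V i`. -/
theorem elRatio_pos_and_abs_sub_le [Nonempty ι] {V : ι → Fin 2 → ℝ} {l : Fin 2 → ℝ} {ε : ℝ}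
    (hε : ε ≤ 1 / 2) (hl : ∑ i, (l ⬝ᵥ V i) • V i = ∑ i, V i) (hb : ∀ i, |l ⬝ᵥ V i| ≤ ε) :
    0 < elRatio V ∧ |(-2 * Real.log (elRatio V)) - ∑ i, l ⬝ᵥ V i| ≤
      4 * ε * ∑ i, l ⬝ᵥ V i := by
  set N : ℝ := (Fintype.card ι : ℝ) with hNdef
  have hN : 0 < N := by simp [N, Fintype.card_pos]
  have hcard : ∑ _i : ι, (1 : ℝ) = N := by simp [N]
  have hε0 : 0 ≤ ε := (abs_nonneg _).trans (hb (Classical.arbitrary ι))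
  set y : ι → ℝ := fun i => l ⬝ᵥ V i with hy
  set Q := ∑ i, y i with hQ
  -- Pairing the equation for `l` with `l` itself: the first and second moments of the `y i`
  -- coincide.
  have hQ2 : ∑ i, y i ^ 2 = Q := by
    have : l ⬝ᵥ ∑ i, (l ⬝ᵥ V i) • V i = l ⬝ᵥ ∑ i, V i := by rw [hl]
    rw [dotProduct_sum, dotProduct_sum] at this
    simp only [dotProduct_smul, smul_eq_mul] at this
    simp only [sq]
    exact this
  have hyb : ∀ i, |y i| ≤ ε := hb
  have hy1 : ∀ i, -(1 / 2) ≤ y i ∧ y i ≤ 1 / 2 := fun i => abs_le.1 ((hyb i).trans hε)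
  have hQN : Q < N := by
    have : Q ≤ ∑ _i : ι, (1 / 2 : ℝ) := Finset.sum_le_sum fun i _ => (hy1 i).2
    have h2 : ∑ _i : ι, (1 / 2 : ℝ) = N / 2 := by
      simp [N]; ring
    linarith
  have hq : 0 < 1 - Q / N := by rw [sub_pos, div_lt_one hN]; exact hQN
  -- First order version of the dual weights `1 / (N (1 + y i))`. The equation for `l` makes them
  -- satisfy the mean constraint exactly, so no nonlinear equation has to be solved.
  set p : ι → ℝ := fun i => (1 - y i) / (N - Q) with hp
  have hNQ : 0 < N - Q := by linarith
  have hpf : p ∈ feasibleWeights V := by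
    refine ⟨fun i => div_nonneg (by linarith [(hy1 i).2]) hNQ.le, ?_, ?_⟩
    · simp only [hp]
      rw [← Finset.sum_div, Finset.sum_sub_distrib, hcard, ← hQ, div_self hNQ.ne']
    · have : ∀ i, p i • V i = (N - Q)⁻¹ • (V i - (l ⬝ᵥ V i) • V i) := by
        intro i
        rw [smul_sub, smul_smul, ← sub_smul]
        congr 1
        simp only [hp, hy]
        ring
      simp_rw [this]
      rw [← Finset.smul_sum, Finset.sum_sub_distrib, hl, sub_self, smul_zero]
  have hne : (feasibleWeights V).Nonempty := ⟨p, hpf⟩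
  have hgreat := elRatio_isGreatest V hne
  have hlow : ∏ i, (N * p i) ≤ elRatio V := hgreat.2 ⟨p, hpf, rfl⟩
  have hfac : ∀ i, 0 < N * p i := fun i =>
    mul_pos hN (div_pos (by linarith [(hy1 i).2]) hNQ)
  have hpos : 0 < elRatio V := (Finset.prod_pos fun i _ => hfac i).trans_le hlow
  refine ⟨hpos, ?_⟩
  have hup : Real.log (elRatio V) ≤ -∑ i, Real.log (1 + y i) := by
    obtain ⟨p', hp', he⟩ := hgreat.1
    have h := prod_le_exp_neg_sum_log hp' l (fun i => by
      have := (hy1 i).1; simp only [hy] at this; linarith)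
    rw [Real.log_le_iff_le_exp hpos, ← he]
    exact h
  have hlow' : ∑ i, Real.log (1 - y i) - N * Real.log (1 - Q / N) ≤ Real.log (elRatio V) := by
    refine le_trans (le_of_eq ?_) (Real.log_le_log (Finset.prod_pos fun i _ => hfac i) hlow)
    rw [Real.log_prod fun i _ => (hfac i).ne']
    have : ∀ i, Real.log (N * p i) = Real.log (1 - y i) - Real.log (1 - Q / N) := by
      intro i
      rw [← Real.log_div (by linarith [(hy1 i).2]) hq.ne']
      congr 1
      simp only [hp]
      field_simp
    simp_rw [this]
    rw [Finset.sum_sub_distrib, Finset.sum_const, Finset.card_univ, nsmul_eq_mul]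
  have hlogq : Real.log (1 - Q / N) ≤ - (Q / N) := by
    have := Real.log_le_sub_one_of_pos hq
    linarith
  -- The normalization of the weights contributes `+Q`, which offsets the first order term `-Q` of
  -- `∑ log (1 - y i)`. What remains is `-Q / 2`, matching the upper bound.
  have hlogq' : -N * Real.log (1 - Q / N) ≥ Q := by
    have : N * Real.log (1 - Q / N) ≤ N * (-(Q / N)) := mul_le_mul_of_nonneg_left hlogq hN.le
    have e : N * (-(Q / N)) = -Q := by field_simp
    linarith
  have hs1 : ∑ i, (y i - y i ^ 2 / 2 - 2 * ε * y i ^ 2) ≤ ∑ i, Real.log (1 + y i) :=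
    Finset.sum_le_sum fun i _ => by
      have := (abs_le.1 (abs_log_one_add_sub_le hε (hyb i))).1
      linarith
  have hs2 : ∑ i, (-y i - y i ^ 2 / 2 - 2 * ε * y i ^ 2) ≤ ∑ i, Real.log (1 - y i) :=
    Finset.sum_le_sum fun i _ => by
      have := (abs_le.1 (abs_log_one_add_sub_le (x := -y i) hε (by rw [abs_neg]; exact hyb i))).1
      rw [neg_sq, ← sub_eq_add_neg] at this
      linarith
  simp only [Finset.sum_sub_distrib, ← Finset.mul_sum, ← Finset.sum_div, Finset.sum_neg_distrib,
    hQ2, ← hQ] at hs1 hs2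
  rw [abs_le]
  constructor <;> linarith

/-- The empirical likelihood ratio is an upper semicontinuous, hence measurable, function of the
vectors. -/
lemma measurable_elRatio : Measurable (elRatio : (ι → Fin 2 → ℝ) → ℝ) := by
  refine measurable_of_Ici fun c => ?_
  rcases le_or_gt c 0 with hc | hc
  · have : elRatio ⁻¹' Set.Ici c = (Set.univ : Set (ι → Fin 2 → ℝ)) :=
      Set.eq_univ_of_forall fun V => hc.trans (elRatio_nonneg V)
    rw [this]
    exact MeasurableSet.univ
  -- For `c > 0` the superlevel set is the projection of a closed set along the compact simplex,
  -- hence closed. Positivity of `c` excludes the vectors without feasible weights, where the ratio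
  -- is `0`.
  · let T : Set ((ι → Fin 2 → ℝ) × stdSimplex ℝ ι) :=
      {q | ∑ i, (q.2 : ι → ℝ) i • q.1 i = 0 ∧
        c ≤ ∏ i, ((Fintype.card ι : ℝ) * (q.2 : ι → ℝ) i)}
    have hcont : ∀ i, Continuous fun q : (ι → Fin 2 → ℝ) × stdSimplex ℝ ι => (q.2 : ι → ℝ) i :=
      fun i => (continuous_apply i).comp (continuous_subtype_val.comp continuous_snd)
    have hT : IsClosed T := by
      refine IsClosed.inter ?_ ?_
      · exact isClosed_eq (continuous_finsetSum _ fun i _ =>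
          (hcont i).smul ((continuous_apply i).comp continuous_fst)) continuous_const
      · exact isClosed_le continuous_const (continuous_finsetProd _ fun i _ =>
          continuous_const.mul (hcont i))
    have himg : elRatio ⁻¹' Set.Ici c = Prod.fst '' T := by
      ext V
      simp only [Set.mem_preimage, Set.mem_Ici, Set.mem_image, Prod.exists, exists_and_right,
        exists_eq_right]
      constructor
      · intro h
        have hne : (feasibleWeights V).Nonempty := by
          by_contra hne
          rw [Set.not_nonempty_iff_eq_empty] at hne
          rw [elRatio, hne, Set.image_empty, Real.sSup_empty] at h
          linarith
        obtain ⟨p, hp, he⟩ := (elRatio_isGreatest V hne).1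
        exact ⟨⟨p, hp.1, hp.2.1⟩, hp.2.2, by rw [← he] at h; exact h⟩
      · rintro ⟨⟨p, hp⟩, h1, h2⟩
        have hpf : p ∈ feasibleWeights V := ⟨hp.1, hp.2, h1⟩
        exact h2.trans ((elRatio_isGreatest V ⟨p, hpf⟩).2 ⟨p, hpf, rfl⟩)
    rw [himg]
    have : CompactSpace (stdSimplex ℝ ι) :=
      isCompact_iff_compactSpace.1 (isCompact_stdSimplex ℝ ι)
    exact (isClosedMap_fst_of_compactSpace _ hT).measurableSet

lemma measurable_negTwoLog : Measurable negTwoLog := by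
  refine Measurable.ite measurableSet_Ioi ?_ measurable_const
  exact measurable_coe_real_ereal.comp (Real.measurable_log.const_mul _)

end GiniJEL

/-! ### Convergence in probability and in distribution. -/

namespace GiniJEL

variable {Ω : Type*} [MeasurableSpace Ω] {μ : Measure Ω}

/-- Finitely many sequences converging in measure converge almost everywhere along a common
subsequence of any given subsequence. -/
lemma exists_common_subseq_tendsto_ae {I : Type*} {X : I → ℕ → Ω → ℝ} {c : I → ℝ}
    (hX : ∀ i, TendstoInMeasure μ (X i) atTop (fun _ => c i)) (s : Finset I)
    (ns : ℕ → ℕ) (hns : StrictMono ns) :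
    ∃ ms : ℕ → ℕ, StrictMono ms ∧
      ∀ᵐ ω ∂μ, ∀ i ∈ s, Tendsto (fun n => X i (ns (ms n)) ω) atTop (𝓝 (c i)) := by
  classical
  induction s using Finset.induction_on with
  | empty => exact ⟨id, strictMono_id, by simp⟩
  | insert a s _ ih =>
    obtain ⟨ms, hms, h⟩ := ih
    obtain ⟨ks, hks, h'⟩ :=
      ((hX a).comp (hns.comp hms).tendsto_atTop).exists_seq_tendsto_ae
    refine ⟨ms ∘ ks, hms.comp hks, ?_⟩
    filter_upwards [h, h'] with ω h1 h2 i hi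
    rcases Finset.mem_insert.1 hi with rfl | hi
    · exact h2
    · exact (h1 i hi).comp hks.tendsto_atTop

/-- Convergence in measure of a sequence that converges pointwise along every subsequence along
which finitely many sequences, convergent in measure, converge. -/
theorem tendstoInMeasure_of_forall_subseq [IsFiniteMeasure μ] {I : Type*} [Fintype I]
    {X : I → ℕ → Ω → ℝ} {c : I → ℝ}
    (hX : ∀ i, TendstoInMeasure μ (X i) atTop (fun _ => c i)) {F : ℕ → Ω → ℝ} {f : ℝ}
    (hF : ∀ n, AEStronglyMeasurable (F n) μ)
    (h : ∀ᵐ ω ∂μ, ∀ ns : ℕ → ℕ, StrictMono ns →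
      (∀ i, Tendsto (fun n => X i (ns n) ω) atTop (𝓝 (c i))) →
        Tendsto (fun n => F (ns n) ω) atTop (𝓝 f)) :
    TendstoInMeasure μ F atTop (fun _ => f) := by
  rw [exists_seq_tendstoInMeasure_atTop_iff hF]
  intro ns hns
  obtain ⟨ms, hms, h'⟩ := exists_common_subseq_tendsto_ae hX Finset.univ ns hns
  refine ⟨ms, hms, ?_⟩
  filter_upwards [h, h'] with ω h1 h2
  exact h1 (ns ∘ ms) (hns.comp hms) fun i => h2 i (Finset.mem_univ i)

/-- Convergence in distribution to zero implies convergence in probability. -/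
lemma tendstoInMeasure_of_tendstoInDistribution_zero [IsProbabilityMeasure μ]
    {Ω' : Type*} [MeasurableSpace Ω'] {μ' : Measure Ω'} [IsProbabilityMeasure μ']
    {X : ℕ → Ω → ℝ}
    (hX : TendstoInDistribution X atTop (fun _ : Ω' => (0 : ℝ)) (fun _ => μ) μ') :
    TendstoInMeasure μ X atTop (fun _ => 0) := by
  rw [tendstoInMeasure_iff_norm]
  intro ε hε
  -- Portmanteau for this closed set, which is null for the point mass at zero.
  set F : Set ℝ := {x | ε ≤ ‖x‖}
  have hF : IsClosed F := isClosed_le continuous_const continuous_norm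
  have h := ProbabilityMeasure.limsup_measure_closed_le_of_tendsto hX.tendsto hF
  have h0 : (μ'.map (fun _ : Ω' => (0 : ℝ))) F = 0 := by
    rw [Measure.map_apply measurable_const hF.measurableSet]
    have : (fun _ : Ω' => (0 : ℝ)) ⁻¹' F = ∅ := by
      ext x
      simp [F, hε]
    rw [this, measure_empty]
  simp only [ProbabilityMeasure.coe_mk] at h
  rw [h0] at h
  have e : ∀ n, (μ.map (X n)) F = μ {x | ε ≤ ‖X n x - 0‖} := by
    intro n
    rw [Measure.map_apply_of_aemeasurable (hX.forall_aemeasurable n) hF.measurableSet]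
    simp [F]
  simp_rw [e] at h
  exact tendsto_of_le_liminf_of_limsup_le (by simp) h

/-- A product of a sequence converging in distribution and one converging to zero in probability
converges to zero in probability. -/
lemma tendstoInMeasure_mul_of_tendstoInDistribution [IsProbabilityMeasure μ]
    {Ω' : Type*} [MeasurableSpace Ω'] {μ' : Measure Ω'} [IsProbabilityMeasure μ']
    {X Y : ℕ → Ω → ℝ} {L : Ω' → ℝ}
    (hX : TendstoInDistribution X atTop L (fun _ => μ) μ')
    (hY : TendstoInMeasure μ Y atTop (fun _ => 0)) (hYm : ∀ n, AEMeasurable (Y n) μ) :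
    TendstoInMeasure μ (fun n ω => X n ω * Y n ω) atTop (fun _ => 0) := by
  -- Slutsky: jointly with `Y`, the product converges in distribution to `L * 0`.
  have h := hX.continuous_comp_prodMk_of_tendstoInMeasure_const
    (g := fun x : ℝ × ℝ => x.1 * x.2) (by fun_prop) hY hYm
  simp only [mul_zero] at h
  exact tendstoInMeasure_of_tendstoInDistribution_zero h

/-- Convergence in mean to zero of nonnegative random variables implies convergence in measure. -/
lemma tendstoInMeasure_of_tendsto_integral [IsFiniteMeasure μ] {X : ℕ → Ω → ℝ}
    (h0 : ∀ n ω, 0 ≤ X n ω) (hint : ∀ n, Integrable (X n) μ)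
    (h : Tendsto (fun n => ∫ ω, X n ω ∂μ) atTop (𝓝 0)) :
    TendstoInMeasure μ X atTop (fun _ => 0) := by
  rw [tendstoInMeasure_iff_measureReal_norm]
  intro ε hε
  refine squeeze_zero (fun _ => measureReal_nonneg) (fun n => ?_)
    (g := fun n => ε⁻¹ * ∫ ω, X n ω ∂μ) (by simpa using h.const_mul ε⁻¹)
  have := mul_meas_ge_le_integral_of_nonneg (ae_of_all _ (h0 n)) (hint n) ε
  have e : {x | ε ≤ ‖X n x - 0‖} = {x | ε ≤ X n x} := by
    ext x
    simp [Real.norm_eq_abs, abs_of_nonneg (h0 n x)]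
  rw [e, ← div_eq_inv_mul, le_div_iff₀ hε, mul_comm]
  exact this

/-- Convergence to zero in quadratic mean implies convergence in measure. -/
lemma tendstoInMeasure_of_tendsto_integral_sq [IsFiniteMeasure μ] {X : ℕ → Ω → ℝ}
    (hX : ∀ n, MemLp (X n) 2 μ)
    (h : Tendsto (fun n => ∫ ω, X n ω ^ 2 ∂μ) atTop (𝓝 0)) :
    TendstoInMeasure μ X atTop (fun _ => 0) := by
  have h2 := tendstoInMeasure_of_tendsto_integral (fun n ω => sq_nonneg (X n ω))
    (fun n => (hX n).integrable_sq) h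
  refine tendstoInMeasure_of_forall_subseq (I := Unit) (X := fun _ n ω => X n ω ^ 2)
    (c := fun _ => 0) (fun _ => h2) (fun n => (hX n).aestronglyMeasurable)
    (ae_of_all _ fun ω ns _ hc => ?_)
  have := (hc ()).sqrt
  simp only [Real.sqrt_sq_eq_abs, Real.sqrt_zero] at this
  exact (tendsto_zero_iff_abs_tendsto_zero _).2 this

/-- Convergence in distribution is not affected by a change on events of vanishing probability, in
a space without a metric. -/
lemma tendstoInDistribution_of_tendsto_measure_ne [IsProbabilityMeasure μ]
    {Ω' : Type*} [MeasurableSpace Ω'] {μ' : Measure Ω'} [IsProbabilityMeasure μ']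
    {E : Type*} [TopologicalSpace E] [MeasurableSpace E] [OpensMeasurableSpace E]
    {X Y : ℕ → Ω → E} {L : Ω' → E}
    (hX : TendstoInDistribution X atTop L (fun _ => μ) μ') (hY : ∀ n, AEMeasurable (Y n) μ)
    (h : Tendsto (fun n => μ {ω | Y n ω ≠ X n ω}) atTop (𝓝 0)) :
    TendstoInDistribution Y atTop L (fun _ => μ) μ' := by
  refine ⟨hY, hX.aemeasurable_limit, ?_⟩
  refine ProbabilityMeasure.tendsto_iff_forall_integral_tendsto.2 fun f => ?_
  have hXf := ProbabilityMeasure.tendsto_iff_forall_integral_tendsto.1 hX.tendsto f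
  simp only [ProbabilityMeasure.coe_mk] at hXf ⊢
  have hr : Tendsto (fun n => 2 * ‖f‖ * μ.real {ω | Y n ω ≠ X n ω}) atTop (𝓝 0) := by
    have := ((ENNReal.tendsto_toReal ENNReal.zero_ne_top).comp h).const_mul (2 * ‖f‖)
    simpa [Function.comp_def, Measure.real] using this
  -- The integrands differ only where `Y n ≠ X n`, and there by at most `2 * ‖f‖`.
  have hd : Tendsto (fun n => ∫ x, f x ∂(μ.map (Y n)) - ∫ x, f x ∂(μ.map (X n))) atTop (𝓝 0) := by
    refine squeeze_zero_norm (fun n => ?_) hr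
    have hXm := hX.forall_aemeasurable n
    have hfY : AEStronglyMeasurable (fun ω => f (Y n ω)) μ :=
      (f.continuous.measurable.comp_aemeasurable (hY n)).aestronglyMeasurable
    have hfX : AEStronglyMeasurable (fun ω => f (X n ω)) μ :=
      (f.continuous.measurable.comp_aemeasurable hXm).aestronglyMeasurable
    have hiY : Integrable (fun ω => f (Y n ω)) μ :=
      Integrable.of_bound hfY ‖f‖ (ae_of_all _ fun ω => f.norm_coe_le_norm _)
    have hiX : Integrable (fun ω => f (X n ω)) μ :=
      Integrable.of_bound hfX ‖f‖ (ae_of_all _ fun ω => f.norm_coe_le_norm _)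
    rw [integral_map (hY n) f.continuous.measurable.aestronglyMeasurable,
      integral_map hXm f.continuous.measurable.aestronglyMeasurable, ← integral_sub hiY hiX]
    -- The exceptional event need not be measurable; its measurable hull has the same measure.
    set S := toMeasurable μ {ω | Y n ω ≠ X n ω}
    have hS : MeasurableSet S := measurableSet_toMeasurable _ _
    refine (norm_integral_le_of_norm_le (g := S.indicator fun _ => 2 * ‖f‖)
      ((integrable_const _).indicator hS) (ae_of_all _ fun ω => ?_)).trans (le_of_eq ?_)
    · by_cases hω : ω ∈ S
      · rw [Set.indicator_of_mem hω]
        calc ‖f (Y n ω) - f (X n ω)‖ ≤ ‖f (Y n ω)‖ + ‖f (X n ω)‖ := norm_sub_le _ _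
          _ ≤ 2 * ‖f‖ := by linarith [f.norm_coe_le_norm (Y n ω), f.norm_coe_le_norm (X n ω)]
      · rw [Set.indicator_of_notMem hω]
        have : Y n ω = X n ω := by
          by_contra hne
          exact hω (subset_toMeasurable μ _ hne)
        rw [this, sub_self, norm_zero]
    · rw [integral_indicator_const _ hS, smul_eq_mul, mul_comm]
      simp only [S, Measure.real, measure_toMeasurable]
  simpa using hd.add hXf

end GiniJEL

/-! ### Wilks' theorem for the empirical likelihood of random vectors. -/

namespace GiniJEL

variable {Ω : Type*} [MeasurableSpace Ω] {μ : Measure Ω}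

/-- The limit of a sequence converging in distribution may be replaced by another one with the same
law. -/
lemma tendstoInDistribution_congr_limit [IsProbabilityMeasure μ]
    {Ω' Ω'' : Type*} [MeasurableSpace Ω'] {μ' : Measure Ω'} [IsProbabilityMeasure μ']
    [MeasurableSpace Ω''] {μ'' : Measure Ω''} [IsProbabilityMeasure μ'']
    {E : Type*} [TopologicalSpace E] [MeasurableSpace E] [OpensMeasurableSpace E]
    {X : ℕ → Ω → E} {L : Ω' → E} {L' : Ω'' → E}
    (hX : TendstoInDistribution X atTop L (fun _ => μ) μ') (hL' : AEMeasurable L' μ'')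
    (h : μ'.map L = μ''.map L') :
    TendstoInDistribution X atTop L' (fun _ => μ) μ'' := by
  refine ⟨hX.forall_aemeasurable, hL', ?_⟩
  have ht := hX.tendsto
  have e : (⟨μ'.map L, Measure.isProbabilityMeasure_map hX.aemeasurable_limit⟩ :
      ProbabilityMeasure E) = ⟨μ''.map L', Measure.isProbabilityMeasure_map hL'⟩ :=
    Subtype.ext h
  rw [← e]
  exact ht

/-- The normalized sum `n^{-1/2} ∑ V i`. -/
noncomputable def scaledSum {ι : Type*} [Fintype ι] (V : ι → Fin 2 → ℝ) (a : Fin 2) : ℝ :=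
  (√(Fintype.card ι : ℝ))⁻¹ * ∑ i, V i a

/-- The matrix of empirical second moments. -/
noncomputable def secondMoment {ι : Type*} [Fintype ι] (V : ι → Fin 2 → ℝ) :
    Matrix (Fin 2) (Fin 2) ℝ :=
  Matrix.of fun a b => (Fintype.card ι : ℝ)⁻¹ * ∑ i, V i a * V i b

section Deterministic

variable {ι : Type*} [Fintype ι]

/-- The quadratic approximation of the empirical log-likelihood ratio in terms of the normalized sum
and the second moments. -/
lemma elRatio_approx [Nonempty ι] (V : ι → Fin 2 → ℝ)
    (hS : (secondMoment V).det ≠ 0) {ε : ℝ}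
    (hεdef : ε = (∑ a, |((secondMoment V)⁻¹.mulVec (scaledSum V)) a|) *
      (‖V‖ / √(Fintype.card ι : ℝ))) (hε : ε ≤ 1 / 2) :
    0 < elRatio V ∧
      |(-2 * Real.log (elRatio V)) - (secondMoment V)⁻¹.mulVec (scaledSum V) ⬝ᵥ scaledSum V| ≤
        4 * ε * ((secondMoment V)⁻¹.mulVec (scaledSum V) ⬝ᵥ scaledSum V) := by
  set N : ℝ := (Fintype.card ι : ℝ)
  have hN : 0 < N := by simp [N, Fintype.card_pos]
  have hsN : 0 < √N := Real.sqrt_pos.2 hN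
  have hsq : √N * √N = N := Real.mul_self_sqrt hN.le
  set u := (secondMoment V)⁻¹.mulVec (scaledSum V) with hu
  have hSu : (secondMoment V).mulVec u = scaledSum V := by
    rw [hu, Matrix.mulVec_mulVec, Matrix.mul_nonsing_inv _ (isUnit_iff_ne_zero.2 hS),
      Matrix.one_mulVec]
  -- With this scaling `∑ (l ⬝ᵥ V i) V i = N S l = √N S u = √N m = ∑ V i`, where `m` is the
  -- normalized sum and `S` the second moment matrix.
  set l : Fin 2 → ℝ := (√N)⁻¹ • u with hl
  have hdot : ∀ v, l ⬝ᵥ v = (√N)⁻¹ * (u 0 * v 0 + u 1 * v 1) := by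
    intro v
    rw [hl, smul_dotProduct, smul_eq_mul, dotProduct, Fin.sum_univ_two]
  have hsum : ∑ i, l ⬝ᵥ V i = u ⬝ᵥ scaledSum V := by
    simp only [hdot]
    simp only [dotProduct, Fin.sum_univ_two, scaledSum]
    rw [← Finset.mul_sum, Finset.sum_add_distrib, ← Finset.mul_sum, ← Finset.mul_sum]
    ring
  have heq : ∑ i, (l ⬝ᵥ V i) • V i = ∑ i, V i := by
    ext a
    have ha := congrFun hSu a
    simp only [Matrix.mulVec, dotProduct, Fin.sum_univ_two, secondMoment, Matrix.of_apply,
      scaledSum] at ha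
    simp only [Finset.sum_apply, Pi.smul_apply, smul_eq_mul, hdot]
    have e : ∀ i, (√N)⁻¹ * (u 0 * V i 0 + u 1 * V i 1) * V i a =
        (√N)⁻¹ * (u 0 * (V i a * V i 0) + u 1 * (V i a * V i 1)) := by intro i; ring
    simp_rw [e]
    rw [← Finset.mul_sum, Finset.sum_add_distrib, ← Finset.mul_sum, ← Finset.mul_sum]
    change N⁻¹ * _ * _ + N⁻¹ * _ * _ = (√N)⁻¹ * _ at ha
    have h2 : ∑ i, V i a = √N * ((√N)⁻¹ * ∑ i, V i a) := by
      rw [← mul_assoc, mul_inv_cancel₀ hsN.ne', one_mul]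
    have hi : (√N)⁻¹ = √N * N⁻¹ := by
      rw [eq_mul_inv_iff_mul_eq₀ hN.ne', inv_mul_eq_iff_eq_mul₀ hsN.ne']
      exact hsq.symm
    rw [h2, ← ha, hi]
    ring
  have hb : ∀ i, |l ⬝ᵥ V i| ≤ ε := by
    intro i
    have hV : ∀ a, |V i a| ≤ ‖V‖ := fun a =>
      (norm_le_pi_norm (V i) a).trans (norm_le_pi_norm V i)
    rw [hεdef, hdot, Fin.sum_univ_two, abs_mul, abs_of_pos (inv_pos.2 hsN)]
    have h1 : |u 0 * V i 0 + u 1 * V i 1| ≤ (|u 0| + |u 1|) * ‖V‖ := by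
      refine (abs_add_le _ _).trans ?_
      rw [abs_mul, abs_mul, add_mul]
      exact add_le_add (mul_le_mul_of_nonneg_left (hV 0) (abs_nonneg _))
        (mul_le_mul_of_nonneg_left (hV 1) (abs_nonneg _))
    calc (√N)⁻¹ * |u 0 * V i 0 + u 1 * V i 1| ≤ (√N)⁻¹ * ((|u 0| + |u 1|) * ‖V‖) :=
          mul_le_mul_of_nonneg_left h1 (inv_pos.2 hsN).le
      _ = (|u 0| + |u 1|) * (‖V‖ / √N) := by ring
  have := elRatio_pos_and_abs_sub_le hε heq hb
  rwa [hsum] at this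

/-- The empirical likelihood ratio is invariant under invertible linear maps. -/
lemma elRatio_mulVec (A : Matrix (Fin 2) (Fin 2) ℝ) (hA : IsUnit A) (V : ι → Fin 2 → ℝ) :
    elRatio (fun i => A.mulVec (V i)) = elRatio V := by
  have : feasibleWeights (fun i => A.mulVec (V i)) = feasibleWeights V := by
    ext p
    simp only [feasibleWeights, Set.mem_ofPred_eq]
    have e : ∑ i, p i • A.mulVec (V i) = A.mulVec (∑ i, p i • V i) := by
      rw [Matrix.mulVec_sum]
      simp_rw [Matrix.mulVec_smul]
    rw [e]
    refine and_congr_right fun _ => and_congr_right fun _ => ⟨fun h => ?_, fun h => ?_⟩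
    · exact Matrix.mulVec_injective_iff_isUnit.2 hA (by rw [h, Matrix.mulVec_zero])
    · rw [h, Matrix.mulVec_zero]
  rw [elRatio, elRatio, this]

end Deterministic

section Wilks

variable [IsProbabilityMeasure μ] {ι : ℕ → Type*} [∀ k, Fintype (ι k)]
  {V : ∀ k, Ω → ι k → Fin 2 → ℝ}

lemma measurable_scaledSum {κ : Type*} [Fintype κ] :
    Measurable (scaledSum : (κ → Fin 2 → ℝ) → Fin 2 → ℝ) := by
  refine measurable_pi_lambda _ fun a => ?_
  unfold scaledSum
  fun_prop

lemma measurable_secondMoment {κ : Type*} [Fintype κ] (a b : Fin 2) :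
    Measurable (fun V : κ → Fin 2 → ℝ => secondMoment V a b) := by
  simp only [secondMoment, Matrix.of_apply]
  fun_prop

/-- Cramer's rule, valid for singular `S` too, since both sides are then zero. Measurability and
limits of the inverse can thus be read off entrywise without any condition on the determinant. -/
lemma inv_fin_two_apply_eq (S : Matrix (Fin 2) (Fin 2) ℝ) :
    S⁻¹ = Matrix.of ![![(S 0 0 * S 1 1 - S 0 1 * S 1 0)⁻¹ * S 1 1,
        -((S 0 0 * S 1 1 - S 0 1 * S 1 0)⁻¹ * S 0 1)],
      ![-((S 0 0 * S 1 1 - S 0 1 * S 1 0)⁻¹ * S 1 0),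
        (S 0 0 * S 1 1 - S 0 1 * S 1 0)⁻¹ * S 0 0]] := by
  rw [Matrix.inv_def, Matrix.det_fin_two, Matrix.adjugate_fin_two, Ring.inverse_eq_inv']
  ext a b
  fin_cases a <;> fin_cases b <;> simp

lemma measurable_inv_secondMoment {κ : Type*} [Fintype κ] (a b : Fin 2) :
    Measurable (fun V : κ → Fin 2 → ℝ => (secondMoment V)⁻¹ a b) := by
  simp only [inv_fin_two_apply_eq]
  have h := fun a b => measurable_secondMoment (κ := κ) a b
  fin_cases a <;> fin_cases b <;> simp
  · exact (((h 0 0).mul (h 1 1)).sub ((h 0 1).mul (h 1 0))).inv.mul (h 1 1)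
  · exact (((h 0 0).mul (h 1 1)).sub ((h 0 1).mul (h 1 0))).inv.mul (h 0 1)
  · exact (((h 0 0).mul (h 1 1)).sub ((h 0 1).mul (h 1 0))).inv.mul (h 1 0)
  · exact (((h 0 0).mul (h 1 1)).sub ((h 0 1).mul (h 1 0))).inv.mul (h 0 0)

/-- **Wilks' theorem** for the empirical likelihood of vectors with standard normal limit of the
normalized sums and unit limit of the second moments. -/
theorem tendstoInDistribution_negTwoLog_elRatio_of_standard
    (hV : ∀ k, Measurable (V k))
    (hcard : Tendsto (fun k => Fintype.card (ι k)) atTop atTop)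
    (hsum : TendstoInDistribution (fun k ω => scaledSum (V k ω)) atTop
      (fun x : Fin 2 → ℝ => x) (fun _ => μ) (Measure.pi fun _ => gaussianReal 0 1))
    (hS : ∀ a b, TendstoInMeasure μ (fun k ω => secondMoment (V k ω) a b) atTop
      (fun _ => (1 : Matrix (Fin 2) (Fin 2) ℝ) a b))
    (hmax : TendstoInMeasure μ (fun k ω => ‖V k ω‖ / √(Fintype.card (ι k) : ℝ)) atTop
      (fun _ => 0)) :
    TendstoInDistribution (fun k ω => negTwoLog (elRatio (V k ω))) atTop
      (fun x : ℝ => (x : EReal)) (fun _ => μ) (chiSquare 2) := by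
  set m : Fin 2 → ℕ → Ω → ℝ := fun a k ω => scaledSum (V k ω) a with hm
  set S : Fin 2 → Fin 2 → ℕ → Ω → ℝ := fun a b k ω => secondMoment (V k ω) a b with hSdef
  set D : Fin 2 → Fin 2 → ℕ → Ω → ℝ := fun a b k ω => (secondMoment (V k ω))⁻¹ a b with hD
  set bd : ℕ → Ω → ℝ := fun k ω => ‖V k ω‖ / √(Fintype.card (ι k) : ℝ) with hbd
  have mm : ∀ a k, Measurable (m a k) := fun a k =>
    (measurable_pi_apply a).comp (measurable_scaledSum.comp (hV k))
  have mS : ∀ a b k, Measurable (S a b k) := fun a b k => (measurable_secondMoment a b).comp (hV k)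
  have mD : ∀ a b k, Measurable (D a b k) := fun a b k =>
    (measurable_inv_secondMoment a b).comp (hV k)
  have mbd : ∀ k, Measurable (bd k) := fun k => (measurable_norm.comp (hV k)).div_const _
  -- convergence of the inverse matrices
  have hDlim : ∀ a b, TendstoInMeasure μ (D a b) atTop
      (fun _ => (1 : Matrix (Fin 2) (Fin 2) ℝ) a b) := by
    intro a b
    refine tendstoInMeasure_of_forall_subseq (I := Fin 2 × Fin 2) (X := fun q => S q.1 q.2)
      (c := fun q => (1 : Matrix (Fin 2) (Fin 2) ℝ) q.1 q.2) (fun q => hS q.1 q.2)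
      (fun n => (mD a b n).aestronglyMeasurable) (ae_of_all _ fun ω ns _ hc => ?_)
    have h00 := hc (0, 0)
    have h01 := hc (0, 1)
    have h10 := hc (1, 0)
    have h11 := hc (1, 1)
    simp only [Matrix.one_apply_eq, ne_eq, zero_ne_one, one_ne_zero, not_false_eq_true,
      Matrix.one_apply_ne] at h00 h01 h10 h11
    have hd : Tendsto (fun n => (S 0 0 (ns n) ω * S 1 1 (ns n) ω -
        S 0 1 (ns n) ω * S 1 0 (ns n) ω)⁻¹) atTop (𝓝 1) := by
      have := ((h00.mul h11).sub (h01.mul h10)).inv₀ (by norm_num)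
      simpa using this
    simp only [hD, inv_fin_two_apply_eq]
    fin_cases a <;> fin_cases b <;> simp
    · simpa using hd.mul h11
    · simpa using (hd.mul h01).neg
    · simpa using (hd.mul h10).neg
    · simpa using hd.mul h00
  -- products with one factor bounded in probability
  have hm1 : ∀ a, TendstoInDistribution (m a) atTop (fun x : Fin 2 → ℝ => x a) (fun _ => μ)
      (Measure.pi fun _ => gaussianReal 0 1) := fun a =>
    hsum.continuous_comp (g := fun x : Fin 2 → ℝ => x a) (by fun_prop)
  have hm2 : ∀ a b, TendstoInDistribution (fun k ω => m a k ω * m b k ω) atTop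
      (fun x : Fin 2 → ℝ => x a * x b) (fun _ => μ) (Measure.pi fun _ => gaussianReal 0 1) :=
    fun a b => hsum.continuous_comp (g := fun x : Fin 2 → ℝ => x a * x b) (by fun_prop)
  have hmb : ∀ a, TendstoInMeasure μ (fun k ω => m a k ω * bd k ω) atTop (fun _ => 0) :=
    fun a => tendstoInMeasure_mul_of_tendstoInDistribution (hm1 a) hmax
      fun n => (mbd n).aemeasurable
  have hmmD : ∀ a b, TendstoInMeasure μ
      (fun k ω => (m a k ω * m b k ω) * (D a b k ω - (1 : Matrix (Fin 2) (Fin 2) ℝ) a b)) atTop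
      (fun _ => 0) := by
    intro a b
    refine tendstoInMeasure_mul_of_tendstoInDistribution (hm2 a b) ?_
      fun n => ((mD a b n).sub_const _).aemeasurable
    refine tendstoInMeasure_of_forall_subseq (I := Unit) (X := fun _ => D a b)
      (fun _ => hDlim a b) (fun n => ((mD a b n).sub_const _).aestronglyMeasurable)
      (ae_of_all _ fun ω ns _ hc => ?_)
    simpa using (hc ()).sub_const ((1 : Matrix (Fin 2) (Fin 2) ℝ) a b)
  -- This is the bound `ε` of `elRatio_approx`. Its factors are not known to converge jointly, so it
  -- is rewritten through the products `m * bd`, which vanish in probability.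
  set ep : ℕ → Ω → ℝ := fun k ω =>
    (∑ a, |((secondMoment (V k ω))⁻¹.mulVec (scaledSum (V k ω))) a|) * bd k ω with hep
  have ep_eq : ∀ k ω, ep k ω = (|D 0 0 k ω * m 0 k ω + D 0 1 k ω * m 1 k ω| +
      |D 1 0 k ω * m 0 k ω + D 1 1 k ω * m 1 k ω|) * bd k ω := by
    intro k ω
    simp [hep, hD, hm, Matrix.mulVec, dotProduct, Fin.sum_univ_two]
  have bd_nonneg : ∀ k ω, 0 ≤ bd k ω := fun k ω => by positivity
  have ep_eq' : ∀ k ω, ep k ω =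
      |D 0 0 k ω * (m 0 k ω * bd k ω) + D 0 1 k ω * (m 1 k ω * bd k ω)| +
      |D 1 0 k ω * (m 0 k ω * bd k ω) + D 1 1 k ω * (m 1 k ω * bd k ω)| := by
    intro k ω
    rw [ep_eq, add_mul, ← abs_of_nonneg (bd_nonneg k ω), ← abs_mul, ← abs_mul,
      abs_of_nonneg (bd_nonneg k ω)]
    ring_nf
  have mep : ∀ k, Measurable (ep k) := by
    intro k
    have : ep k = fun ω => (|D 0 0 k ω * m 0 k ω + D 0 1 k ω * m 1 k ω| +
      |D 1 0 k ω * m 0 k ω + D 1 1 k ω * m 1 k ω|) * bd k ω := funext fun ω => ep_eq k ω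
    rw [this]
    have habs : ∀ f : Ω → ℝ, Measurable f → Measurable fun ω => |f ω| := fun f hf =>
      continuous_abs.measurable.comp hf
    exact ((habs _ (((mD 0 0 k).mul (mm 0 k)).add ((mD 0 1 k).mul (mm 1 k)))).add
      (habs _ (((mD 1 0 k).mul (mm 0 k)).add ((mD 1 1 k).mul (mm 1 k))))).mul (mbd k)
  have hep0 : TendstoInMeasure μ ep atTop (fun _ => 0) := by
    refine tendstoInMeasure_of_forall_subseq (I := (Fin 2 × Fin 2) ⊕ Fin 2)
      (X := Sum.elim (fun q => D q.1 q.2) (fun a k ω => m a k ω * bd k ω))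
      (c := Sum.elim (fun q => (1 : Matrix (Fin 2) (Fin 2) ℝ) q.1 q.2) (fun _ => 0))
      (fun i => by
        rcases i with q | a
        · exact hDlim q.1 q.2
        · exact hmb a)
      (fun n => (mep n).aestronglyMeasurable) (ae_of_all _ fun ω ns _ hc => ?_)
    have hDc := fun a b => hc (Sum.inl (a, b))
    have hmc := fun a => hc (Sum.inr a)
    simp only [Sum.elim_inl, Sum.elim_inr] at hDc hmc
    simp_rw [ep_eq']
    have := ((((hDc 0 0).mul (hmc 0)).add ((hDc 0 1).mul (hmc 1))).abs).add
      ((((hDc 1 0).mul (hmc 0)).add ((hDc 1 1).mul (hmc 1))).abs)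
    simpa using this
  set nm : ℕ → Ω → ℝ := fun k ω => ∑ a, m a k ω ^ 2 with hnm
  have mnm : ∀ k, Measurable (nm k) := fun k =>
    Finset.measurable_sum _ fun a _ => (mm a k).pow_const 2
  have hnmd : TendstoInDistribution nm atTop (fun x : Fin 2 → ℝ => ∑ a, x a ^ 2) (fun _ => μ)
      (Measure.pi fun _ => gaussianReal 0 1) :=
    hsum.continuous_comp (g := fun x : Fin 2 → ℝ => ∑ a, x a ^ 2) (by fun_prop)
  -- The error `4 ε Q` splits into this product and `ep * (Q - nm)`; the sequence `nm` itself
  -- converges only in distribution.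
  have hnmep : TendstoInMeasure μ (fun k ω => nm k ω * ep k ω) atTop (fun _ => 0) :=
    tendstoInMeasure_mul_of_tendstoInDistribution hnmd hep0 fun n => (mep n).aemeasurable
  set Q : ℕ → Ω → ℝ := fun k ω =>
    (secondMoment (V k ω))⁻¹.mulVec (scaledSum (V k ω)) ⬝ᵥ scaledSum (V k ω) with hQ
  have Q_eq : ∀ k ω, Q k ω = nm k ω +
      ∑ a, ∑ b, (m a k ω * m b k ω) * (D a b k ω - (1 : Matrix (Fin 2) (Fin 2) ℝ) a b) := by
    intro k ω
    simp [hQ, hnm, hD, hm, Matrix.mulVec, dotProduct, Fin.sum_univ_two]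
    ring
  -- the base facts, and their consequences along subsequences
  have base : ∀ i : (Fin 2 × Fin 2) ⊕ (Fin 2 × Fin 2) ⊕ Bool,
      TendstoInMeasure μ (Sum.elim (fun q => S q.1 q.2) (Sum.elim
        (fun q k ω => (m q.1 k ω * m q.2 k ω) *
          (D q.1 q.2 k ω - (1 : Matrix (Fin 2) (Fin 2) ℝ) q.1 q.2))
        (fun b => cond b ep fun k ω => nm k ω * ep k ω)) i) atTop
        (fun _ => Sum.elim (fun q => (1 : Matrix (Fin 2) (Fin 2) ℝ) q.1 q.2) (fun _ => (0 : ℝ)) i) := by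
    rintro (q | q | b)
    · exact hS q.1 q.2
    · exact hmmD q.1 q.2
    · cases b
      · exact hnmep
      · exact hep0
  have pointwise : ∀ ω (ns : ℕ → ℕ), StrictMono ns →
      (∀ i : (Fin 2 × Fin 2) ⊕ (Fin 2 × Fin 2) ⊕ Bool, Tendsto (fun n =>
        Sum.elim (fun q => S q.1 q.2) (Sum.elim
        (fun q k ω => (m q.1 k ω * m q.2 k ω) *
          (D q.1 q.2 k ω - (1 : Matrix (Fin 2) (Fin 2) ℝ) q.1 q.2))
        (fun b => cond b ep fun k ω => nm k ω * ep k ω)) i (ns n) ω) atTop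
        (𝓝 (Sum.elim (fun q => (1 : Matrix (Fin 2) (Fin 2) ℝ) q.1 q.2) (fun _ => (0 : ℝ)) i))) →
      (∀ᶠ n in atTop, 0 < elRatio (V (ns n) ω)) ∧
        Tendsto (fun n => -2 * Real.log (elRatio (V (ns n) ω)) - nm (ns n) ω) atTop (𝓝 0) := by
    intro ω ns hns hc
    have hSc := fun a b => hc (Sum.inl (a, b))
    have hmc := fun a b => hc (Sum.inr (Sum.inl (a, b)))
    have he := hc (Sum.inr (Sum.inr true))
    have hne := hc (Sum.inr (Sum.inr false))
    simp only [Sum.elim_inl, Sum.elim_inr, cond_true, cond_false] at hSc hmc he hne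
    have hdet : Tendsto (fun n => (secondMoment (V (ns n) ω)).det) atTop (𝓝 1) := by
      simp only [Matrix.det_fin_two]
      have := ((hSc 0 0).mul (hSc 1 1)).sub ((hSc 0 1).mul (hSc 1 0))
      simpa using this
    have hQn : Tendsto (fun n => Q (ns n) ω - nm (ns n) ω) atTop (𝓝 0) := by
      simp_rw [Q_eq, add_sub_cancel_left]
      have := tendsto_finsetSum (s := Finset.univ) (a := fun _ : Fin 2 => (0 : ℝ))
        (f := fun a n => ∑ b, (m a (ns n) ω * m b (ns n) ω) *
          (D a b (ns n) ω - (1 : Matrix (Fin 2) (Fin 2) ℝ) a b)) fun a _ => by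
          have := tendsto_finsetSum (s := Finset.univ) (a := fun _ : Fin 2 => (0 : ℝ))
            (f := fun b n => (m a (ns n) ω * m b (ns n) ω) *
          (D a b (ns n) ω - (1 : Matrix (Fin 2) (Fin 2) ℝ) a b)) fun b _ => hmc a b
          simpa using this
      simpa using this
    have hQe : Tendsto (fun n => 4 * ep (ns n) ω * Q (ns n) ω) atTop (𝓝 0) := by
      have e : ∀ n, 4 * ep (ns n) ω * Q (ns n) ω =
          4 * (nm (ns n) ω * ep (ns n) ω + ep (ns n) ω * (Q (ns n) ω - nm (ns n) ω)) := by
        intro n; ring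
      simp_rw [e]
      simpa using (hne.add (he.mul hQn)).const_mul 4
    have hev : ∀ᶠ n in atTop, 0 < elRatio (V (ns n) ω) ∧
        |(-2 * Real.log (elRatio (V (ns n) ω))) - Q (ns n) ω| ≤ 4 * ep (ns n) ω * Q (ns n) ω := by
      filter_upwards [hdet.eventually_ne (one_ne_zero), he.eventually_le_const
        (show (0 : ℝ) < 1 / 2 by norm_num),
        (hcard.comp hns.tendsto_atTop).eventually_ge_atTop 1] with n h1 h2 h3
      have : Nonempty (ι (ns n)) := Fintype.card_pos_iff.1 h3
      exact elRatio_approx (V (ns n) ω) h1 rfl h2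
    refine ⟨hev.mono fun n h => h.1, ?_⟩
    have h1 : Tendsto (fun n => -2 * Real.log (elRatio (V (ns n) ω)) - Q (ns n) ω) atTop (𝓝 0) :=
      squeeze_zero_norm' (hev.mono fun n h => h.2) hQe
    simpa using h1.add hQn
  have melr : ∀ k, Measurable fun ω => elRatio (V k ω) := fun k => measurable_elRatio.comp (hV k)
  have mlog : ∀ k, Measurable fun ω => -2 * Real.log (elRatio (V k ω)) := fun k =>
    (Real.measurable_log.comp (melr k)).const_mul _
  have hT : TendstoInMeasure μ (fun k ω => -2 * Real.log (elRatio (V k ω)) - nm k ω) atTop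
      (fun _ => 0) :=
    tendstoInMeasure_of_forall_subseq base
      (fun n => ((mlog n).sub (mnm n)).aestronglyMeasurable)
      (ae_of_all _ fun ω ns hns hc => (pointwise ω ns hns hc).2)
  -- The real number `-2 log R` takes the default value `0` at `R = 0`, where the statistic is `⊤`.
  -- The event `R = 0` has vanishing probability, so the discrepancy does not affect the limit law.
  have hI : TendstoInMeasure μ (fun k ω => if 0 < elRatio (V k ω) then (0 : ℝ) else 1) atTop
      (fun _ => 0) := by
    refine tendstoInMeasure_of_forall_subseq base
      (fun n => (Measurable.ite (measurableSet_lt measurable_const (melr n)) measurable_const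
        measurable_const).aestronglyMeasurable)
      (ae_of_all _ fun ω ns hns hc => ?_)
    refine tendsto_const_nhds.congr' ((pointwise ω ns hns hc).1.mono fun n h => ?_)
    simp [h]
  have hreal : TendstoInDistribution (fun k ω => -2 * Real.log (elRatio (V k ω))) atTop
      (fun x : Fin 2 → ℝ => ∑ a, x a ^ 2) (fun _ => μ) (Measure.pi fun _ => gaussianReal 0 1) :=
    tendstoInDistribution_of_tendstoInMeasure_sub _ _ hnmd hT fun k => (mlog k).aemeasurable
  have hE := hreal.continuous_comp (g := fun x : ℝ => (x : EReal)) continuous_coe_real_ereal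
  refine tendstoInDistribution_of_tendsto_measure_ne
    (X := fun k ω => ((-2 * Real.log (elRatio (V k ω)) : ℝ) : EReal)) ?_
    (fun k => (measurable_negTwoLog.comp (melr k)).aemeasurable) ?_
  · refine tendstoInDistribution_congr_limit hE measurable_coe_real_ereal.aemeasurable ?_
    rw [chiSquare, Measure.map_map measurable_coe_real_ereal (by fun_prop)]
  · rw [tendstoInMeasure_iff_norm] at hI
    refine tendsto_of_tendsto_of_tendsto_of_le_of_le tendsto_const_nhds (hI 1 one_pos)
      (fun _ => zero_le) (fun n => measure_mono fun ω hω => ?_)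
    simp only [Set.mem_ofPred_eq, ne_eq] at hω ⊢
    by_cases hp : 0 < elRatio (V n ω)
    · exact absurd (by simp [negTwoLog, hp]) hω
    · simp [hp]

/-- **Wilks' theorem** for the empirical likelihood of vectors for which the normalized sums are
asymptotically normal with the limit of the second moments as covariance. -/
theorem tendstoInDistribution_negTwoLog_elRatio
    (hV : ∀ k, Measurable (V k))
    (hcard : Tendsto (fun k => Fintype.card (ι k)) atTop atTop)
    {A C : Matrix (Fin 2) (Fin 2) ℝ} (hA : IsUnit A) (hAC : A * C * A.transpose = 1)
    (hsum : TendstoInDistribution (fun k ω => A.mulVec (scaledSum (V k ω))) atTop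
      (fun x : Fin 2 → ℝ => x) (fun _ => μ) (Measure.pi fun _ => gaussianReal 0 1))
    (hS : ∀ a b, TendstoInMeasure μ (fun k ω => secondMoment (V k ω) a b) atTop
      (fun _ => C a b))
    (hmax : TendstoInMeasure μ (fun k ω => ‖V k ω‖ / √(Fintype.card (ι k) : ℝ)) atTop
      (fun _ => 0)) :
    TendstoInDistribution (fun k ω => negTwoLog (elRatio (V k ω))) atTop
      (fun x : ℝ => (x : EReal)) (fun _ => μ) (chiSquare 2) := by
  -- The ratio is unchanged when all vectors are multiplied by the invertible `A`, and the second
  -- moments of the new vectors tend to `A * C * A.transpose = 1`. This reduces the claim to the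
  -- standard case.
  have hV' : ∀ k, Measurable fun ω => fun i => A.mulVec (V k ω i) := by
    intro k
    refine measurable_pi_lambda _ fun i => measurable_pi_lambda _ fun a => ?_
    simp only [Matrix.mulVec, dotProduct]
    have h := hV k
    fun_prop
  have hs : ∀ k ω, scaledSum (fun i => A.mulVec (V k ω i)) = A.mulVec (scaledSum (V k ω)) := by
    intro k ω
    ext a
    simp only [scaledSum, Matrix.mulVec, dotProduct, Fin.sum_univ_two, Finset.sum_add_distrib,
      ← Finset.mul_sum]
    ring
  have hSM : ∀ k ω, secondMoment (fun i => A.mulVec (V k ω i)) =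
      A * secondMoment (V k ω) * A.transpose := by
    intro k ω
    ext a b
    simp only [secondMoment, Matrix.mulVec, dotProduct, Fin.sum_univ_two, Matrix.mul_apply,
      Matrix.of_apply, Matrix.transpose_apply]
    have e : ∀ i, (A a 0 * V k ω i 0 + A a 1 * V k ω i 1) *
        (A b 0 * V k ω i 0 + A b 1 * V k ω i 1) =
        A a 0 * A b 0 * (V k ω i 0 * V k ω i 0) + A a 0 * A b 1 * (V k ω i 0 * V k ω i 1) +
        A a 1 * A b 0 * (V k ω i 1 * V k ω i 0) + A a 1 * A b 1 * (V k ω i 1 * V k ω i 1) := by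
      intro i; ring
    simp_rw [e]
    simp only [Finset.sum_add_distrib, ← Finset.mul_sum]
    ring
  have key := tendstoInDistribution_negTwoLog_elRatio_of_standard (μ := μ)
    (V := fun k ω i => A.mulVec (V k ω i)) hV' hcard (by simpa only [hs] using hsum) ?_ ?_
  · simpa only [elRatio_mulVec A hA] using key
  · intro a b
    refine tendstoInMeasure_of_forall_subseq (I := Fin 2 × Fin 2)
      (X := fun q k ω => secondMoment (V k ω) q.1 q.2) (c := fun q => C q.1 q.2)
      (fun q => hS q.1 q.2)
      (fun n => ((measurable_secondMoment a b).comp (hV' n)).aestronglyMeasurable)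
      (ae_of_all _ fun ω ns _ hc => ?_)
    have hc' : ∀ a b, Tendsto (fun n => secondMoment (V (ns n) ω) a b) atTop (𝓝 (C a b)) :=
      fun a b => hc (a, b)
    simp only [hSM, ← hAC]
    simp only [Matrix.mul_apply, Matrix.transpose_apply]
    exact tendsto_finsetSum _ fun c _ => (tendsto_finsetSum _ fun d _ =>
      (hc' d c).const_mul _).mul_const _
  · set K : ℝ := ∑ a, ∑ b, |A a b|
    refine tendstoInMeasure_of_forall_subseq (I := Unit)
      (X := fun _ k ω => ‖V k ω‖ / √(Fintype.card (ι k) : ℝ)) (fun _ => hmax)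
      (fun n => ((measurable_norm.comp (hV' n)).div_const _).aestronglyMeasurable)
      (ae_of_all _ fun ω ns _ hc => ?_)
    refine squeeze_zero (fun n => by positivity) (fun n => ?_)
      (g := fun n => K * (‖V (ns n) ω‖ / √(Fintype.card (ι (ns n)) : ℝ)))
      (by simpa using (hc ()).const_mul K)
    rw [← mul_div_assoc]
    refine div_le_div_of_nonneg_right ?_ (Real.sqrt_nonneg _)
    have hK : 0 ≤ K := Finset.sum_nonneg fun a _ => Finset.sum_nonneg fun b _ => abs_nonneg _
    refine (pi_norm_le_iff_of_nonneg (by positivity)).2 fun i =>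
      (pi_norm_le_iff_of_nonneg (by positivity)).2 fun a => ?_
    have hVb : ∀ b, |V (ns n) ω i b| ≤ ‖V (ns n) ω‖ := fun b =>
      (norm_le_pi_norm (V (ns n) ω i) b).trans (norm_le_pi_norm (V (ns n) ω) i)
    calc ‖A.mulVec (V (ns n) ω i) a‖ = ‖∑ b, A a b * V (ns n) ω i b‖ := rfl
      _ ≤ ∑ b, ‖A a b * V (ns n) ω i b‖ := norm_sum_le _ _
      _ ≤ ∑ b, |A a b| * ‖V (ns n) ω‖ := Finset.sum_le_sum fun b _ => by
          rw [norm_mul]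
          exact mul_le_mul_of_nonneg_left (hVb b) (abs_nonneg _)
      _ = (∑ b, |A a b|) * ‖V (ns n) ω‖ := (Finset.sum_mul _ _ _).symm
      _ ≤ K * ‖V (ns n) ω‖ := by
          refine mul_le_mul_of_nonneg_right ?_ (norm_nonneg _)
          exact Finset.single_le_sum (f := fun a => ∑ b, |A a b|)
            (fun a _ => Finset.sum_nonneg fun b _ => abs_nonneg _) (Finset.mem_univ a)

end Wilks

end GiniJEL

/-! ### Algebra of U-statistics and their deletions. -/

namespace GiniJEL

section Algebra

variable {m : ℕ}

/-- The `U`-statistic with the values `f i j` of the kernel, computed from the indices in `A`. -/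
noncomputable def ustat (f : Fin m → Fin m → ℝ) (A : Finset (Fin m)) : ℝ :=
  (A.card.choose 2 : ℝ)⁻¹ * ∑ i ∈ A, ∑ j ∈ A with i < j, f i j

/-- The mean of the values `f i j` of the kernel over `j ≠ i`. -/
noncomputable def rowMean (f : Fin m → Fin m → ℝ) (i : Fin m) : ℝ :=
  ((m : ℝ) - 1)⁻¹ * ∑ j ∈ Finset.univ.erase i, f i j

/-- Over a full square with zero diagonal, the deletion of an observation becomes the removal of a
row and a column. -/
lemma two_mul_sum_pairs (f : Fin m → Fin m → ℝ) (hf : ∀ i j, f i j = f j i) (A : Finset (Fin m)) :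
    2 * ∑ i ∈ A, ∑ j ∈ A with i < j, f i j =
      ∑ i ∈ A, ∑ j ∈ A, if i = j then 0 else f i j := by
  have h1 : ∑ i ∈ A, ∑ j ∈ A with i < j, f i j = ∑ i ∈ A, ∑ j ∈ A, if i < j then f i j else 0 := by
    simp only [Finset.sum_filter]
  have h2 : ∑ i ∈ A, ∑ j ∈ A, (if i < j then f i j else 0) =
      ∑ i ∈ A, ∑ j ∈ A, if j < i then f i j else 0 := by
    rw [Finset.sum_comm]
    simp only [hf]
  rw [two_mul]
  nth_rewrite 2 [h1]
  rw [h2, h1, ← Finset.sum_add_distrib]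
  refine Finset.sum_congr rfl fun i _ => ?_
  rw [← Finset.sum_add_distrib]
  refine Finset.sum_congr rfl fun j _ => ?_
  rcases lt_trichotomy i j with h | h | h
  · simp [h, h.not_gt, h.ne]
  · simp [h]
  · simp [h, h.not_gt, h.ne']

lemma sum_erase_eq_sum_ite (f : Fin m → Fin m → ℝ) (i : Fin m) :
    ∑ j ∈ Finset.univ.erase i, f i j = ∑ j, if i = j then 0 else f i j := by
  rw [← Finset.sum_erase (a := i) Finset.univ (f := fun j => if i = j then 0 else f i j) (by simp)]
  refine Finset.sum_congr rfl fun j hj => ?_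
  rw [if_neg (Finset.ne_of_mem_erase hj).symm]

lemma sum_pairs_univ (f : Fin m → Fin m → ℝ) (hf : ∀ i j, f i j = f j i) (hm : 2 ≤ m) :
    ∑ i, ∑ j with i < j, f i j = ((m : ℝ) - 1) / 2 * ∑ i, rowMean f i := by
  have h := two_mul_sum_pairs f hf Finset.univ
  have hm' : (2 : ℝ) ≤ m := by exact_mod_cast hm
  have hne : (m : ℝ) - 1 ≠ 0 := by linarith
  simp only [rowMean, sum_erase_eq_sum_ite, ← Finset.mul_sum, ← h]
  field_simp

lemma ustat_univ (f : Fin m → Fin m → ℝ) (hf : ∀ i j, f i j = f j i) (hm : 2 ≤ m) :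
    ustat f Finset.univ = (m : ℝ)⁻¹ * ∑ i, rowMean f i := by
  have hm' : (2 : ℝ) ≤ m := by exact_mod_cast hm
  have hne : (m : ℝ) - 1 ≠ 0 := by linarith
  have hne0 : (m : ℝ) ≠ 0 := by linarith
  rw [ustat, sum_pairs_univ f hf hm, Finset.card_univ, Fintype.card_fin, Nat.cast_choose_two]
  field_simp

/-- The effect of the deletion of an observation on a `U`-statistic. -/
lemma ustat_univ_sub_erase (f : Fin m → Fin m → ℝ) (hf : ∀ i j, f i j = f j i) (hm : 3 ≤ m)
    (i : Fin m) :
    ustat f Finset.univ - ustat f (Finset.univ.erase i) =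
      2 / ((m : ℝ) - 2) * (rowMean f i - ustat f Finset.univ) := by
  have hm' : (3 : ℝ) ≤ m := by exact_mod_cast hm
  have hne : (m : ℝ) - 1 ≠ 0 := by linarith
  have hne2 : (m : ℝ) - 2 ≠ 0 := by linarith
  have hne3 : (m : ℝ) - 1 - 1 ≠ 0 := by linarith
  have hne0 : (m : ℝ) ≠ 0 := by linarith
  set F : Fin m → Fin m → ℝ := fun i j => if i = j then 0 else f i j with hF
  have hFs : ∀ i j, F i j = F j i := by
    intro i j
    simp only [hF, hf i j, eq_comm]
  have hU := two_mul_sum_pairs f hf Finset.univ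
  have hE := two_mul_sum_pairs f hf (Finset.univ.erase i)
  have hrow : rowMean f i = ((m : ℝ) - 1)⁻¹ * ∑ j, F i j := by
    rw [rowMean, sum_erase_eq_sum_ite]
  -- Row and column `i` have equal sums by symmetry, and their common entry is on the zero diagonal,
  -- so nothing is subtracted twice.
  have hexp : ∑ a ∈ Finset.univ.erase i, ∑ b ∈ Finset.univ.erase i, F a b =
      ∑ a, ∑ b, F a b - 2 * ∑ b, F i b := by
    have h1 : ∀ a, ∑ b ∈ Finset.univ.erase i, F a b = ∑ b, F a b - F a i := fun a =>
      Finset.sum_erase_eq_sub (Finset.mem_univ i)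
    simp_rw [h1]
    rw [Finset.sum_erase_eq_sub (Finset.mem_univ i), Finset.sum_sub_distrib]
    have h2 : ∑ a, F a i = ∑ b, F i b := Finset.sum_congr rfl fun a _ => hFs a i
    have h3 : F i i = 0 := by simp [hF]
    rw [h2, h3]
    ring
  change _ = ∑ a ∈ Finset.univ.erase i, ∑ b ∈ Finset.univ.erase i, F a b at hE
  change _ = ∑ a, ∑ b, F a b at hU
  rw [hexp] at hE
  have e1 : ustat f Finset.univ = (m * (m - 1) : ℝ)⁻¹ * ∑ a, ∑ b, F a b := by
    rw [ustat, ← hU, Finset.card_univ, Fintype.card_fin, Nat.cast_choose_two]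
    field_simp
  have e2 : ustat f (Finset.univ.erase i) = ((m - 1) * (m - 2) : ℝ)⁻¹ *
      (∑ a, ∑ b, F a b - 2 * ∑ b, F i b) := by
    rw [ustat, ← hE, Finset.card_erase_of_mem (Finset.mem_univ i), Finset.card_univ,
      Fintype.card_fin, Nat.cast_choose_two, Nat.cast_sub (by omega)]
    push_cast
    field_simp
    ring
  rw [e1, e2, hrow]
  field_simp
  ring

/-- A U-statistic is the average of its row means. Consequently the jackknife corrections cancel
within each sample and the pseudo-values average to the statistic. -/
lemma sum_rowMean_sub_ustat (f : Fin m → Fin m → ℝ) (hf : ∀ i j, f i j = f j i) (hm : 2 ≤ m) :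
    ∑ i, (rowMean f i - ustat f Finset.univ) = 0 := by
  have hm' : (2 : ℝ) ≤ m := by exact_mod_cast hm
  have hne0 : (m : ℝ) ≠ 0 := by linarith
  rw [Finset.sum_sub_distrib, ustat_univ f hf hm]
  simp
  field_simp
  ring

end Algebra

/-! ### Orthogonality of degenerate kernels. -/

section Orthogonality

variable {Ω : Type*} [MeasurableSpace Ω] {μ : Measure Ω}

lemma integral_sq_sum_of_orthogonal {I : Type*} (s : Finset I) {f : I → Ω → ℝ}
    (hf : ∀ i ∈ s, MemLp (f i) 2 μ)
    (h : ∀ i ∈ s, ∀ j ∈ s, i ≠ j → ∫ ω, f i ω * f j ω ∂μ = 0) :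
    ∫ ω, (∑ i ∈ s, f i ω) ^ 2 ∂μ = ∑ i ∈ s, ∫ ω, f i ω ^ 2 ∂μ := by
  classical
  have hint : ∀ i ∈ s, ∀ j ∈ s, Integrable (fun ω => f i ω * f j ω) μ := fun i hi j hj =>
    (hf i hi).integrable_mul (hf j hj)
  simp_rw [sq, Finset.sum_mul_sum]
  rw [integral_finsetSum _ fun i hi => integrable_finsetSum _ fun j hj => hint i hi j hj]
  refine Finset.sum_congr rfl fun i hi => ?_
  rw [integral_finsetSum _ fun j hj => hint i hi j hj]
  exact Finset.sum_eq_single_of_mem i hi fun j hj hji => h i hi j hj hji.symm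

variable {E : Type*} [MeasurableSpace E] {P : Measure E}
  [IsProbabilityMeasure μ] {Z : ℕ → Ω → E}

/-- Independent measurable random variables with law `P`. -/
structure IsIID (P : Measure E) (Z : ℕ → Ω → E) (μ : Measure Ω) : Prop where
  measurable : ∀ i, Measurable (Z i)
  map_eq : ∀ i, μ.map (Z i) = P
  indep : iIndepFun Z μ

/-- A square integrable kernel with integral zero in the second variable. -/
structure IsDegenerate (P : Measure E) (q : E → E → ℝ) : Prop where
  measurable : Measurable (Function.uncurry q)
  memLp : MemLp (Function.uncurry q) 2 (P.prod P)
  integral_eq : ∀ z, ∫ w, q z w ∂P = 0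

lemma IsIID.map_pair (hZ : IsIID P Z μ) {i j : ℕ} (hij : i ≠ j) :
    μ.map (fun ω => (Z i ω, Z j ω)) = P.prod P := by
  rw [(indepFun_iff_map_prod_eq_prod_map_map (hZ.measurable i).aemeasurable
    (hZ.measurable j).aemeasurable).1 (hZ.indep.indepFun hij), hZ.map_eq, hZ.map_eq]

lemma IsIID.memLp_pair (hZ : IsIID P Z μ) {q : E → E → ℝ}
    (hq : MemLp (Function.uncurry q) 2 (P.prod P)) {i j : ℕ} (hij : i ≠ j) :
    MemLp (fun ω => q (Z i ω) (Z j ω)) 2 μ := by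
  rw [← hZ.map_pair hij] at hq
  exact hq.comp_of_map ((hZ.measurable i).prodMk (hZ.measurable j)).aemeasurable

lemma IsIID.integral_pair (hZ : IsIID P Z μ) {q : E × E → ℝ} (hq : Measurable q)
    {i j : ℕ} (hij : i ≠ j) :
    ∫ ω, q (Z i ω, Z j ω) ∂μ = ∫ v, q v ∂(P.prod P) := by
  rw [← hZ.map_pair hij, integral_map
    ((hZ.measurable i).prodMk (hZ.measurable j)).aemeasurable hq.aestronglyMeasurable]

lemma IsIID.integral_sq_pair (hZ : IsIID P Z μ) {q : E → E → ℝ}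
    (hq : Measurable (Function.uncurry q)) {i j : ℕ} (hij : i ≠ j) :
    ∫ ω, q (Z i ω) (Z j ω) ^ 2 ∂μ = ∫ v, Function.uncurry q v ^ 2 ∂(P.prod P) :=
  hZ.integral_pair (q := fun v => Function.uncurry q v ^ 2) (hq.pow_const 2) hij

variable [IsProbabilityMeasure P]

/-- The variable `Z l` occurs in one factor only, as second argument, and is independent of the
others; integrating it out first gives zero by degeneracy. -/
lemma IsIID.integral_mul_eq_zero (hZ : IsIID P Z μ) {q : E → E → ℝ} (hq : IsDegenerate P q)
    {i j k l : ℕ} (hij : i ≠ j) (hkl : k ≠ l) (hli : l ≠ i) (hlj : l ≠ j) :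
    ∫ ω, q (Z i ω) (Z j ω) * q (Z k ω) (Z l ω) ∂μ = 0 := by
  classical
  -- The index `k` may coincide with `i` or `j`; only independence of this block from `Z l` matters.
  set S : Finset ℕ := {i, j, k}
  have hST : Disjoint S {l} := by
    simp [S, hli, hlj, hkl.symm]
  have hI := hZ.indep.indepFun_finset S {l} hST hZ.measurable
  let φ : (S → E) → E × E × E := fun x =>
    (x ⟨i, by simp [S]⟩, x ⟨j, by simp [S]⟩, x ⟨k, by simp [S]⟩)
  let ψ : (({l} : Finset ℕ) → E) → E := fun x => x ⟨l, by simp⟩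
  have hφ : Measurable φ := by fun_prop
  have hψ : Measurable ψ := by fun_prop
  have hI2 : IndepFun (fun ω => (Z i ω, Z j ω, Z k ω)) (Z l) μ := hI.comp hφ hψ
  have hX : Measurable fun ω => (Z i ω, Z j ω, Z k ω) :=
    (hZ.measurable i).prodMk ((hZ.measurable j).prodMk (hZ.measurable k))
  have hmap := (indepFun_iff_map_prod_eq_prod_map_map hX.aemeasurable
    (hZ.measurable l).aemeasurable).1 hI2
  rw [hZ.map_eq] at hmap
  let F : (E × E × E) × E → ℝ := fun x => q x.1.1 x.1.2.1 * q x.1.2.2 x.2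
  have hF : Measurable F := by
    refine (hq.measurable.comp (g := Function.uncurry q)
      (f := fun x : (E × E × E) × E => (x.1.1, x.1.2.1)) (by fun_prop)).mul
      (hq.measurable.comp (g := Function.uncurry q)
      (f := fun x : (E × E × E) × E => (x.1.2.2, x.2)) (by fun_prop))
  have hpair : Measurable fun ω => ((Z i ω, Z j ω, Z k ω), Z l ω) := hX.prodMk (hZ.measurable l)
  have hint : Integrable F ((μ.map fun ω => (Z i ω, Z j ω, Z k ω)).prod P) := by
    rw [← hmap, integrable_map_measure hF.aestronglyMeasurable hpair.aemeasurable]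
    exact (hZ.memLp_pair hq.memLp hij).integrable_mul (hZ.memLp_pair hq.memLp hkl)
  have : IsProbabilityMeasure (μ.map fun ω => (Z i ω, Z j ω, Z k ω)) :=
    Measure.isProbabilityMeasure_map hX.aemeasurable
  calc ∫ ω, q (Z i ω) (Z j ω) * q (Z k ω) (Z l ω) ∂μ
      = ∫ x, F x ∂(μ.map fun ω => ((Z i ω, Z j ω, Z k ω), Z l ω)) :=
        (integral_map hpair.aemeasurable hF.aestronglyMeasurable).symm
    _ = ∫ x, ∫ y, F (x, y) ∂P ∂(μ.map fun ω => (Z i ω, Z j ω, Z k ω)) := by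
        rw [hmap, integral_prod _ hint]
    _ = 0 := by
        simp only [F, integral_const_mul, hq.integral_eq, mul_zero, integral_zero]

/-- The second moment of a row sum of a degenerate kernel. -/
lemma IsIID.integral_sq_sum_row (hZ : IsIID P Z μ) {q : E → E → ℝ} (hq : IsDegenerate P q) {m : ℕ}
    (i : Fin m) :
    ∫ ω, (∑ j ∈ Finset.univ.erase i, q (Z i ω) (Z j ω)) ^ 2 ∂μ =
      ((m : ℝ) - 1) * ∫ v, Function.uncurry q v ^ 2 ∂(P.prod P) := by
  have hval : ∀ j ∈ Finset.univ.erase i, (i : ℕ) ≠ j := fun j hj h =>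
    Finset.ne_of_mem_erase hj (Fin.ext h.symm)
  rw [integral_sq_sum_of_orthogonal _ (fun j hj => hZ.memLp_pair hq.memLp (hval j hj))]
  · rw [Finset.sum_congr rfl fun j hj => hZ.integral_sq_pair hq.measurable (hval j hj)]
    rw [Finset.sum_const, Finset.card_erase_of_mem (Finset.mem_univ i), Finset.card_univ,
      Fintype.card_fin, nsmul_eq_mul, Nat.cast_pred i.pos]
  · intro j hj l hl hjl
    exact hZ.integral_mul_eq_zero hq (hval j hj) (hval l hl) (hval l hl).symm
      fun h => hjl (Fin.ext h.symm)

/-- The second moment of a degenerate `U`-statistic. -/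
lemma IsIID.integral_sq_sum_pairs (hZ : IsIID P Z μ) {q : E → E → ℝ} (hq : IsDegenerate P q)
    (hs : ∀ z w, q z w = q w z) {m : ℕ} (hm : 2 ≤ m) :
    ∫ ω, (∑ i : Fin m, ∑ j : Fin m with i < j, q (Z i ω) (Z j ω)) ^ 2 ∂μ =
      (m : ℝ) * (m - 1) / 2 * ∫ v, Function.uncurry q v ^ 2 ∂(P.prod P) := by
  have hval : ∀ i j : Fin m, i < j → (i : ℕ) ≠ j := fun i j h => (Fin.lt_def.1 h).ne
  simp_rw [Finset.sum_sigma']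
  rw [integral_sq_sum_of_orthogonal]
  · rw [Finset.sum_congr rfl fun (p : (_ : Fin m) × Fin m) hp =>
      hZ.integral_sq_pair hq.measurable (hval p.1 p.2 (by simpa using hp))]
    -- The number of pairs is obtained from `sum_pairs_univ` for a constant kernel.
    rw [← Finset.sum_sigma' (f := fun _ _ => ∫ v, Function.uncurry q v ^ 2 ∂(P.prod P)),
      sum_pairs_univ _ (fun _ _ => rfl) hm]
    have hm' : (2 : ℝ) ≤ m := by exact_mod_cast hm
    have hne : (m : ℝ) - 1 ≠ 0 := by linarith
    have hr : ∀ i : Fin m, rowMean (fun _ _ => ∫ v, Function.uncurry q v ^ 2 ∂(P.prod P)) i =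
        ∫ v, Function.uncurry q v ^ 2 ∂(P.prod P) := by
      intro i
      rw [rowMean, Finset.sum_const, Finset.card_erase_of_mem (Finset.mem_univ i),
        Finset.card_univ, Fintype.card_fin, nsmul_eq_mul, Nat.cast_pred i.pos]
      field_simp
    simp_rw [hr]
    simp
    ring
  · intro p hp
    exact hZ.memLp_pair hq.memLp (hval p.1 p.2 (by simpa using hp))
  · rintro ⟨i, j⟩ hij ⟨k, l⟩ hkl hne
    simp only [Finset.mem_sigma, Finset.mem_univ, true_and, Finset.mem_filter] at hij hkl
    -- Two distinct increasing pairs cannot contain the same indices, so `k` or `l` is absent from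
    -- `(i, j)`. If it is only `k`, the symmetry of `q` moves it to the second place.
    by_cases h : l = i ∨ l = j
    · have hk : (k : ℕ) ≠ i ∧ (k : ℕ) ≠ j := by
        have hkl' := Fin.lt_def.1 hkl
        have hij' := Fin.lt_def.1 hij
        rcases h with rfl | rfl
        · omega
        · refine ⟨fun h => hne ?_, by omega⟩
          have : k = i := Fin.ext h
          rw [this]
      simp_rw [hs (Z k _) (Z l _)]
      exact hZ.integral_mul_eq_zero hq (hval i j hij) (hval k l hkl).symm hk.1 hk.2
    · push Not at h
      exact hZ.integral_mul_eq_zero hq (hval i j hij) (hval k l hkl)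
        (fun e => h.1 (Fin.ext e)) (fun e => h.2 (Fin.ext e))

end Orthogonality

end GiniJEL

/-! ### Hoeffding projections and one-sample limit theorems. -/

namespace GiniJEL

variable {Ω : Type*} [MeasurableSpace Ω] {μ : Measure Ω}
  {E : Type*} [MeasurableSpace E] {P : Measure E}

/-- The conditional mean of the kernel `h` given its first argument. -/
noncomputable def proj (P : Measure E) (h : E → E → ℝ) (z : E) : ℝ := ∫ w, h z w ∂P

/-- The mean of the kernel `h`. -/
noncomputable def kmean (P : Measure E) (h : E → E → ℝ) : ℝ := ∫ z, proj P h z ∂P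

/-- A symmetric square integrable kernel. -/
structure IsSymmKernel (P : Measure E) (h : E → E → ℝ) : Prop where
  measurable : Measurable (Function.uncurry h)
  symm : ∀ z w, h z w = h w z
  memLp : MemLp (Function.uncurry h) 2 (P.prod P)
  -- Required at every `z`, so that the centered kernels below integrate to zero at every point and
  -- not just almost everywhere.
  integrable : ∀ z, Integrable (h z) P

section Kernel

variable [IsProbabilityMeasure P] {h : E → E → ℝ}

lemma sq_integral_le_integral_sq {f : E → ℝ} (hf : MemLp f 2 P) :
    (∫ x, f x ∂P) ^ 2 ≤ ∫ x, f x ^ 2 ∂P := by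
  have h1 := variance_nonneg f P
  rw [variance_eq_sub hf] at h1
  simpa using h1

lemma IsSymmKernel.measurable_proj (hh : IsSymmKernel P h) : Measurable (proj P h) :=
  (hh.measurable.stronglyMeasurable.integral_prod_right' (ν := P)).measurable

/-- Jensen's inequality on almost every section of `h`, followed by Fubini. -/
lemma IsSymmKernel.memLp_proj (hh : IsSymmKernel P h) : MemLp (proj P h) 2 P := by
  rw [memLp_two_iff_integrable_sq hh.measurable_proj.aestronglyMeasurable]
  have hi := hh.memLp.integrable_sq
  refine hi.integral_prod_left.mono' (hh.measurable_proj.pow_const 2).aestronglyMeasurable ?_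
  filter_upwards [hi.prod_right_ae] with z hz
  rw [Real.norm_eq_abs, abs_of_nonneg (sq_nonneg _)]
  refine sq_integral_le_integral_sq ?_
  rw [memLp_two_iff_integrable_sq (hh.integrable z).aestronglyMeasurable]
  exact hz

lemma IsSymmKernel.integrable_proj (hh : IsSymmKernel P h) : Integrable (proj P h) P :=
  hh.memLp_proj.integrable (by norm_num)

/-- Centering in the second variable alone is enough for row sums, in which the first argument stays
fixed. The resulting kernel is in general not symmetric. -/
lemma IsSymmKernel.isDegenerate_sub_proj (hh : IsSymmKernel P h) :
    IsDegenerate P fun z w => h z w - proj P h z where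
  measurable := hh.measurable.sub (hh.measurable_proj.comp measurable_fst)
  memLp := hh.memLp.sub (hh.memLp_proj.comp_fst P)
  integral_eq z := by
    rw [integral_sub (hh.integrable z) (integrable_const _)]
    simp [proj]

/-- The second order Hoeffding component: unlike the one-sided centering it inherits the symmetry of
`h`, as needed for sums over all pairs. -/
lemma IsSymmKernel.isDegenerate_hoeffding (hh : IsSymmKernel P h) :
    IsDegenerate P fun z w => h z w - proj P h z - proj P h w + kmean P h where
  measurable := ((hh.measurable.sub (hh.measurable_proj.comp measurable_fst)).sub
    (hh.measurable_proj.comp measurable_snd)).add_const _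
  memLp := ((hh.memLp.sub (hh.memLp_proj.comp_fst P)).sub (hh.memLp_proj.comp_snd P)).add
    (memLp_const _)
  integral_eq z := by
    have h1 : Integrable (fun w => h z w - proj P h z) P :=
      (hh.integrable z).sub (integrable_const _)
    have h2 : Integrable (fun w => h z w - proj P h z - proj P h w) P := h1.sub hh.integrable_proj
    rw [integral_add h2 (integrable_const _),
      integral_sub h1 hh.integrable_proj, hh.isDegenerate_sub_proj.integral_eq z]
    simp [kmean]

end Kernel

section LimitTheorems

variable {Z : ℕ → Ω → E} {h : E → E → ℝ}

lemma IsIID.identDistrib_comp (hZ : IsIID P Z μ) {φ : E → ℝ} (hφ : Measurable φ) (i : ℕ) :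
    IdentDistrib (fun ω => φ (Z i ω)) (fun ω => φ (Z 0 ω)) μ μ := by
  have : IdentDistrib (Z i) (Z 0) μ μ :=
    ⟨(hZ.measurable i).aemeasurable, (hZ.measurable 0).aemeasurable, by
      rw [hZ.map_eq, hZ.map_eq]⟩
  exact this.comp hφ

lemma IsIID.memLp_comp (hZ : IsIID P Z μ) {φ : E → ℝ} {p : ENNReal} (hφ : MemLp φ p P) (i : ℕ) :
    MemLp (fun ω => φ (Z i ω)) p μ := by
  rw [← hZ.map_eq i] at hφ
  exact hφ.comp_of_map (hZ.measurable i).aemeasurable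

lemma IsIID.integral_comp (hZ : IsIID P Z μ) {φ : E → ℝ} (hφ : Measurable φ) (i : ℕ) :
    ∫ ω, φ (Z i ω) ∂μ = ∫ z, φ z ∂P := by
  rw [← hZ.map_eq i, integral_map (hZ.measurable i).aemeasurable hφ.aestronglyMeasurable]

lemma IsIID.measurable_ustat (hZ : IsIID P Z μ) (hh : IsSymmKernel P h) (m : ℕ) :
    Measurable fun ω => ustat (fun i j : Fin m => h (Z i ω) (Z j ω)) Finset.univ := by
  unfold ustat
  refine Measurable.const_mul (Finset.measurable_sum _ fun i _ =>
    Finset.measurable_sum _ fun j _ => ?_) _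
  exact hh.measurable.comp ((hZ.measurable i).prodMk (hZ.measurable j))

/-- The strong law of large numbers. -/
lemma IsIID.tendsto_mean (hZ : IsIID P Z μ) {φ : E → ℝ} (hφ : Measurable φ)
    (hi : Integrable φ P) :
    ∀ᵐ ω ∂μ, Tendsto (fun m : ℕ => (m : ℝ)⁻¹ * ∑ i : Fin m, φ (Z i ω)) atTop
      (𝓝 (∫ z, φ z ∂P)) := by
  have h := strong_law_ae_real (μ := μ) (fun i ω => φ (Z i ω))
    (memLp_one_iff_integrable.1 (hZ.memLp_comp (memLp_one_iff_integrable.2 hi) 0))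
    (fun i j hij => (hZ.indep.indepFun hij).comp hφ hφ)
    (fun i => hZ.identDistrib_comp hφ i)
  filter_upwards [h] with ω hω
  rw [hZ.integral_comp hφ] at hω
  refine hω.congr fun m => ?_
  rw [Finset.sum_range, div_eq_inv_mul]

/-- The maximum of the first `m` terms of a sequence that is `o(√m)` is `o(√m)`. -/
lemma tendsto_norm_div_sqrt {x : ℕ → ℝ}
    (hx : Tendsto (fun m : ℕ => x m ^ 2 / m) atTop (𝓝 0)) :
    Tendsto (fun m : ℕ => ‖fun i : Fin m => x i‖ / √m) atTop (𝓝 0) := by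
  rw [Metric.tendsto_atTop]
  intro ε hε
  have h1 : ∀ᶠ m : ℕ in atTop, x m ^ 2 / m < (ε / 2) ^ 2 := hx.eventually_lt_const (by positivity)
  obtain ⟨m₀, hm₀⟩ := eventually_atTop.1 h1
  set K := ∑ i ∈ Finset.range (m₀ + 1), |x i| with hK
  have hK0 : 0 ≤ K := Finset.sum_nonneg fun _ _ => abs_nonneg _
  obtain ⟨m₁, hm₁⟩ := eventually_atTop.1
    ((Real.tendsto_sqrt_atTop.comp tendsto_natCast_atTop_atTop).eventually_ge_atTop (2 * K / ε))
  refine ⟨max m₁ 1, fun m hm => ?_⟩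
  -- The finitely many early terms are bounded by the constant `K`, which `√m` dominates. A later
  -- term satisfies `|x i| ≤ (ε / 2) √i ≤ (ε / 2) √m`.
  have hmpos : (0 : ℝ) < m := by exact_mod_cast (le_max_right m₁ 1).trans hm
  have hsm : 0 < √(m : ℝ) := Real.sqrt_pos.2 hmpos
  have hKm : K ≤ ε / 2 * √m := by
    have := hm₁ m ((le_max_left _ _).trans hm)
    simp only [Function.comp_apply] at this
    rw [div_le_iff₀ hε] at this
    linarith
  rw [Real.dist_eq, sub_zero, abs_of_nonneg (by positivity), div_lt_iff₀ hsm]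
  have : ‖fun i : Fin m => x i‖ ≤ ε / 2 * √m := by
    refine (pi_norm_le_iff_of_nonneg (by positivity)).2 fun i => ?_
    rw [Real.norm_eq_abs]
    by_cases hi : (i : ℕ) < m₀ + 1
    · exact (Finset.single_le_sum (f := fun i => |x i|) (fun _ _ => abs_nonneg _)
        (Finset.mem_range.2 hi)).trans hKm
    · have hi2 := hm₀ i (by omega)
      have hipos : (0 : ℝ) < (i : ℕ) := by
        have : 0 < (i : ℕ) := by omega
        exact_mod_cast this
      rw [div_lt_iff₀ hipos] at hi2
      have him : ((i : ℕ) : ℝ) ≤ m := by exact_mod_cast i.2.le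
      refine abs_le_of_sq_le_sq ?_ (by positivity)
      rw [mul_pow, Real.sq_sqrt hmpos.le]
      exact hi2.le.trans (mul_le_mul_of_nonneg_left him (by positivity))
  have h3 : ε / 2 * √(m : ℝ) < ε * √m := by nlinarith
  linarith

/-- The averages of `φ ^ 2` converge by the strong law; comparing consecutive averages gives `φ (Z
m) ^ 2 / m → 0`, which controls the maximum. -/
lemma IsIID.tendsto_norm_div_sqrt (hZ : IsIID P Z μ) {φ : E → ℝ} (hφ : Measurable φ)
    (hi : MemLp φ 2 P) :
    ∀ᵐ ω ∂μ, Tendsto (fun m : ℕ => ‖fun i : Fin m => φ (Z i ω)‖ / √m) atTop (𝓝 0) := by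
  filter_upwards [hZ.tendsto_mean (φ := fun z => φ z ^ 2) (hφ.pow_const 2) hi.integrable_sq]
    with ω hω
  refine GiniJEL.tendsto_norm_div_sqrt (x := fun i => φ (Z i ω)) ?_
  have h1 := hω.comp (tendsto_add_atTop_nat 1)
  have h2 : Tendsto (fun m : ℕ => ((m : ℝ) + 1) / m) atTop (𝓝 1) := by
    have : Tendsto (fun m : ℕ => 1 + 1 / (m : ℝ)) atTop (𝓝 (1 + 0)) :=
      tendsto_const_nhds.add tendsto_one_div_atTop_nhds_zero_nat
    rw [add_zero] at this
    refine this.congr' ((eventually_gt_atTop 0).mono fun m hm => ?_)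
    have : (m : ℝ) ≠ 0 := by exact_mod_cast hm.ne'
    field_simp
  have h3 := (h2.mul h1).sub hω
  rw [one_mul, sub_self] at h3
  refine h3.congr' ((eventually_gt_atTop 0).mono fun m hm => ?_)
  have hm' : (m : ℝ) ≠ 0 := by exact_mod_cast hm.ne'
  have hm1 : (m : ℝ) + 1 ≠ 0 := by positivity
  simp only [Function.comp_apply, Fin.sum_univ_castSucc, Fin.val_castSucc, Fin.val_last]
  push_cast
  field_simp
  ring

variable [IsProbabilityMeasure μ]

/-- The central limit theorem for centered random variables. -/
lemma IsIID.tendstoInDistribution (hZ : IsIID P Z μ) {φ : E → ℝ} (hφ : Measurable φ)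
    (hi : MemLp φ 2 P) (h0 : ∫ z, φ z ∂P = 0) :
    TendstoInDistribution (fun (m : ℕ) ω => (√(m : ℝ))⁻¹ * ∑ i : Fin m, φ (Z i ω)) atTop
      (fun x : ℝ => x) (fun _ => μ) (gaussianReal 0 (∫ z, φ z ^ 2 ∂P).toNNReal) := by
  have hvar : Var[fun ω => φ (Z 0 ω); μ] = ∫ z, φ z ^ 2 ∂P := by
    rw [variance_eq_sub (hZ.memLp_comp hi 0), hZ.integral_comp hφ, h0]
    simp only [Pi.pow_apply]
    rw [hZ.integral_comp (hφ.pow_const 2)]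
    ring
  have h := tendstoInDistribution_inv_sqrt_mul_sum_sub (P := μ) (X := fun i ω => φ (Z i ω))
    (Y := fun x : ℝ => x) (P' := gaussianReal 0 (∫ z, φ z ^ 2 ∂P).toNNReal)
    (by rw [hvar]; exact HasLaw.id) (hZ.memLp_comp hi 0)
    (hZ.indep.comp (fun _ => φ) fun _ => hφ) (fun i => hZ.identDistrib_comp hφ i)
  simp only [hZ.integral_comp hφ, h0, mul_zero, sub_zero, Finset.sum_range] at h
  exact h

variable [IsProbabilityMeasure P]

/-- The row means of a kernel are close to the projections in quadratic mean. -/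
lemma IsIID.tendstoInMeasure_rowMean (hZ : IsIID P Z μ) (hh : IsSymmKernel P h) :
    TendstoInMeasure μ (fun (m : ℕ) ω => (m : ℝ)⁻¹ * ∑ i : Fin m,
      (rowMean (fun i j : Fin m => h (Z i ω) (Z j ω)) i - proj P h (Z i ω)) ^ 2) atTop
      (fun _ => 0) := by
  set q : E → E → ℝ := fun z w => h z w - proj P h z with hqdef
  have hq : IsDegenerate P q := hh.isDegenerate_sub_proj
  set K := ∫ v, Function.uncurry q v ^ 2 ∂(P.prod P)
  have hmem : ∀ (m : ℕ) (i : Fin m), MemLp (fun ω => ((m : ℝ) - 1)⁻¹ *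
      ∑ j ∈ Finset.univ.erase i, q (Z i ω) (Z j ω)) 2 μ := by
    intro m i
    have hs : MemLp (fun ω => ∑ j ∈ Finset.univ.erase i, q (Z i ω) (Z j ω)) 2 μ :=
      memLp_finsetSum (f := fun (j : Fin m) ω => q (Z i ω) (Z j ω)) _ fun j hj =>
        hZ.memLp_pair hq.memLp fun h => Finset.ne_of_mem_erase hj (Fin.ext h.symm)
    exact hs.const_mul _
  have key : TendstoInMeasure μ (fun (m : ℕ) ω => (m : ℝ)⁻¹ * ∑ i : Fin m,
      (((m : ℝ) - 1)⁻¹ * ∑ j ∈ Finset.univ.erase i, q (Z i ω) (Z j ω)) ^ 2) atTop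
      (fun _ => 0) := by
    refine tendstoInMeasure_of_tendsto_integral (fun m ω => by positivity)
      (fun m => (integrable_finsetSum _ fun i _ => (hmem m i).integrable_sq).const_mul _) ?_
    -- A row sum of `m - 1` orthogonal terms has second moment `(m - 1) K`, and its mean carries the
    -- factor `(m - 1)⁻¹` squared.
    have hlim : Tendsto (fun m : ℕ => K * ((m : ℝ) - 1)⁻¹) atTop (𝓝 0) := by
      have : Tendsto (fun m : ℕ => (m : ℝ) - 1) atTop atTop :=
        tendsto_atTop_add_const_right _ _ tendsto_natCast_atTop_atTop
      simpa using this.inv_tendsto_atTop.const_mul K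
    refine hlim.congr' ((eventually_ge_atTop 2).mono fun m hm => ?_)
    have hm' : (2 : ℝ) ≤ m := by exact_mod_cast hm
    have hne : (m : ℝ) - 1 ≠ 0 := by linarith
    have hne0 : (m : ℝ) ≠ 0 := by linarith
    simp only
    rw [integral_const_mul, integral_finsetSum _ fun i _ => (hmem m i).integrable_sq]
    simp_rw [mul_pow, integral_const_mul, hZ.integral_sq_sum_row hq]
    simp only [Finset.sum_const, Finset.card_univ, Fintype.card_fin, nsmul_eq_mul]
    change K * _ = _ * (_ * (_ * (_ * K)))
    field_simp
  refine key.congr' ((eventually_ge_atTop 2).mono fun m hm => ae_of_all _ fun ω => ?_)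
    (ae_of_all _ fun _ => rfl)
  have hm' : (2 : ℝ) ≤ m := by exact_mod_cast hm
  have hne : (m : ℝ) - 1 ≠ 0 := by linarith
  simp only
  congr 1
  refine Finset.sum_congr rfl fun i _ => ?_
  congr 1
  rw [rowMean, Finset.sum_sub_distrib, Finset.sum_const,
    Finset.card_erase_of_mem (Finset.mem_univ i), Finset.card_univ, Fintype.card_fin, nsmul_eq_mul,
    Nat.cast_pred i.pos, mul_sub, inv_mul_cancel_left₀ hne]

/-- The Hoeffding expansion of a `U`-statistic. -/
lemma IsIID.tendstoInMeasure_hoeffding (hZ : IsIID P Z μ) (hh : IsSymmKernel P h) :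
    TendstoInMeasure μ (fun (m : ℕ) ω => √(m : ℝ) *
      (ustat (fun i j : Fin m => h (Z i ω) (Z j ω)) Finset.univ - kmean P h -
        2 / (m : ℝ) * ∑ i : Fin m, (proj P h (Z i ω) - kmean P h))) atTop (fun _ => 0) := by
  set q : E → E → ℝ := fun z w => h z w - proj P h z - proj P h w + kmean P h with hqdef
  have hq : IsDegenerate P q := hh.isDegenerate_hoeffding
  have hqs : ∀ z w, q z w = q w z := by
    intro z w
    simp only [hqdef, hh.symm z w]
    ring
  set K := ∫ v, Function.uncurry q v ^ 2 ∂(P.prod P)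
  have hmem : ∀ (m : ℕ), MemLp (fun ω => √(m : ℝ) * (((m : ℝ) * (m - 1) / 2)⁻¹ *
      ∑ i : Fin m, ∑ j : Fin m with i < j, q (Z i ω) (Z j ω))) 2 μ := by
    intro m
    have hs : MemLp (fun ω => ∑ i : Fin m, ∑ j : Fin m with i < j, q (Z i ω) (Z j ω)) 2 μ :=
      memLp_finsetSum (f := fun (i : Fin m) ω => ∑ j : Fin m with i < j, q (Z i ω) (Z j ω)) _
        fun i _ => memLp_finsetSum (f := fun (j : Fin m) ω => q (Z i ω) (Z j ω)) _ fun j hj =>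
          hZ.memLp_pair hq.memLp (Fin.lt_def.1 (Finset.mem_filter.1 hj).2).ne
    exact (hs.const_mul _).const_mul _
  have key : TendstoInMeasure μ (fun (m : ℕ) ω => √(m : ℝ) * (((m : ℝ) * (m - 1) / 2)⁻¹ *
      ∑ i : Fin m, ∑ j : Fin m with i < j, q (Z i ω) (Z j ω))) atTop (fun _ => 0) := by
    refine tendstoInMeasure_of_tendsto_integral_sq hmem ?_
    -- The second moment is `m * (2 / (m (m - 1))) ^ 2 * (m (m - 1) / 2) * K = 2 K / (m - 1)`.
    have hlim : Tendsto (fun m : ℕ => 2 * K * ((m : ℝ) - 1)⁻¹) atTop (𝓝 0) := by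
      have : Tendsto (fun m : ℕ => (m : ℝ) - 1) atTop atTop :=
        tendsto_atTop_add_const_right _ _ tendsto_natCast_atTop_atTop
      simpa using this.inv_tendsto_atTop.const_mul (2 * K)
    refine hlim.congr' ((eventually_ge_atTop 2).mono fun m hm => ?_)
    have hm' : (2 : ℝ) ≤ m := by exact_mod_cast hm
    have hne : (m : ℝ) - 1 ≠ 0 := by linarith
    have hne0 : (m : ℝ) ≠ 0 := by linarith
    simp_rw [mul_pow, integral_const_mul, hZ.integral_sq_sum_pairs hq hqs hm]
    rw [Real.sq_sqrt (by linarith)]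
    change _ = _ * (_ * (_ * K))
    field_simp
  refine key.congr' ((eventually_ge_atTop 2).mono fun m hm => ae_of_all _ fun ω => ?_)
    (ae_of_all _ fun _ => rfl)
  have hm' : (2 : ℝ) ≤ m := by exact_mod_cast hm
  have hne : (m : ℝ) - 1 ≠ 0 := by linarith
  have hne0 : (m : ℝ) ≠ 0 := by linarith
  simp only
  congr 1
  have hrow : ∀ i : Fin m, rowMean (fun i j : Fin m => q (Z i ω) (Z j ω)) i =
      rowMean (fun i j : Fin m => h (Z i ω) (Z j ω)) i - proj P h (Z i ω) -
        ((m : ℝ) - 1)⁻¹ * (∑ j : Fin m, proj P h (Z j ω) - proj P h (Z i ω)) + kmean P h := by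
    intro i
    simp only [rowMean, hqdef, Finset.sum_add_distrib, Finset.sum_sub_distrib, Finset.sum_const,
      Finset.card_erase_of_mem (Finset.mem_univ i), Finset.card_univ, Fintype.card_fin,
      nsmul_eq_mul, Nat.cast_pred i.pos]
    rw [Finset.sum_erase_eq_sub (f := fun j : Fin m => proj P h (Z j ω)) (Finset.mem_univ i)]
    field_simp
  rw [sum_pairs_univ (fun i j : Fin m => q (Z i ω) (Z j ω)) (fun i j => hqs _ _) hm,
    ustat_univ (fun i j : Fin m => h (Z i ω) (Z j ω)) (fun i j => hh.symm _ _) hm]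
  simp_rw [hrow]
  simp only [Finset.sum_add_distrib, Finset.sum_sub_distrib, Finset.sum_const, Finset.card_univ,
      Fintype.card_fin, nsmul_eq_mul, ← Finset.mul_sum]
  field_simp
  ring

/-- The rate of consistency of a `U`-statistic. -/
lemma IsIID.tendstoInMeasure_ustat (hZ : IsIID P Z μ) (hh : IsSymmKernel P h) :
    TendstoInMeasure μ (fun (m : ℕ) ω => √√(m : ℝ) *
      (ustat (fun i j : Fin m => h (Z i ω) (Z j ω)) Finset.univ - kmean P h)) atTop
      (fun _ => 0) := by
  have h1 := hZ.tendstoInDistribution (φ := fun z => proj P h z - kmean P h)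
    (hh.measurable_proj.sub_const _) (hh.memLp_proj.sub (memLp_const _)) (by
      rw [integral_sub hh.integrable_proj (integrable_const _)]
      simp [kmean])
  have hss : Tendsto (fun m : ℕ => √√(m : ℝ)) atTop atTop :=
    Real.tendsto_sqrt_atTop.comp (Real.tendsto_sqrt_atTop.comp tendsto_natCast_atTop_atTop)
  -- The linear Hoeffding term at scale `m ^ (1/4)` is the normalized sum of the central limit
  -- theorem times this factor. The fourth root suffices later, where only products of two such
  -- errors have to be negligible at scale `√n`.
  have h2 : TendstoInMeasure μ (fun (m : ℕ) (_ : Ω) => 2 * (√√(m : ℝ))⁻¹) atTop (fun _ => 0) := by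
    refine tendstoInMeasure_of_tendsto_ae (fun _ => aestronglyMeasurable_const)
      (ae_of_all _ fun _ => ?_)
    simpa using hss.inv_tendsto_atTop.const_mul 2
  have h3 := tendstoInMeasure_mul_of_tendstoInDistribution h1 h2 fun _ => aemeasurable_const
  refine tendstoInMeasure_of_forall_subseq (I := Bool)
    (X := fun b => cond b (fun (m : ℕ) ω => √(m : ℝ) *
      (ustat (fun i j : Fin m => h (Z i ω) (Z j ω)) Finset.univ - kmean P h -
        2 / (m : ℝ) * ∑ i : Fin m, (proj P h (Z i ω) - kmean P h)))
      (fun (m : ℕ) ω => (√(m : ℝ))⁻¹ * (∑ i : Fin m, (proj P h (Z i ω) - kmean P h)) *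
        (2 * (√√(m : ℝ))⁻¹))) (c := fun _ => 0)
    (fun b => by
      cases b
      · exact h3
      · exact hZ.tendstoInMeasure_hoeffding hh)
    (fun m => (((hZ.measurable_ustat hh m).sub_const _).const_mul _).aestronglyMeasurable)
    (ae_of_all _ fun ω ns hns hc => ?_)
  have ht := hc true
  have hf := hc false
  simp only [cond_true, cond_false] at ht hf
  have hsub := ((hss.comp hns.tendsto_atTop).inv_tendsto_atTop.mul ht).add hf
  simp only [mul_zero, add_zero] at hsub
  refine hsub.congr' ((hns.tendsto_atTop.eventually_gt_atTop 0).mono fun n hn => ?_)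
  have hm : (0 : ℝ) < ns n := by exact_mod_cast hn
  have hs : 0 < √(ns n : ℝ) := Real.sqrt_pos.2 hm
  have hs2 : 0 < √√(ns n : ℝ) := Real.sqrt_pos.2 hs
  have e1 : (ns n : ℝ) = √(ns n : ℝ) * √(ns n : ℝ) := (Real.mul_self_sqrt hm.le).symm
  have e2 : √(ns n : ℝ) = √√(ns n : ℝ) * √√(ns n : ℝ) := (Real.mul_self_sqrt hs.le).symm
  simp only [Pi.inv_apply, Function.comp_apply]
  generalize ∑ i : Fin (ns n), (proj P h (Z i ω) - kmean P h) = S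
  generalize ustat (fun i j : Fin (ns n) => h (Z i ω) (Z j ω)) Finset.univ = U
  generalize √√(ns n : ℝ) = t at *
  have e3 : (ns n : ℝ) = t * t * (t * t) := e1.trans (by rw [e2])
  rw [e2, e3]
  field_simp
  ring

end LimitTheorems

end GiniJEL

/-! ### Gini kernels and Gini covariances. -/

namespace GiniJEL

section Gini

variable {E : Type*}

/-- The kernel of the Gini covariance of `X` and the distribution function of `Y`. -/
noncomputable def giniKernel (X Y : E → ℝ) (z w : E) : ℝ :=
  1 / 4 * ((if Y w < Y z then X z - X w else 0) + (if Y z < Y w then X w - X z else 0))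

lemma giniKernel_symm (X Y : E → ℝ) (z w : E) : giniKernel X Y z w = giniKernel X Y w z := by
  rw [giniKernel, giniKernel, add_comm]

lemma giniKernel_self (X : E → ℝ) (z w : E) : giniKernel X X z w = 1 / 4 * |X z - X w| := by
  rw [giniKernel]
  congr 1
  rcases lt_trichotomy (X z) (X w) with h | h | h
  · rw [if_neg h.not_gt, if_pos h, abs_of_neg (by linarith)]
    ring
  · simp [h]
  · rw [if_pos h, if_neg h.not_gt, abs_of_pos (by linarith)]
    ring

/-- A bound free of `Y`: square integrability of the kernel then needs second moments of `X` only.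
-/
lemma abs_giniKernel_le (X Y : E → ℝ) (z w : E) : |giniKernel X Y z w| ≤ |X z| + |X w| := by
  have h1 : |X z - X w| ≤ |X z| + |X w| := abs_sub _ _
  have h2 : |X w - X z| ≤ |X z| + |X w| := by rw [abs_sub_comm]; exact h1
  have h0 : 0 ≤ |X z| + |X w| := by positivity
  rw [giniKernel, abs_mul, abs_of_pos (by norm_num : (0 : ℝ) < 1 / 4)]
  rcases lt_trichotomy (Y w) (Y z) with h | h | h
  · rw [if_pos h, if_neg h.not_gt, add_zero]
    linarith
  · simp [h]
    linarith
  · rw [if_neg h.not_gt, if_pos h, zero_add]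
    linarith

variable [MeasurableSpace E] {P : Measure E}

lemma measurable_giniKernel {X Y : E → ℝ} (hX : Measurable X) (hY : Measurable Y) :
    Measurable (Function.uncurry (giniKernel X Y)) := by
  have hY1 : Measurable fun v : E × E => Y v.1 := hY.comp measurable_fst
  have hY2 : Measurable fun v : E × E => Y v.2 := hY.comp measurable_snd
  have hX1 : Measurable fun v : E × E => X v.1 := hX.comp measurable_fst
  have hX2 : Measurable fun v : E × E => X v.2 := hX.comp measurable_snd
  exact ((Measurable.ite (measurableSet_lt hY2 hY1) (hX1.sub hX2) measurable_const).add
    (Measurable.ite (measurableSet_lt hY1 hY2) (hX2.sub hX1) measurable_const)).const_mul _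

variable [IsProbabilityMeasure P]

lemma isSymmKernel_giniKernel {X Y : E → ℝ} (hX : Measurable X) (hY : Measurable Y)
    (hX2 : MemLp X 2 P) : IsSymmKernel P (giniKernel X Y) where
  measurable := measurable_giniKernel hX hY
  symm := giniKernel_symm X Y
  memLp := by
    refine ((hX2.comp_fst P).norm.add (hX2.comp_snd P).norm).of_le
      (measurable_giniKernel hX hY).aestronglyMeasurable (ae_of_all _ fun v => ?_)
    rw [Real.norm_eq_abs]
    refine (abs_giniKernel_le X Y v.1 v.2).trans (le_of_eq ?_)
    rw [Real.norm_eq_abs]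
    simp only [Pi.add_apply, Real.norm_eq_abs]
    exact (abs_of_nonneg (by positivity)).symm
  integrable z := by
    have hi : Integrable X P := hX2.integrable (by norm_num)
    refine ((integrable_const |X z|).add hi.abs).mono'
      ((measurable_giniKernel hX hY).comp measurable_prodMk_left).aestronglyMeasurable
      (ae_of_all _ fun w => abs_giniKernel_le X Y z w)

lemma measure_eq_zero_of_continuous_cdf {Y : E → ℝ} (hY : Measurable Y)
    (hc : Continuous (cdf (P.map Y))) (c : ℝ) : P {w | Y w = c} = 0 := by
  have : IsProbabilityMeasure (P.map Y) := Measure.isProbabilityMeasure_map hY.aemeasurable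
  have h : (P.map Y) {c} = 0 := by
    rw [← measure_cdf (P.map Y), StieltjesFunction.measure_singleton,
      hc.continuousAt.continuousWithinAt.leftLim_eq, sub_self, ENNReal.ofReal_zero]
  rwa [Measure.map_apply hY (measurableSet_singleton c)] at h

lemma integral_ite_gt {Y : E → ℝ} (hY : Measurable Y) (c : ℝ) :
    ∫ w, (if c < Y w then (1 : ℝ) else 0) ∂P = 1 - cdf (P.map Y) c := by
  have : IsProbabilityMeasure (P.map Y) := Measure.isProbabilityMeasure_map hY.aemeasurable
  have e : (fun w => if c < Y w then (1 : ℝ) else 0) = ({w | Y w ≤ c}ᶜ : Set E).indicator 1 := by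
    ext w
    simp [Set.indicator_apply]
  rw [e, integral_indicator_one (measurableSet_le hY measurable_const).compl,
    measureReal_compl (measurableSet_le hY measurable_const), cdf_eq_real,
    map_measureReal_apply hY measurableSet_Iic]
  simp
  rfl

/-- Continuity excludes an atom of `Y` at `c`, so the strict inequality has the same probability as
`Y ≤ c`. -/
lemma integral_ite_lt {Y : E → ℝ} (hY : Measurable Y) (hc : Continuous (cdf (P.map Y))) (c : ℝ) :
    ∫ w, (if Y w < c then (1 : ℝ) else 0) ∂P = cdf (P.map Y) c := by
  have h := integral_ite_gt (P := P) hY c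
  have hi1 : Integrable (fun w => if Y w < c then (1 : ℝ) else 0) P :=
    Integrable.of_bound (Measurable.ite (measurableSet_lt hY measurable_const) measurable_const
      measurable_const).aestronglyMeasurable 1 (ae_of_all _ fun w => by split_ifs <;> simp)
  have hi2 : Integrable (fun w => if c < Y w then (1 : ℝ) else 0) P :=
    Integrable.of_bound (Measurable.ite (measurableSet_lt measurable_const hY) measurable_const
      measurable_const).aestronglyMeasurable 1 (ae_of_all _ fun w => by split_ifs <;> simp)
  have hs : ∫ w, ((if Y w < c then (1 : ℝ) else 0) + (if c < Y w then (1 : ℝ) else 0)) ∂P = 1 := by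
    have : ∫ _w, (1 : ℝ) ∂P = 1 := by simp
    rw [← this]
    refine integral_congr_ae ?_
    have h0 : ∀ᵐ w ∂P, Y w ≠ c := by
      rw [ae_iff]
      simpa using measure_eq_zero_of_continuous_cdf hY hc c
    filter_upwards [h0] with w hw
    rcases lt_or_gt_of_ne hw with h | h
    · simp [h, h.not_gt]
    · simp [h, h.not_gt]
  rw [integral_add hi1 hi2, h] at hs
  linarith

/-- The mean of the Gini kernel before centering. -/
lemma kmean_giniKernel_aux {X Y : E → ℝ} (hY : Measurable Y)
    (hi : Integrable X P) (hc : Continuous (cdf (P.map Y))) :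
    ∫ v, (if Y v.2 < Y v.1 then X v.1 - X v.2 else 0) ∂(P.prod P) =
      2 * ∫ z, X z * cdf (P.map Y) (Y z) ∂P - ∫ z, X z ∂P := by
  have hY1 : Measurable fun v : E × E => Y v.1 := hY.comp measurable_fst
  have hY2 : Measurable fun v : E × E => Y v.2 := hY.comp measurable_snd
  have hmi : Measurable fun v : E × E => if Y v.2 < Y v.1 then (1 : ℝ) else 0 :=
    Measurable.ite (measurableSet_lt hY2 hY1) measurable_const measurable_const
  have hb : ∀ v : E × E, ‖if Y v.2 < Y v.1 then (1 : ℝ) else 0‖ ≤ 1 := fun v => by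
    split_ifs <;> simp
  have hi1 : Integrable (fun v : E × E => X v.1 * if Y v.2 < Y v.1 then (1 : ℝ) else 0)
      (P.prod P) := (hi.comp_fst P).mul_bdd hmi.aestronglyMeasurable (ae_of_all _ hb)
  have hi2 : Integrable (fun v : E × E => X v.2 * if Y v.2 < Y v.1 then (1 : ℝ) else 0)
      (P.prod P) := (hi.comp_snd P).mul_bdd hmi.aestronglyMeasurable (ae_of_all _ hb)
  have e : ∀ v : E × E, (if Y v.2 < Y v.1 then X v.1 - X v.2 else 0) =
      (X v.1 * if Y v.2 < Y v.1 then (1 : ℝ) else 0) -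
        X v.2 * if Y v.2 < Y v.1 then (1 : ℝ) else 0 := by
    intro v
    split_ifs <;> ring
  simp_rw [e]
  have hG : Integrable (fun z => X z * cdf (P.map Y) (Y z)) P := by
    refine hi.mul_bdd (c := 1) (((monotone_cdf _).measurable.comp hY).aestronglyMeasurable)
      (ae_of_all _ fun z => ?_)
    rw [Real.norm_eq_abs, abs_of_nonneg (cdf_nonneg _ _)]
    exact cdf_le_one _ _
  -- Fubini in opposite orders, so that each time the variable inside `X` is kept and only the
  -- indicator is integrated.
  rw [integral_sub hi1 hi2, integral_prod _ hi1, integral_prod_symm _ hi2]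
  simp only [integral_const_mul, integral_ite_lt hY hc, integral_ite_gt hY]
  simp_rw [mul_sub, mul_one]
  rw [integral_sub hi hG]
  ring

lemma memLp_cdf_comp {Y : E → ℝ} (hY : Measurable Y) :
    MemLp (fun z => cdf (P.map Y) (Y z)) 2 P :=
  MemLp.of_bound ((monotone_cdf _).measurable.comp hY).aestronglyMeasurable 1
    (ae_of_all _ fun z => by
      rw [Real.norm_eq_abs, abs_of_nonneg (cdf_nonneg _ _)]
      exact cdf_le_one _ _)

/-- For `X = 1` the left side of `kmean_giniKernel_aux` vanishes, leaving `0 = 2 ∫ G(Y) - 1`. -/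
lemma integral_cdf_comp {Y : E → ℝ} (hY : Measurable Y) (hc : Continuous (cdf (P.map Y))) :
    ∫ z, cdf (P.map Y) (Y z) ∂P = 1 / 2 := by
  have h := kmean_giniKernel_aux (X := fun _ => (1 : ℝ)) hY (integrable_const _) hc
  simp at h
  linarith

/-- The mean of the Gini kernel is the Gini covariance. -/
lemma kmean_giniKernel {X Y : E → ℝ} (hX : Measurable X) (hY : Measurable Y)
    (hX2 : MemLp X 2 P) (hc : Continuous (cdf (P.map Y))) :
    kmean P (giniKernel X Y) = cov[X, fun z => cdf (P.map Y) (Y z); P] := by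
  have hi : Integrable X P := hX2.integrable (by norm_num)
  have hk := isSymmKernel_giniKernel (P := P) hX hY hX2
  rw [covariance_eq_sub hX2 (memLp_cdf_comp hY), integral_cdf_comp hY hc]
  have haux := kmean_giniKernel_aux hY hi hc
  set a : E × E → ℝ := fun v => if Y v.2 < Y v.1 then X v.1 - X v.2 else 0 with ha
  have ham : Measurable a := Measurable.ite
    (measurableSet_lt (hY.comp measurable_snd) (hY.comp measurable_fst))
    ((hX.comp measurable_fst).sub (hX.comp measurable_snd)) measurable_const
  have hai : Integrable a (P.prod P) := by
    refine ((hi.comp_fst P).sub (hi.comp_snd P)).mono ham.aestronglyMeasurable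
      (ae_of_all _ fun v => ?_)
    simp only [ha, Pi.sub_apply]
    split_ifs
    · exact le_rfl
    · simp
  have h1 : kmean P (giniKernel X Y) = ∫ v, Function.uncurry (giniKernel X Y) v ∂(P.prod P) := by
    rw [integral_prod _ (hk.memLp.integrable (by norm_num))]
    rfl
  -- Both halves have the same integral, twice the Gini covariance; this accounts for the factor `1
  -- / 4`.
  have h2 : ∀ v, Function.uncurry (giniKernel X Y) v = 1 / 4 * (a v + a v.swap) := fun v => rfl
  rw [h1]
  simp_rw [h2]
  have hai' : Integrable (fun v : E × E => a v.swap) (P.prod P) := hai.swap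
  rw [integral_const_mul, integral_add hai hai', integral_prod_swap, haux]
  simp only [Pi.mul_apply]
  ring

/-- The kernel is a multiple of `|X z - X w|`. If its mean vanished, then `X` would be almost surely
equal to some value `X z`, contradicting the absence of atoms. -/
lemma kmean_giniKernel_self_ne_zero {X : E → ℝ} (hX : Measurable X)
    (hX2 : MemLp X 2 P) (hc : Continuous (cdf (P.map X))) :
    kmean P (giniKernel X X) ≠ 0 := by
  intro h
  have hk := isSymmKernel_giniKernel (P := P) hX hX hX2
  have hpos : ∀ z w, 0 ≤ giniKernel X X z w := fun z w => by
    rw [giniKernel_self]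
    positivity
  have h1 := (integral_eq_zero_iff_of_nonneg (fun z => integral_nonneg (hpos z))
    hk.integrable_proj).1 h
  obtain ⟨z, hz⟩ := h1.exists
  have h2 := (integral_eq_zero_iff_of_nonneg (hpos z) (hk.integrable z)).1 hz
  have h3 : ∀ᵐ w ∂P, X w ≠ X z := by
    rw [ae_iff]
    simpa using measure_eq_zero_of_continuous_cdf hX hc (X z)
  obtain ⟨w, hw1, hw2⟩ := (h2.and h3).exists
  rw [giniKernel_self] at hw1
  simp only [Pi.zero_apply, mul_eq_zero, abs_eq_zero, sub_eq_zero] at hw1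
  rcases hw1 with h | h
  · norm_num at h
  · exact hw2 h.symm

end Gini

/-! ### The two components of the kernel and their projections. -/

section Components

/-- The two coordinates of a pair. -/
def coord (a : Fin 2) (z : ℝ × ℝ) : ℝ := ![z.1, z.2] a

lemma measurable_coord (a : Fin 2) : Measurable (coord a) := by
  fin_cases a
  · exact measurable_fst
  · exact measurable_snd

/-- The Gini kernel of a coordinate with respect to the other one. -/
noncomputable def crossKernel (a : Fin 2) : ℝ × ℝ → ℝ × ℝ → ℝ :=
  giniKernel (coord a) (coord (1 - a))

/-- The Gini kernel of a coordinate with respect to itself. -/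
noncomputable def selfKernel (a : Fin 2) : ℝ × ℝ → ℝ × ℝ → ℝ := giniKernel (coord a) (coord a)

/-- The form `a₂ b₂ d - a₁ b₂ + a₂ b₁`. -/
def gform (d a₁ a₂ b₁ b₂ : ℝ) : ℝ := a₂ * b₂ * d - a₁ * b₂ + a₂ * b₁

/-- Exchanging coordinates turns one component into the other, so from here on both are treated
uniformly in `a`. -/
lemma kernelH_apply (d : Fin 2 → ℝ) (z₁ z₂ w₁ w₂ : ℝ × ℝ) (a : Fin 2) :
    kernelH d z₁ z₂ w₁ w₂ a = gform (d a) (crossKernel a z₁ z₂) (selfKernel a z₁ z₂)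
      (crossKernel a w₁ w₂) (selfKernel a w₁ w₂) := by
  simp only [crossKernel, selfKernel, gform]
  rw [giniKernel_self, giniKernel_self]
  fin_cases a <;> rfl

variable {P Q : Measure (ℝ × ℝ)}

lemma memLp_coord (h1 : Integrable (fun z : ℝ × ℝ => z.1 ^ 2) P)
    (h2 : Integrable (fun z : ℝ × ℝ => z.2 ^ 2) P) (a : Fin 2) : MemLp (coord a) 2 P := by
  rw [memLp_two_iff_integrable_sq (measurable_coord a).aestronglyMeasurable]
  fin_cases a
  · exact h1
  · exact h2

variable [IsProbabilityMeasure P] [IsProbabilityMeasure Q]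

/-- With `d = a₁ / a₂ - b₁ / b₂` the form `a₂ b₂ d - a₁ b₂ + a₂ b₁` is zero, the denominators being
nonzero. This is the unbiasedness at the true parameter, where the continuity of the marginals
enters. -/
lemma gform_giniDiff (hP : ∀ a, MemLp (coord a) 2 P) (hQ : ∀ a, MemLp (coord a) 2 Q)
    (hPc : ∀ a, Continuous (cdf (P.map (coord a)))) (hQc : ∀ a, Continuous (cdf (Q.map (coord a))))
    (a : Fin 2) :
    gform (giniDiff P Q a) (kmean P (crossKernel a)) (kmean P (selfKernel a))
      (kmean Q (crossKernel a)) (kmean Q (selfKernel a)) = 0 := by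
  have key : ∀ (R : Measure (ℝ × ℝ)) [IsProbabilityMeasure R], (∀ a, MemLp (coord a) 2 R) →
      (∀ a, Continuous (cdf (R.map (coord a)))) →
      ![giniCorr R, giniCorr (R.map Prod.swap)] a =
        kmean R (crossKernel a) / kmean R (selfKernel a) := by
    intro R _ hR hRc
    rw [crossKernel, selfKernel, kmean_giniKernel (measurable_coord a) (measurable_coord _) (hR a)
      (hRc _), kmean_giniKernel (measurable_coord a) (measurable_coord _) (hR a) (hRc _)]
    fin_cases a
    · rfl
    · have hm : ∀ f : ℝ × ℝ → ℝ, Measurable f → AEStronglyMeasurable f (R.map Prod.swap) :=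
        fun f hf => hf.aestronglyMeasurable
      have e1 : (R.map Prod.swap).map Prod.fst = R.map Prod.snd :=
        Measure.map_map measurable_fst measurable_swap
      have e2 : (R.map Prod.swap).map Prod.snd = R.map Prod.fst :=
        Measure.map_map measurable_snd measurable_swap
      change giniCorr (R.map Prod.swap) = _
      have c1 : cov[fun z : ℝ × ℝ => z.1, fun z => cdf (R.map Prod.fst) z.2; R.map Prod.swap] =
          cov[fun z : ℝ × ℝ => z.2, fun z => cdf (R.map Prod.fst) z.1; R] :=
        covariance_map_fun (hm _ measurable_fst)
          (hm _ ((monotone_cdf _).measurable.comp measurable_snd)) measurable_swap.aemeasurable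
      have c2 : cov[fun z : ℝ × ℝ => z.1, fun z => cdf (R.map Prod.snd) z.1; R.map Prod.swap] =
          cov[fun z : ℝ × ℝ => z.2, fun z => cdf (R.map Prod.snd) z.2; R] :=
        covariance_map_fun (hm _ measurable_fst)
          (hm _ ((monotone_cdf _).measurable.comp measurable_fst)) measurable_swap.aemeasurable
      rw [giniCorr, e1, e2, c1, c2]
      rfl
  have hd : giniDiff P Q a = kmean P (crossKernel a) / kmean P (selfKernel a) -
      kmean Q (crossKernel a) / kmean Q (selfKernel a) := by
    rw [← key P hP hPc, ← key Q hQ hQc]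
    fin_cases a <;> rfl
  have hPne : kmean P (selfKernel a) ≠ 0 :=
    kmean_giniKernel_self_ne_zero (measurable_coord a) (hP a) (hPc a)
  have hQne : kmean Q (selfKernel a) ≠ 0 :=
    kmean_giniKernel_self_ne_zero (measurable_coord a) (hQ a) (hQc a)
  rw [hd, gform]
  field_simp
  ring

lemma isSymmKernel_crossKernel (hP : ∀ a, MemLp (coord a) 2 P) (a : Fin 2) :
    IsSymmKernel P (crossKernel a) :=
  isSymmKernel_giniKernel (measurable_coord _) (measurable_coord _) (hP a)

lemma isSymmKernel_selfKernel (hP : ∀ a, MemLp (coord a) 2 P) (a : Fin 2) :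
    IsSymmKernel P (selfKernel a) :=
  isSymmKernel_giniKernel (measurable_coord _) (measurable_coord _) (hP a)

lemma kmean_eq_integral_prod {h : ℝ × ℝ → ℝ × ℝ → ℝ} (hh : IsSymmKernel P h) :
    ∫ v : (ℝ × ℝ) × (ℝ × ℝ), h v.1 v.2 ∂(P.prod P) = kmean P h :=
  integral_prod (Function.uncurry h) (hh.memLp.integrable (by norm_num))

lemma integrable_prod_kernel {h : ℝ × ℝ → ℝ × ℝ → ℝ} (hh : IsSymmKernel P h) :
    Integrable (fun v : (ℝ × ℝ) × (ℝ × ℝ) => h v.1 v.2) (P.prod P) :=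
  hh.memLp.integrable (by norm_num)

lemma integral_sub_add {α : Type*} [MeasurableSpace α] {ν : Measure α} {A B C : α → ℝ}
    (hA : Integrable A ν) (hB : Integrable B ν) (hC : Integrable C ν) :
    ∫ x, A x - B x + C x ∂ν = ∫ x, A x ∂ν - ∫ x, B x ∂ν + ∫ x, C x ∂ν := by
  have h : Integrable (fun x => A x - B x) ν := hA.sub hB
  rw [integral_add h hC, integral_sub hA hB]

lemma g₁₀_apply (hP : ∀ a, MemLp (coord a) 2 P) (hQ : ∀ a, MemLp (coord a) 2 Q)
    (d : Fin 2 → ℝ) (z : ℝ × ℝ) (a : Fin 2) :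
    g₁₀ P Q d z a = gform (d a) (proj P (crossKernel a) z) (proj P (selfKernel a) z)
      (kmean Q (crossKernel a)) (kmean Q (selfKernel a)) := by
  have hi : ∀ {h k : ℝ × ℝ → ℝ × ℝ → ℝ}, IsSymmKernel P h → IsSymmKernel Q k →
      Integrable (fun v : (ℝ × ℝ) × (ℝ × ℝ) × (ℝ × ℝ) => h z v.1 * k v.2.1 v.2.2)
        (P.prod (Q.prod Q)) := fun hh hk =>
    (hh.integrable z).mul_prod (integrable_prod_kernel hk)
  have hv : ∀ {h k : ℝ × ℝ → ℝ × ℝ → ℝ}, IsSymmKernel P h → IsSymmKernel Q k →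
      ∫ v : (ℝ × ℝ) × (ℝ × ℝ) × (ℝ × ℝ), h z v.1 * k v.2.1 v.2.2 ∂(P.prod (Q.prod Q)) =
        proj P h z * kmean Q k := by
    intro h k hh hk
    rw [integral_prod_mul (fun v => h z v) (fun v : (ℝ × ℝ) × (ℝ × ℝ) => k v.1 v.2),
      kmean_eq_integral_prod hk]
    rfl
  have hP1 := isSymmKernel_crossKernel hP
  have hP2 := isSymmKernel_selfKernel hP
  have hQ1 := isSymmKernel_crossKernel hQ
  have hQ2 := isSymmKernel_selfKernel hQ
  have hint : ∀ a, Integrable (fun v : (ℝ × ℝ) × (ℝ × ℝ) × (ℝ × ℝ) =>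
      kernelH d z v.1 v.2.1 v.2.2 a) (P.prod (Q.prod Q)) := by
    intro a
    simp only [kernelH_apply, gform]
    exact (((hi (hP2 a) (hQ2 a)).mul_const _).sub (hi (hP1 a) (hQ2 a))).add (hi (hP2 a) (hQ1 a))
  rw [g₁₀, eval_integral hint]
  simp only [kernelH_apply, gform]
  have hA : Integrable (fun v : (ℝ × ℝ) × (ℝ × ℝ) × (ℝ × ℝ) =>
      selfKernel a z v.1 * selfKernel a v.2.1 v.2.2 * d a) (P.prod (Q.prod Q)) :=
    (hi (hP2 a) (hQ2 a)).mul_const _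
  rw [integral_sub_add hA (hi (hP1 a) (hQ2 a)) (hi (hP2 a) (hQ1 a)), integral_mul_const, hv (hP2 a) (hQ2 a),
    hv (hP1 a) (hQ2 a), hv (hP2 a) (hQ1 a)]

lemma g₀₁_apply (hP : ∀ a, MemLp (coord a) 2 P) (hQ : ∀ a, MemLp (coord a) 2 Q)
    (d : Fin 2 → ℝ) (w : ℝ × ℝ) (a : Fin 2) :
    g₀₁ P Q d w a = gform (d a) (kmean P (crossKernel a)) (kmean P (selfKernel a))
      (proj Q (crossKernel a) w) (proj Q (selfKernel a) w) := by
  -- Reassociating the product groups the two variables of the first sample, so that each term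
  -- factors.
  have hmp := measurePreserving_prodAssoc P P Q
  have hi : ∀ {h k : ℝ × ℝ → ℝ × ℝ → ℝ}, IsSymmKernel P h → IsSymmKernel Q k →
      Integrable (fun v : (ℝ × ℝ) × (ℝ × ℝ) × (ℝ × ℝ) => h v.1 v.2.1 * k w v.2.2)
        (P.prod (P.prod Q)) := by
    intro h k hh hk
    rw [← hmp.integrable_comp_emb MeasurableEquiv.prodAssoc.measurableEmbedding]
    exact (integrable_prod_kernel hh).mul_prod (hk.integrable w)
  have hv : ∀ {h k : ℝ × ℝ → ℝ × ℝ → ℝ}, IsSymmKernel P h → IsSymmKernel Q k →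
      ∫ v : (ℝ × ℝ) × (ℝ × ℝ) × (ℝ × ℝ), h v.1 v.2.1 * k w v.2.2 ∂(P.prod (P.prod Q)) =
        kmean P h * proj Q k w := by
    intro h k hh hk
    rw [← hmp.integral_comp MeasurableEquiv.prodAssoc.measurableEmbedding]
    rw [← kmean_eq_integral_prod hh]
    exact integral_prod_mul (fun v : (ℝ × ℝ) × (ℝ × ℝ) => h v.1 v.2) (fun v => k w v)
  have hP1 := isSymmKernel_crossKernel hP
  have hP2 := isSymmKernel_selfKernel hP
  have hQ1 := isSymmKernel_crossKernel hQ
  have hQ2 := isSymmKernel_selfKernel hQ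
  have hint : ∀ a, Integrable (fun v : (ℝ × ℝ) × (ℝ × ℝ) × (ℝ × ℝ) =>
      kernelH d v.1 v.2.1 w v.2.2 a) (P.prod (P.prod Q)) := by
    intro a
    simp only [kernelH_apply, gform]
    exact (((hi (hP2 a) (hQ2 a)).mul_const _).sub (hi (hP1 a) (hQ2 a))).add (hi (hP2 a) (hQ1 a))
  rw [g₀₁, eval_integral hint]
  simp only [kernelH_apply, gform]
  have hA : Integrable (fun v : (ℝ × ℝ) × (ℝ × ℝ) × (ℝ × ℝ) =>
      selfKernel a v.1 v.2.1 * selfKernel a w v.2.2 * d a) (P.prod (P.prod Q)) :=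
    (hi (hP2 a) (hQ2 a)).mul_const _
  rw [integral_sub_add hA (hi (hP1 a) (hQ2 a)) (hi (hP2 a) (hQ1 a)), integral_mul_const, hv (hP2 a) (hQ2 a),
    hv (hP1 a) (hQ2 a), hv (hP2 a) (hQ1 a)]

end Components

end GiniJEL

/-! ### Jackknife pseudo-values. -/

namespace GiniJEL

section PseudoValues

variable {m₁ m₂ : ℕ}

/-- The `U`-statistic with kernel `h` of the observations `z i`, `i ∈ A`. -/
noncomputable def sampleU (h : ℝ × ℝ → ℝ × ℝ → ℝ) {m : ℕ} (z : Fin m → ℝ × ℝ)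
    (A : Finset (Fin m)) : ℝ :=
  ustat (fun i j => h (z i) (z j)) A

/-- Every term of the kernel is a product of a function of the first sample and one of the second,
so the fourfold sum factors. This reduces all two-sample questions to one-sample U-statistics. -/
lemma twoSampleU_apply (d : Fin 2 → ℝ) (z : Fin m₁ → ℝ × ℝ) (w : Fin m₂ → ℝ × ℝ)
    (A : Finset (Fin m₁)) (B : Finset (Fin m₂)) (a : Fin 2) :
    twoSampleU d z w A B a = gform (d a) (sampleU (crossKernel a) z A) (sampleU (selfKernel a) z A)
      (sampleU (crossKernel a) w B) (sampleU (selfKernel a) w B) := by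
  simp only [twoSampleU, Pi.smul_apply, Finset.sum_apply, kernelH_apply, smul_eq_mul, gform,
    sampleU, ustat, Finset.sum_add_distrib, Finset.sum_sub_distrib, ← Finset.mul_sum,
    ← Finset.sum_mul]
  ring

/-- The antisymmetry under exchange of the samples, through which the asymptotics of the second
sample follow from those of the first. -/
lemma gform_swap (d a₁ a₂ b₁ b₂ : ℝ) : gform d a₁ a₂ b₁ b₂ = -gform (-d) b₁ b₂ a₁ a₂ := by
  simp only [gform]
  ring

/-- The pseudo-values of the first sample in terms of row means. -/
lemma pseudoValue_inl (d : Fin 2 → ℝ) (z : Fin m₁ → ℝ × ℝ) (w : Fin m₂ → ℝ × ℝ) (hm : 3 ≤ m₁)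
    (i : Fin m₁) (a : Fin 2) :
    pseudoValue d z w (Sum.inl i) a = twoSampleU d z w Finset.univ Finset.univ a +
      2 * ((m₁ : ℝ) + m₂ - 1) / (m₁ - 2) * gform (d a)
        (rowMean (fun i j => crossKernel a (z i) (z j)) i -
          sampleU (crossKernel a) z Finset.univ)
        (rowMean (fun i j => selfKernel a (z i) (z j)) i -
          sampleU (selfKernel a) z Finset.univ)
        (sampleU (crossKernel a) w Finset.univ) (sampleU (selfKernel a) w Finset.univ) := by
  -- A pseudo-value is `U + (n - 1) (U - U⁽⁻ⁱ⁾)`, and by linearity the difference is `gform` of the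
  -- two one-sample deletion effects.
  have h1 := ustat_univ_sub_erase (fun i j => crossKernel a (z i) (z j))
    (fun _ _ => giniKernel_symm _ _ _ _) hm i
  have h2 := ustat_univ_sub_erase (fun i j => selfKernel a (z i) (z j))
    (fun _ _ => giniKernel_symm _ _ _ _) hm i
  rw [sub_eq_iff_eq_add, ← sub_eq_iff_eq_add'] at h1 h2
  simp only [pseudoValue, Pi.sub_apply, Pi.smul_apply, smul_eq_mul, twoSampleU_apply]
  simp only [sampleU]
  rw [← h1, ← h2]
  simp only [gform]
  ring

/-- The pseudo-values of the second sample in terms of row means. -/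
lemma pseudoValue_inr (d : Fin 2 → ℝ) (z : Fin m₁ → ℝ × ℝ) (w : Fin m₂ → ℝ × ℝ) (hm : 3 ≤ m₂)
    (j : Fin m₂) (a : Fin 2) :
    pseudoValue d z w (Sum.inr j) a = twoSampleU d z w Finset.univ Finset.univ a +
      2 * ((m₁ : ℝ) + m₂ - 1) / (m₂ - 2) * gform (d a)
        (sampleU (crossKernel a) z Finset.univ) (sampleU (selfKernel a) z Finset.univ)
        (rowMean (fun i j => crossKernel a (w i) (w j)) j -
          sampleU (crossKernel a) w Finset.univ)
        (rowMean (fun i j => selfKernel a (w i) (w j)) j -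
          sampleU (selfKernel a) w Finset.univ) := by
  have h1 := ustat_univ_sub_erase (fun i j => crossKernel a (w i) (w j))
    (fun _ _ => giniKernel_symm _ _ _ _) hm j
  have h2 := ustat_univ_sub_erase (fun i j => selfKernel a (w i) (w j))
    (fun _ _ => giniKernel_symm _ _ _ _) hm j
  rw [sub_eq_iff_eq_add, ← sub_eq_iff_eq_add'] at h1 h2
  simp only [pseudoValue, Pi.sub_apply, Pi.smul_apply, smul_eq_mul, twoSampleU_apply]
  simp only [sampleU]
  rw [← h1, ← h2]
  simp only [gform]
  ring

lemma sum_gform_left {ι : Type*} [Fintype ι] (d : ℝ) (x y : ι → ℝ) (b₁ b₂ : ℝ) :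
    ∑ i, gform d (x i) (y i) b₁ b₂ = gform d (∑ i, x i) (∑ i, y i) b₁ b₂ := by
  simp only [gform, Finset.sum_add_distrib, Finset.sum_sub_distrib, ← Finset.sum_mul]

lemma sum_gform_right {ι : Type*} [Fintype ι] (d : ℝ) (x y : ι → ℝ) (a₁ a₂ : ℝ) :
    ∑ i, gform d a₁ a₂ (x i) (y i) = gform d a₁ a₂ (∑ i, x i) (∑ i, y i) := by
  simp only [gform, Finset.sum_add_distrib, Finset.sum_sub_distrib, ← Finset.sum_mul,
    ← Finset.mul_sum]

/-- The mean of the pseudo-values is the statistic itself. -/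
lemma sum_pseudoValue (d : Fin 2 → ℝ) (z : Fin m₁ → ℝ × ℝ) (w : Fin m₂ → ℝ × ℝ) (hm₁ : 3 ≤ m₁)
    (hm₂ : 3 ≤ m₂) (a : Fin 2) :
    ∑ i, pseudoValue d z w i a =
      ((m₁ : ℝ) + m₂) * twoSampleU d z w Finset.univ Finset.univ a := by
  rw [Fintype.sum_sum_type]
  simp only [pseudoValue_inl d z w hm₁, pseudoValue_inr d z w hm₂, Finset.sum_add_distrib,
    ← Finset.mul_sum, sum_gform_left, sum_gform_right]
  have hz : ∀ a b, ∑ i, (rowMean (fun i j => giniKernel (coord a) (coord b) (z i) (z j)) i -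
      sampleU (giniKernel (coord a) (coord b)) z Finset.univ) = 0 := fun a b =>
    sum_rowMean_sub_ustat _ (fun _ _ => giniKernel_symm _ _ _ _) (by omega)
  have hw : ∀ a b, ∑ i, (rowMean (fun i j => giniKernel (coord a) (coord b) (w i) (w j)) i -
      sampleU (giniKernel (coord a) (coord b)) w Finset.univ) = 0 := fun a b =>
    sum_rowMean_sub_ustat _ (fun _ _ => giniKernel_symm _ _ _ _) (by omega)
  simp only [crossKernel, selfKernel, hz, hw]
  simp only [gform, Finset.sum_const, Finset.card_univ, Fintype.card_fin, nsmul_eq_mul]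
  ring

end PseudoValues

/-! ### Averages under perturbations small in quadratic mean. -/

section Averages

variable {m : ℕ → ℕ}

/-- The Cauchy-Schwarz inequality for averages along a sequence. -/
lemma tendsto_avg_mul_zero {x y : ∀ k, Fin (m k) → ℝ} {s : ℝ}
    (hx : Tendsto (fun k => (m k : ℝ)⁻¹ * ∑ i, x k i ^ 2) atTop (𝓝 0))
    (hy : Tendsto (fun k => (m k : ℝ)⁻¹ * ∑ i, y k i ^ 2) atTop (𝓝 s)) :
    Tendsto (fun k => (m k : ℝ)⁻¹ * ∑ i, x k i * y k i) atTop (𝓝 0) := by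
  have h := (hx.mul hy).sqrt
  rw [zero_mul, Real.sqrt_zero] at h
  refine squeeze_zero_norm (fun k => ?_) h
  rw [Real.norm_eq_abs]
  refine Real.abs_le_sqrt ?_
  have := Finset.sum_mul_sq_le_sq_mul_sq Finset.univ (x k) (y k)
  calc ((m k : ℝ)⁻¹ * ∑ i, x k i * y k i) ^ 2
      = (m k : ℝ)⁻¹ ^ 2 * (∑ i, x k i * y k i) ^ 2 := mul_pow _ _ _
    _ ≤ (m k : ℝ)⁻¹ ^ 2 * ((∑ i, x k i ^ 2) * ∑ i, y k i ^ 2) :=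
        mul_le_mul_of_nonneg_left this (sq_nonneg _)
    _ = _ := by ring

/-- The limit of averages of products is stable under perturbations that vanish in quadratic mean.
-/
lemma tendsto_avg_mul {x y x' y' : ∀ k, Fin (m k) → ℝ} {s sx sy : ℝ}
    (hx : Tendsto (fun k => (m k : ℝ)⁻¹ * ∑ i, (x k i - x' k i) ^ 2) atTop (𝓝 0))
    (hy : Tendsto (fun k => (m k : ℝ)⁻¹ * ∑ i, (y k i - y' k i) ^ 2) atTop (𝓝 0))
    (hx' : Tendsto (fun k => (m k : ℝ)⁻¹ * ∑ i, x' k i ^ 2) atTop (𝓝 sx))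
    (hy' : Tendsto (fun k => (m k : ℝ)⁻¹ * ∑ i, y' k i ^ 2) atTop (𝓝 sy))
    (hxy : Tendsto (fun k => (m k : ℝ)⁻¹ * ∑ i, x' k i * y' k i) atTop (𝓝 s)) :
    Tendsto (fun k => (m k : ℝ)⁻¹ * ∑ i, x k i * y k i) atTop (𝓝 s) := by
  -- Expansion of `x y` around `x' y'`; each of the three error terms contains a vanishing factor
  -- and falls to Cauchy-Schwarz.
  have h := ((tendsto_avg_mul_zero hx hy).add ((tendsto_avg_mul_zero hx hy').add
    (tendsto_avg_mul_zero hy hx'))).add hxy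
  simp only [add_zero, zero_add] at h
  refine h.congr fun k => ?_
  rw [← mul_add, ← mul_add, ← mul_add, ← Finset.sum_add_distrib, ← Finset.sum_add_distrib,
    ← Finset.sum_add_distrib]
  congr 1
  refine Finset.sum_congr rfl fun i _ => ?_
  ring

/-- Negligibility of the maximum is stable under perturbations that vanish in quadratic mean. -/
lemma tendsto_norm_of_avg {x x' : ∀ k, Fin (m k) → ℝ}
    (hx : Tendsto (fun k => (m k : ℝ)⁻¹ * ∑ i, (x k i - x' k i) ^ 2) atTop (𝓝 0))
    (hx' : Tendsto (fun k => ‖x' k‖ / √(m k : ℝ)) atTop (𝓝 0)) :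
    Tendsto (fun k => ‖x k‖ / √(m k : ℝ)) atTop (𝓝 0) := by
  have h := hx.sqrt.add hx'
  rw [Real.sqrt_zero, add_zero] at h
  refine squeeze_zero (fun k => by positivity) (fun k => ?_) h
  -- The maximum of the perturbation is bounded by its Euclidean norm, which is `o(√m)`.
  have h1 : ‖x k‖ ≤ √(∑ i, (x k i - x' k i) ^ 2) + ‖x' k‖ := by
    refine (pi_norm_le_iff_of_nonneg (by positivity)).2 fun i => ?_
    have e : x k i = (x k i - x' k i) + x' k i := by ring
    rw [e]
    refine (norm_add_le _ _).trans (add_le_add ?_ (norm_le_pi_norm (x' k) i))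
    exact Real.abs_le_sqrt (Finset.single_le_sum (f := fun i => (x k i - x' k i) ^ 2)
      (fun _ _ => sq_nonneg _) (Finset.mem_univ i))
  rw [Real.sqrt_mul' _ (Finset.sum_nonneg fun _ _ => sq_nonneg _), Real.sqrt_inv]
  calc ‖x k‖ / √(m k : ℝ) ≤ (√(∑ i, (x k i - x' k i) ^ 2) + ‖x' k‖) / √(m k : ℝ) :=
        div_le_div_of_nonneg_right h1 (Real.sqrt_nonneg _)
    _ = _ := by ring

lemma tendsto_gform {d : ℝ} {a₁ a₂ b₁ b₂ : ℕ → ℝ} {A₁ A₂ B₁ B₂ : ℝ}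
    (h₁ : Tendsto a₁ atTop (𝓝 A₁)) (h₂ : Tendsto a₂ atTop (𝓝 A₂))
    (h₃ : Tendsto b₁ atTop (𝓝 B₁)) (h₄ : Tendsto b₂ atTop (𝓝 B₂)) :
    Tendsto (fun k => gform d (a₁ k) (a₂ k) (b₁ k) (b₂ k)) atTop (𝓝 (gform d A₁ A₂ B₁ B₂)) :=
  (((h₂.mul h₄).mul_const d).sub (h₁.mul h₄)).add (h₂.mul h₃)

/-- The quadratic mean approximation of the pseudo-values by the projections. -/
lemma tendsto_avg_pseudoValue {x₁ x₂ y₁ y₂ : ∀ k, Fin (m k) → ℝ} {A₁ A₂ B₁ B₂ U c : ℕ → ℝ}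
    {θ₁ θ₂ b₁ b₂ c₀ d s₁ s₂ : ℝ} (hm : Tendsto m atTop atTop)
    (hx₁ : Tendsto (fun k => (m k : ℝ)⁻¹ * ∑ i, (x₁ k i - y₁ k i) ^ 2) atTop (𝓝 0))
    (hx₂ : Tendsto (fun k => (m k : ℝ)⁻¹ * ∑ i, (x₂ k i - y₂ k i) ^ 2) atTop (𝓝 0))
    (hy₁ : Tendsto (fun k => (m k : ℝ)⁻¹ * ∑ i, y₁ k i ^ 2) atTop (𝓝 s₁))
    (hy₂ : Tendsto (fun k => (m k : ℝ)⁻¹ * ∑ i, y₂ k i ^ 2) atTop (𝓝 s₂))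
    (hA₁ : Tendsto A₁ atTop (𝓝 θ₁)) (hA₂ : Tendsto A₂ atTop (𝓝 θ₂))
    (hB₁ : Tendsto B₁ atTop (𝓝 b₁)) (hB₂ : Tendsto B₂ atTop (𝓝 b₂))
    (hU : Tendsto U atTop (𝓝 0)) (hc : Tendsto c atTop (𝓝 c₀))
    (h0 : gform d θ₁ θ₂ b₁ b₂ = 0) :
    Tendsto (fun k => (m k : ℝ)⁻¹ * ∑ i, (U k + c k *
      gform d (x₁ k i - A₁ k) (x₂ k i - A₂ k) (B₁ k) (B₂ k) -
        c₀ * gform d (y₁ k i) (y₂ k i) b₁ b₂) ^ 2) atTop (𝓝 0) := by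
  -- the coefficients of the expansion
  set e₀ : ℕ → ℝ := fun k => U k - c k * gform d (A₁ k) (A₂ k) (B₁ k) (B₂ k) with he₀
  set p₁ : ℕ → ℝ := fun k => -(c k * B₂ k) with hp₁
  set p₂ : ℕ → ℝ := fun k => c k * (d * B₂ k + B₁ k) with hp₂
  set e₁ : ℕ → ℝ := fun k => p₁ k + c₀ * b₂ with he₁
  set e₂ : ℕ → ℝ := fun k => p₂ k - c₀ * (d * b₂ + b₁) with he₂
  have t₀ : Tendsto e₀ atTop (𝓝 0) := by
    have := hU.sub (hc.mul (tendsto_gform (d := d) hA₁ hA₂ hB₁ hB₂))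
    simpa [h0] using this
  have tp₁ : Tendsto p₁ atTop (𝓝 (-(c₀ * b₂))) := (hc.mul hB₂).neg
  have tp₂ : Tendsto p₂ atTop (𝓝 (c₀ * (d * b₂ + b₁))) :=
    hc.mul ((hB₂.const_mul d).add hB₁)
  have t₁ : Tendsto e₁ atTop (𝓝 0) := by
    have := tp₁.add_const (c₀ * b₂)
    rwa [neg_add_cancel] at this
  have t₂ : Tendsto e₂ atTop (𝓝 0) := by
    have := tp₂.sub_const (c₀ * (d * b₂ + b₁))
    rwa [sub_self] at this
  -- The error is a sum of five terms, so its square is at most five times the sum of the squares.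
  -- In each term either the coefficient or the average tends to zero, while the other factor
  -- converges.
  have hbound := ((((t₀.pow 2).add ((tp₁.pow 2).mul hx₁)).add ((tp₂.pow 2).mul hx₂)).add
    ((t₁.pow 2).mul hy₁)).add ((t₂.pow 2).mul hy₂)
  have hlim := hbound.const_mul 5
  simp only [mul_zero, zero_mul, add_zero, ne_eq, OfNat.ofNat_ne_zero, not_false_eq_true,
    zero_pow] at hlim
  refine squeeze_zero' (Eventually.of_forall fun k => by positivity)
    ((hm.eventually_gt_atTop 0).mono fun k hk => ?_) hlim
  have hk' : (m k : ℝ) ≠ 0 := by exact_mod_cast hk.ne'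
  have hpt : ∀ i, (U k + c k * gform d (x₁ k i - A₁ k) (x₂ k i - A₂ k) (B₁ k) (B₂ k) -
        c₀ * gform d (y₁ k i) (y₂ k i) b₁ b₂) ^ 2 ≤ 5 * (e₀ k ^ 2 + p₁ k ^ 2 *
        (x₁ k i - y₁ k i) ^ 2 + p₂ k ^ 2 * (x₂ k i - y₂ k i) ^ 2 + e₁ k ^ 2 * y₁ k i ^ 2 +
        e₂ k ^ 2 * y₂ k i ^ 2) := by
    intro i
    have e : U k + c k * gform d (x₁ k i - A₁ k) (x₂ k i - A₂ k) (B₁ k) (B₂ k) -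
        c₀ * gform d (y₁ k i) (y₂ k i) b₁ b₂ = e₀ k + p₁ k * (x₁ k i - y₁ k i) +
          p₂ k * (x₂ k i - y₂ k i) + e₁ k * y₁ k i + e₂ k * y₂ k i := by
      simp only [he₀, he₁, he₂, hp₁, hp₂, gform]
      ring
    rw [e, ← mul_pow, ← mul_pow, ← mul_pow, ← mul_pow]
    generalize p₁ k * (x₁ k i - y₁ k i) = q₁
    generalize p₂ k * (x₂ k i - y₂ k i) = q₂
    generalize e₁ k * y₁ k i = q₃
    generalize e₂ k * y₂ k i = q₄
    generalize e₀ k = q₀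
    nlinarith [sq_nonneg (q₀ - q₁), sq_nonneg (q₀ - q₂), sq_nonneg (q₀ - q₃), sq_nonneg (q₀ - q₄),
      sq_nonneg (q₁ - q₂), sq_nonneg (q₁ - q₃), sq_nonneg (q₁ - q₄), sq_nonneg (q₂ - q₃),
      sq_nonneg (q₂ - q₄), sq_nonneg (q₃ - q₄)]
  calc _ ≤ (m k : ℝ)⁻¹ * ∑ i, 5 * (e₀ k ^ 2 + p₁ k ^ 2 *
        (x₁ k i - y₁ k i) ^ 2 + p₂ k ^ 2 * (x₂ k i - y₂ k i) ^ 2 + e₁ k ^ 2 * y₁ k i ^ 2 +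
        e₂ k ^ 2 * y₂ k i ^ 2) :=
        mul_le_mul_of_nonneg_left (Finset.sum_le_sum fun i _ => hpt i) (by positivity)
    _ = _ := by
        rw [← Finset.mul_sum]
        simp only [Finset.sum_add_distrib, ← Finset.mul_sum, Finset.sum_const, Finset.card_univ,
          Fintype.card_fin, nsmul_eq_mul]
        field_simp

end Averages

end GiniJEL

/-! ### The two-sample central limit theorem. -/

namespace GiniJEL

variable {Ω : Type*} [MeasurableSpace Ω] {μ : Measure Ω}
  {E : Type*} [MeasurableSpace E] {P Q : Measure E} {Z W : ℕ → Ω → E}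

/-- Statistics of the two samples are independent. -/
lemma indepFun_sum_sum (hZ : ∀ i, Measurable (Z i)) (hW : ∀ i, Measurable (W i))
    (hZW : iIndepFun (fun s : ℕ ⊕ ℕ => Sum.elim Z W s) μ) {u v : E → ℝ} (hu : Measurable u)
    (hv : Measurable v) (m₁ m₂ : ℕ) :
    IndepFun (fun ω => ∑ i : Fin m₁, u (Z i ω)) (fun ω => ∑ j : Fin m₂, v (W j ω)) μ := by
  classical
  set S : Finset (ℕ ⊕ ℕ) := (Finset.range m₁).image Sum.inl
  set T : Finset (ℕ ⊕ ℕ) := (Finset.range m₂).image Sum.inr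
  have hST : Disjoint S T := by
    rw [Finset.disjoint_left]
    intro a ha hb
    simp only [S, T, Finset.mem_image] at ha hb
    obtain ⟨i, _, rfl⟩ := ha
    obtain ⟨j, _, h⟩ := hb
    cases h
  have h := hZW.indepFun_finset S T hST (fun s => by cases s; exacts [hZ _, hW _])
  let φ : (S → E) → ℝ := fun x => ∑ i : Fin m₁, u (x ⟨Sum.inl (i : ℕ), by simp [S]⟩)
  let ψ : (T → E) → ℝ := fun x => ∑ i : Fin m₂, v (x ⟨Sum.inr (i : ℕ), by simp [T]⟩)
  have hφ : Measurable φ :=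
    Finset.measurable_sum _ fun i _ => hu.comp (measurable_pi_apply _)
  have hψ : Measurable ψ :=
    Finset.measurable_sum _ fun i _ => hv.comp (measurable_pi_apply _)
  exact h.comp hφ hψ

variable [IsProbabilityMeasure μ]

/-- The limit of the characteristic functions of linear combinations of independent asymptotically
normal sequences. -/
lemma tendsto_charFun_add {X Y : ℕ → Ω → ℝ} {s t : NNReal}
    (hX : TendstoInDistribution X atTop (fun x : ℝ => x) (fun _ => μ) (gaussianReal 0 s))
    (hY : TendstoInDistribution Y atTop (fun x : ℝ => x) (fun _ => μ) (gaussianReal 0 t))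
    (hXY : ∀ k, IndepFun (X k) (Y k) μ) (a b : ℝ) :
    Tendsto (fun k => charFun (μ.map fun ω => a * X k ω + b * Y k ω) 1) atTop
      (𝓝 (Complex.exp (-((a ^ 2 * s + b ^ 2 * t : ℝ) : ℂ) / 2))) := by
  have h1 := ProbabilityMeasure.tendsto_iff_tendsto_charFun.1 hX.tendsto a
  have h2 := ProbabilityMeasure.tendsto_iff_tendsto_charFun.1 hY.tendsto b
  simp only [ProbabilityMeasure.coe_mk] at h1 h2
  have hid : ∀ ν : Measure ℝ, ν.map (fun x : ℝ => x) = ν := fun ν => Measure.map_id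
  rw [hid, charFun_gaussianReal] at h1 h2
  have e : ∀ k, charFun (μ.map fun ω => a * X k ω + b * Y k ω) 1 =
      charFun (μ.map (X k)) a * charFun (μ.map (Y k)) b := by
    intro k
    have hXm := hX.forall_aemeasurable k
    have hYm := hY.forall_aemeasurable k
    have hI : IndepFun (fun ω => a * X k ω) (fun ω => b * Y k ω) μ :=
      (hXY k).comp (φ := fun x => a * x) (ψ := fun x => b * x) (by fun_prop) (by fun_prop)
    rw [hI.charFun_map_fun_add_eq_mul (hXm.const_mul a) (hYm.const_mul b), Pi.mul_apply,
      charFun_map_mul_comp hXm, charFun_map_mul_comp hYm, mul_one, mul_one]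
  simp_rw [e]
  convert h1.mul h2 using 2
  rw [← Complex.exp_add]
  congr 1
  push_cast
  ring

/-- The two-sample central limit theorem for normalized sums of centered random vectors. -/
theorem tendstoInDistribution_two_sample [IsProbabilityMeasure P] [IsProbabilityMeasure Q]
    (hZ : IsIID P Z μ) (hW : IsIID Q W μ)
    (hZW : iIndepFun (fun s : ℕ ⊕ ℕ => Sum.elim Z W s) μ) {G K : Fin 2 → E → ℝ}
    (hG : ∀ a, Measurable (G a)) (hK : ∀ a, Measurable (K a))
    (hG2 : ∀ a, MemLp (G a) 2 P) (hK2 : ∀ a, MemLp (K a) 2 Q)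
    (hG0 : ∀ a, ∫ z, G a z ∂P = 0) (hK0 : ∀ a, ∫ z, K a z ∂Q = 0) {κ₁ κ₂ : ℝ}
    {A C : Matrix (Fin 2) (Fin 2) ℝ} (hAC : A * C * A.transpose = 1)
    (hC : ∀ a b, C a b = κ₁ ^ 2 * ∫ z, G a z * G b z ∂P + κ₂ ^ 2 * ∫ z, K a z * K b z ∂Q)
    {n₁ n₂ : ℕ → ℕ} (hn₁ : Tendsto n₁ atTop atTop) (hn₂ : Tendsto n₂ atTop atTop) :
    TendstoInDistribution (fun k ω => A.mulVec fun a =>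
        κ₁ * ((√(n₁ k : ℝ))⁻¹ * ∑ i : Fin (n₁ k), G a (Z i ω)) +
        κ₂ * ((√(n₂ k : ℝ))⁻¹ * ∑ j : Fin (n₂ k), K a (W j ω))) atTop
      (fun x : Fin 2 → ℝ => x) (fun _ => μ) (Measure.pi fun _ => gaussianReal 0 1) := by
  set L : ℕ → Ω → Fin 2 → ℝ := fun k ω => A.mulVec fun a =>
        κ₁ * ((√(n₁ k : ℝ))⁻¹ * ∑ i : Fin (n₁ k), G a (Z i ω)) +
        κ₂ * ((√(n₂ k : ℝ))⁻¹ * ∑ j : Fin (n₂ k), K a (W j ω)) with hL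
  have mL : ∀ k, Measurable (L k) := by
    intro k
    refine measurable_pi_lambda _ fun a => ?_
    simp only [hL, Matrix.mulVec, dotProduct]
    refine Finset.measurable_sum _ fun b _ => ?_
    refine Measurable.const_mul ?_ _
    have h1 : Measurable fun ω => ∑ i : Fin (n₁ k), G b (Z i ω) :=
      Finset.measurable_sum _ fun i _ => (hG b).comp (hZ.measurable i)
    have h2 : Measurable fun ω => ∑ j : Fin (n₂ k), K b (W j ω) :=
      Finset.measurable_sum _ fun j _ => (hK b).comp (hW.measurable j)
    exact ((h1.const_mul _).const_mul _).add ((h2.const_mul _).const_mul _)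
  -- Characteristic functions need an inner product, so the convergence is proved in Euclidean space
  -- and transported back at the end.
  have hto : Measurable (WithLp.toLp 2 : (Fin 2 → ℝ) → EuclideanSpace ℝ (Fin 2)) := by fun_prop
  have hE : TendstoInDistribution (fun k ω => (WithLp.toLp 2 (L k ω) : EuclideanSpace ℝ (Fin 2)))
      atTop (fun x : Fin 2 → ℝ => (WithLp.toLp 2 x : EuclideanSpace ℝ (Fin 2))) (fun _ => μ)
      (Measure.pi fun _ => gaussianReal 0 1) := by
    refine ⟨fun k => (hto.comp (mL k)).aemeasurable, hto.aemeasurable, ?_⟩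
    refine ProbabilityMeasure.tendsto_iff_tendsto_charFun.2 fun t => ?_
    simp only [ProbabilityMeasure.coe_mk]
    have hlim : (Measure.pi fun _ : Fin 2 => gaussianReal 0 1).map
        (fun x => (WithLp.toLp 2 x : EuclideanSpace ℝ (Fin 2))) =
        stdGaussian (EuclideanSpace ℝ (Fin 2)) := map_pi_eq_stdGaussian
    rw [hlim, charFun_stdGaussian]
    -- Pairing with `t` after applying `A` is pairing with `Aᵀ t`: scalar central limit theorems for
    -- `u` and `v` suffice (Cramér-Wold), with limit variance `tᵀ A C Aᵀ t = ‖t‖ ^ 2`.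
    set s : Fin 2 → ℝ := fun b => ∑ a, A a b * t a with hs
    set u : E → ℝ := fun z => ∑ b, s b * G b z with hu
    set v : E → ℝ := fun z => ∑ b, s b * K b z with hv
    have mu : Measurable u := Finset.measurable_sum _ fun b _ => (hG b).const_mul _
    have mv : Measurable v := Finset.measurable_sum _ fun b _ => (hK b).const_mul _
    have hu2 : MemLp u 2 P := memLp_finsetSum _ fun b _ => (hG2 b).const_mul _
    have hv2 : MemLp v 2 Q := memLp_finsetSum _ fun b _ => (hK2 b).const_mul _
    have hu0 : ∫ z, u z ∂P = 0 := by
      simp only [hu]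
      rw [integral_finsetSum _ fun b _ => ((hG2 b).integrable (by norm_num)).const_mul _]
      simp [integral_const_mul, hG0]
    have hv0 : ∫ z, v z ∂Q = 0 := by
      simp only [hv]
      rw [integral_finsetSum _ fun b _ => ((hK2 b).integrable (by norm_num)).const_mul _]
      simp [integral_const_mul, hK0]
    have hX := (hZ.tendstoInDistribution mu hu2 hu0)
    have hY := (hW.tendstoInDistribution mv hv2 hv0)
    have hX' : TendstoInDistribution (fun k ω => (√(n₁ k : ℝ))⁻¹ * ∑ i : Fin (n₁ k), u (Z i ω))
        atTop (fun x : ℝ => x) (fun _ => μ) (gaussianReal 0 (∫ z, u z ^ 2 ∂P).toNNReal) :=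
      ⟨fun k => hX.forall_aemeasurable (n₁ k), hX.aemeasurable_limit, hX.tendsto.comp hn₁⟩
    have hY' : TendstoInDistribution (fun k ω => (√(n₂ k : ℝ))⁻¹ * ∑ i : Fin (n₂ k), v (W i ω))
        atTop (fun x : ℝ => x) (fun _ => μ) (gaussianReal 0 (∫ z, v z ^ 2 ∂Q).toNNReal) :=
      ⟨fun k => hY.forall_aemeasurable (n₂ k), hY.aemeasurable_limit, hY.tendsto.comp hn₂⟩
    have hI : ∀ k, IndepFun (fun ω => (√(n₁ k : ℝ))⁻¹ * ∑ i : Fin (n₁ k), u (Z i ω))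
        (fun ω => (√(n₂ k : ℝ))⁻¹ * ∑ i : Fin (n₂ k), v (W i ω)) μ := fun k =>
      (indepFun_sum_sum hZ.measurable hW.measurable hZW mu mv (n₁ k) (n₂ k)).comp
        (φ := fun x => (√(n₁ k : ℝ))⁻¹ * x) (ψ := fun x => (√(n₂ k : ℝ))⁻¹ * x)
        (by fun_prop) (by fun_prop)
    have hch := tendsto_charFun_add hX' hY' hI κ₁ κ₂
    rw [Real.coe_toNNReal _ (integral_nonneg fun _ => sq_nonneg _),
      Real.coe_toNNReal _ (integral_nonneg fun _ => sq_nonneg _)] at hch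
    -- the variance of the linear combination
    have hquad : ∀ (ν : Measure E) (F : Fin 2 → E → ℝ), (∀ a, MemLp (F a) 2 ν) →
        (∫ z, (∑ b, s b * F b z) ^ 2 ∂ν) = ∑ a, ∑ b, s a * s b * (∫ z, F a z * F b z ∂ν) := by
      intro ν F hF
      have hint : ∀ a b, Integrable (fun z => s a * s b * (F a z * F b z)) ν := fun a b =>
        ((hF a).integrable_mul (hF b)).const_mul _
      have e : ∀ z, (∑ b, s b * F b z) ^ 2 = ∑ a, ∑ b, s a * s b * (F a z * F b z) := by
        intro z
        simp only [Fin.sum_univ_two]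
        ring
      simp_rw [e]
      rw [integral_finsetSum _ fun a _ => integrable_finsetSum _ fun b _ => hint a b]
      refine Finset.sum_congr rfl fun a _ => ?_
      rw [integral_finsetSum _ fun b _ => hint a b]
      simp_rw [integral_const_mul]
    have hnorm : κ₁ ^ 2 * ∫ z, u z ^ 2 ∂P + κ₂ ^ 2 * ∫ z, v z ^ 2 ∂Q = ‖t‖ ^ 2 := by
      have h1 : κ₁ ^ 2 * ∫ z, u z ^ 2 ∂P + κ₂ ^ 2 * ∫ z, v z ^ 2 ∂Q =
          ∑ a, ∑ b, s a * s b * C a b := by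
        rw [hquad P G hG2, hquad Q K hK2]
        simp only [hC, Fin.sum_univ_two]
        ring
      have h2 : ∑ a, ∑ b, s a * s b * C a b =
          ∑ c, ∑ e, t c * t e * (A * C * A.transpose) c e := by
        simp only [hs, Matrix.mul_apply, Matrix.transpose_apply, Fin.sum_univ_two]
        ring
      rw [h1, h2, hAC, EuclideanSpace.norm_sq_eq]
      simp [Fin.sum_univ_two]
      ring
    rw [hnorm] at hch
    have hlimeq : Complex.exp (-((‖t‖ ^ 2 : ℝ) : ℂ) / 2) = Complex.exp (-(‖t‖ : ℂ) ^ 2 / 2) := by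
      push_cast
      rfl
    rw [hlimeq] at hch
    refine hch.congr fun k => ?_
    have hmeas : AEMeasurable (fun ω => κ₁ * ((√(n₁ k : ℝ))⁻¹ * ∑ i : Fin (n₁ k), u (Z i ω)) +
        κ₂ * ((√(n₂ k : ℝ))⁻¹ * ∑ i : Fin (n₂ k), v (W i ω))) μ :=
      ((hX'.forall_aemeasurable k).const_mul _).add ((hY'.forall_aemeasurable k).const_mul _)
    rw [charFun_apply, charFun_apply, integral_map hmeas (by fun_prop),
      integral_map (φ := fun ω => (WithLp.toLp 2 (L k ω) : EuclideanSpace ℝ (Fin 2)))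
        (hto.comp (mL k)).aemeasurable (by fun_prop)]
    refine integral_congr_ae (ae_of_all _ fun ω => ?_)
    simp only
    congr 3
    rw [PiLp.inner_apply]
    simp only [RCLike.inner_apply, conj_trivial, one_mul, hL, hu, hv, hs, Matrix.mulVec, dotProduct,
      Fin.sum_univ_two, Finset.sum_add_distrib, ← Finset.mul_sum]
    ring
  exact hE.continuous_comp (g := fun x : EuclideanSpace ℝ (Fin 2) => WithLp.ofLp x) (by fun_prop)

end GiniJEL

/-! ### Asymptotics of pseudo-values along typical arrays. -/

namespace GiniJEL

/-- A triangular array of observations along which the Gini kernels and the functions `G` satisfy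
the limit theorems for samples from `P`. -/
structure IsTypical (P : Measure (ℝ × ℝ)) (G : Fin 2 → ℝ × ℝ → ℝ) (m : ℕ → ℕ)
    (z : ∀ k, Fin (m k) → ℝ × ℝ) : Prop where
  tendsto_size : Tendsto m atTop atTop
  rowMean : ∀ a b, Tendsto (fun k => (m k : ℝ)⁻¹ * ∑ i,
    (GiniJEL.rowMean (fun i j => giniKernel (coord a) (coord b) (z k i) (z k j)) i -
      proj P (giniKernel (coord a) (coord b)) (z k i)) ^ 2) atTop (𝓝 0)
  ustat : ∀ a b, Tendsto (fun k => √√(m k : ℝ) *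
    (sampleU (giniKernel (coord a) (coord b)) (z k) Finset.univ -
      kmean P (giniKernel (coord a) (coord b)))) atTop (𝓝 0)
  hoeffding : ∀ a b, Tendsto (fun k => √(m k : ℝ) *
    (sampleU (giniKernel (coord a) (coord b)) (z k) Finset.univ -
      kmean P (giniKernel (coord a) (coord b)) - 2 / (m k : ℝ) *
        ∑ i, (proj P (giniKernel (coord a) (coord b)) (z k i) -
          kmean P (giniKernel (coord a) (coord b))))) atTop (𝓝 0)
  mean_sq_proj : ∀ a b, Tendsto (fun k => (m k : ℝ)⁻¹ *
    ∑ i, proj P (giniKernel (coord a) (coord b)) (z k i) ^ 2) atTop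
      (𝓝 (∫ x, proj P (giniKernel (coord a) (coord b)) x ^ 2 ∂P))
  mean_mul : ∀ a b, Tendsto (fun k => (m k : ℝ)⁻¹ * ∑ i, G a (z k i) * G b (z k i)) atTop
    (𝓝 (∫ x, G a x * G b x ∂P))
  norm : ∀ a, Tendsto (fun k => ‖fun i => G a (z k i)‖ / √(m k : ℝ)) atTop (𝓝 0)

section Deterministic

variable {P Q : Measure (ℝ × ℝ)} {G K : Fin 2 → ℝ × ℝ → ℝ} {d : Fin 2 → ℝ} {m₁ m₂ : ℕ → ℕ}
  {z : ∀ k, Fin (m₁ k) → ℝ × ℝ} {w : ∀ k, Fin (m₂ k) → ℝ × ℝ}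

lemma IsTypical.tendsto_sqrt (h : IsTypical P G m₁ z) :
    Tendsto (fun k => √(m₁ k : ℝ)) atTop atTop :=
  Real.tendsto_sqrt_atTop.comp (tendsto_natCast_atTop_atTop.comp h.tendsto_size)

lemma IsTypical.tendsto_sampleU (h : IsTypical P G m₁ z) (a b : Fin 2) :
    Tendsto (fun k => sampleU (giniKernel (coord a) (coord b)) (z k) Finset.univ) atTop
      (𝓝 (kmean P (giniKernel (coord a) (coord b)))) := by
  have hss := Real.tendsto_sqrt_atTop.comp h.tendsto_sqrt
  have h1 := (hss.inv_tendsto_atTop.mul (h.ustat a b)).add_const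
    (kmean P (giniKernel (coord a) (coord b)))
  rw [mul_zero, zero_add] at h1
  refine h1.congr' ((hss.eventually_gt_atTop 0).mono fun k hk => ?_)
  simp only [Function.comp_apply] at hk
  simp only [Pi.inv_apply, Function.comp_apply]
  rw [inv_mul_cancel_left₀ hk.ne', sub_add_cancel]

lemma tendsto_twoSampleU (h₁ : IsTypical P G m₁ z) (h₂ : IsTypical Q K m₂ w) {a : Fin 2}
    (h0 : gform (d a) (kmean P (crossKernel a)) (kmean P (selfKernel a))
      (kmean Q (crossKernel a)) (kmean Q (selfKernel a)) = 0) :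
    Tendsto (fun k => twoSampleU d (z k) (w k) Finset.univ Finset.univ a) atTop (𝓝 0) := by
  simp only [twoSampleU_apply]
  rw [← h0]
  exact tendsto_gform (h₁.tendsto_sampleU _ _) (h₁.tendsto_sampleU _ _) (h₂.tendsto_sampleU _ _)
    (h₂.tendsto_sampleU _ _)

/-- The limit of the normalization of the pseudo-values. -/
lemma tendsto_jackknife_coeff {x y : ℕ → ℝ} {ρ : ℝ} (hρ : 0 < ρ) (hy : Tendsto y atTop atTop)
    (h : Tendsto (fun k => x k / y k) atTop (𝓝 ρ)) :
    Tendsto (fun k => 2 * (y k - 1) / (x k - 2)) atTop (𝓝 (2 / ρ)) := by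
  have hi := hy.inv_tendsto_atTop
  have h1 := ((tendsto_const_nhds (x := (1 : ℝ))).sub hi).const_mul 2
  have h2 := h.sub (hi.const_mul 2)
  have h3 := h1.div h2 (by simpa using hρ.ne')
  simp only [sub_zero, mul_zero, mul_one] at h3
  refine h3.congr' ((hy.eventually_gt_atTop 0).mono fun k hk => ?_)
  have : y k ≠ 0 := hk.ne'
  simp only [Pi.div_apply, Pi.inv_apply]
  have e1 : 2 * (1 - (y k)⁻¹) = 2 * (y k - 1) / y k := by field_simp
  have e2 : x k / y k - 2 * (y k)⁻¹ = (x k - 2) / y k := by field_simp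
  rw [e1, e2, div_div_div_cancel_right₀ this]

variable {ρ₁ ρ₂ : ℝ}

/-- The pseudo-values of the first sample are close to projections in quadratic mean. -/
lemma tendsto_avg_pseudoValue_inl (h₁ : IsTypical P G m₁ z) (h₂ : IsTypical Q K m₂ w) {a : Fin 2}
    (hG : ∀ x, G a x = gform (d a) (proj P (crossKernel a) x) (proj P (selfKernel a) x)
      (kmean Q (crossKernel a)) (kmean Q (selfKernel a)))
    (h0 : gform (d a) (kmean P (crossKernel a)) (kmean P (selfKernel a))
      (kmean Q (crossKernel a)) (kmean Q (selfKernel a)) = 0) (hρ₁ : 0 < ρ₁)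
    (hr₁ : Tendsto (fun k => (m₁ k : ℝ) / (m₁ k + m₂ k)) atTop (𝓝 ρ₁)) :
    Tendsto (fun k => (m₁ k : ℝ)⁻¹ * ∑ i, (pseudoValue d (z k) (w k) (Sum.inl i) a -
      2 / ρ₁ * G a (z k i)) ^ 2) atTop (𝓝 0) := by
  have hy : Tendsto (fun k => (m₁ k : ℝ) + m₂ k) atTop atTop :=
    (tendsto_natCast_atTop_atTop.comp h₁.tendsto_size).atTop_add_nonneg fun k => Nat.cast_nonneg _
  have h := tendsto_avg_pseudoValue h₁.tendsto_size (h₁.rowMean a (1 - a)) (h₁.rowMean a a)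
    (h₁.mean_sq_proj a (1 - a)) (h₁.mean_sq_proj a a) (h₁.tendsto_sampleU a (1 - a))
    (h₁.tendsto_sampleU a a) (h₂.tendsto_sampleU a (1 - a)) (h₂.tendsto_sampleU a a)
    (tendsto_twoSampleU h₁ h₂ h0) (tendsto_jackknife_coeff hρ₁ hy hr₁) h0
  refine h.congr' ((h₁.tendsto_size.eventually_ge_atTop 3).mono fun k hk => ?_)
  simp only
  congr 1
  refine Finset.sum_congr rfl fun i _ => ?_
  rw [pseudoValue_inl d (z k) (w k) hk, hG]
  rfl

/-- The pseudo-values of the second sample are close to projections in quadratic mean. -/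
lemma tendsto_avg_pseudoValue_inr (h₁ : IsTypical P G m₁ z) (h₂ : IsTypical Q K m₂ w) {a : Fin 2}
    (hK : ∀ x, K a x = gform (d a) (kmean P (crossKernel a)) (kmean P (selfKernel a))
      (proj Q (crossKernel a) x) (proj Q (selfKernel a) x))
    (h0 : gform (d a) (kmean P (crossKernel a)) (kmean P (selfKernel a))
      (kmean Q (crossKernel a)) (kmean Q (selfKernel a)) = 0) (hρ₂ : 0 < ρ₂)
    (hr₂ : Tendsto (fun k => (m₂ k : ℝ) / (m₁ k + m₂ k)) atTop (𝓝 ρ₂)) :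
    Tendsto (fun k => (m₂ k : ℝ)⁻¹ * ∑ i, (pseudoValue d (z k) (w k) (Sum.inr i) a -
      2 / ρ₂ * K a (w k i)) ^ 2) atTop (𝓝 0) := by
  have hy : Tendsto (fun k => (m₁ k : ℝ) + m₂ k) atTop atTop :=
    (tendsto_natCast_atTop_atTop.comp h₁.tendsto_size).atTop_add_nonneg fun k => Nat.cast_nonneg _
  -- The samples exchange roles, with `-d` in place of `d`; the sign of `gform_swap` is absorbed in
  -- the coefficient, now tending to `-(2 / ρ₂)`.
  have h0' : gform (-d a) (kmean Q (crossKernel a)) (kmean Q (selfKernel a))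
      (kmean P (crossKernel a)) (kmean P (selfKernel a)) = 0 := by
    rw [gform_swap, neg_neg, h0, neg_zero]
  have h := tendsto_avg_pseudoValue h₂.tendsto_size (h₂.rowMean a (1 - a)) (h₂.rowMean a a)
    (h₂.mean_sq_proj a (1 - a)) (h₂.mean_sq_proj a a) (h₂.tendsto_sampleU a (1 - a))
    (h₂.tendsto_sampleU a a) (h₁.tendsto_sampleU a (1 - a)) (h₁.tendsto_sampleU a a)
    (tendsto_twoSampleU h₁ h₂ h0) (tendsto_jackknife_coeff hρ₂ hy hr₂).neg h0'
  refine h.congr' ((h₂.tendsto_size.eventually_ge_atTop 3).mono fun k hk => ?_)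
  simp only
  congr 1
  refine Finset.sum_congr rfl fun i _ => ?_
  rw [pseudoValue_inr d (z k) (w k) hk, hK, gform_swap (d a),
    gform_swap (d a) (kmean P (crossKernel a)), neg_mul, mul_neg, neg_mul, mul_neg]
  rfl

/-- Consistency of the second moments of the pseudo-values. -/
lemma tendsto_secondMoment_pseudoValue (h₁ : IsTypical P G m₁ z) (h₂ : IsTypical Q K m₂ w)
    (hG : ∀ a x, G a x = gform (d a) (proj P (crossKernel a) x) (proj P (selfKernel a) x)
      (kmean Q (crossKernel a)) (kmean Q (selfKernel a)))
    (hK : ∀ a x, K a x = gform (d a) (kmean P (crossKernel a)) (kmean P (selfKernel a))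
      (proj Q (crossKernel a) x) (proj Q (selfKernel a) x))
    (h0 : ∀ a, gform (d a) (kmean P (crossKernel a)) (kmean P (selfKernel a))
      (kmean Q (crossKernel a)) (kmean Q (selfKernel a)) = 0)
    (hρ₁ : 0 < ρ₁) (hρ₂ : 0 < ρ₂)
    (hr₁ : Tendsto (fun k => (m₁ k : ℝ) / (m₁ k + m₂ k)) atTop (𝓝 ρ₁))
    (hr₂ : Tendsto (fun k => (m₂ k : ℝ) / (m₁ k + m₂ k)) atTop (𝓝 ρ₂)) (a b : Fin 2) :
    Tendsto (fun k => secondMoment (pseudoValue d (z k) (w k)) a b) atTop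
      (𝓝 (4 / ρ₁ * (∫ x, G a x * G b x ∂P) + 4 / ρ₂ * ∫ x, K a x * K b x ∂Q)) := by
  have hsc : ∀ {ν : Measure (ℝ × ℝ)} {F : Fin 2 → ℝ × ℝ → ℝ} {m : ℕ → ℕ}
      {v : ∀ k, Fin (m k) → ℝ × ℝ} (c : ℝ), IsTypical ν F m v → ∀ a b,
      Tendsto (fun k => (m k : ℝ)⁻¹ * ∑ i, c * F a (v k i) * (c * F b (v k i))) atTop
        (𝓝 (c ^ 2 * ∫ x, F a x * F b x ∂ν)) := by
    intro ν F m v c h a b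
    refine ((h.mean_mul a b).const_mul (c ^ 2)).congr fun k => ?_
    rw [mul_left_comm, Finset.mul_sum]
    congr 1
    refine Finset.sum_congr rfl fun i _ => ?_
    ring
  have hsq : ∀ {ν : Measure (ℝ × ℝ)} {F : Fin 2 → ℝ × ℝ → ℝ} {m : ℕ → ℕ}
      {v : ∀ k, Fin (m k) → ℝ × ℝ} (c : ℝ), IsTypical ν F m v → ∀ a,
      Tendsto (fun k => (m k : ℝ)⁻¹ * ∑ i, (c * F a (v k i)) ^ 2) atTop
        (𝓝 (c ^ 2 * ∫ x, F a x * F a x ∂ν)) := by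
    intro ν F m v c h a
    simpa only [← pow_two] using hsc c h a a
  have t₁ := tendsto_avg_mul (tendsto_avg_pseudoValue_inl h₁ h₂ (hG a) (h0 a) hρ₁ hr₁)
    (tendsto_avg_pseudoValue_inl h₁ h₂ (hG b) (h0 b) hρ₁ hr₁) (hsq _ h₁ a) (hsq _ h₁ b)
    (hsc _ h₁ a b)
  have t₂ := tendsto_avg_mul (tendsto_avg_pseudoValue_inr h₁ h₂ (hK a) (h0 a) hρ₂ hr₂)
    (tendsto_avg_pseudoValue_inr h₁ h₂ (hK b) (h0 b) hρ₂ hr₂) (hsq _ h₂ a) (hsq _ h₂ b)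
    (hsc _ h₂ a b)
  -- The pooled average weights the samples by their proportions, and `ρ (2 / ρ) ^ 2 = 4 / ρ`.
  have t := (hr₁.mul t₁).add (hr₂.mul t₂)
  have e : ρ₁ * ((2 / ρ₁) ^ 2 * ∫ x, G a x * G b x ∂P) +
      ρ₂ * ((2 / ρ₂) ^ 2 * ∫ x, K a x * K b x ∂Q) =
      4 / ρ₁ * (∫ x, G a x * G b x ∂P) + 4 / ρ₂ * ∫ x, K a x * K b x ∂Q := by
    field_simp
    ring
  rw [e] at t
  refine t.congr' (((h₁.tendsto_size.eventually_gt_atTop 0).and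
    (h₂.tendsto_size.eventually_gt_atTop 0)).mono fun k hk => ?_)
  have hk₁ : (m₁ k : ℝ) ≠ 0 := by exact_mod_cast hk.1.ne'
  have hk₂ : (m₂ k : ℝ) ≠ 0 := by exact_mod_cast hk.2.ne'
  simp only [secondMoment, Matrix.of_apply, Fintype.sum_sum_type, Fintype.card_sum,
    Fintype.card_fin, Nat.cast_add]
  field_simp

/-- Negligibility of the largest pseudo-value. -/
lemma tendsto_norm_pseudoValue (h₁ : IsTypical P G m₁ z) (h₂ : IsTypical Q K m₂ w)
    (hG : ∀ a x, G a x = gform (d a) (proj P (crossKernel a) x) (proj P (selfKernel a) x)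
      (kmean Q (crossKernel a)) (kmean Q (selfKernel a)))
    (hK : ∀ a x, K a x = gform (d a) (kmean P (crossKernel a)) (kmean P (selfKernel a))
      (proj Q (crossKernel a) x) (proj Q (selfKernel a) x))
    (h0 : ∀ a, gform (d a) (kmean P (crossKernel a)) (kmean P (selfKernel a))
      (kmean Q (crossKernel a)) (kmean Q (selfKernel a)) = 0)
    (hρ₁ : 0 < ρ₁) (hρ₂ : 0 < ρ₂)
    (hr₁ : Tendsto (fun k => (m₁ k : ℝ) / (m₁ k + m₂ k)) atTop (𝓝 ρ₁))
    (hr₂ : Tendsto (fun k => (m₂ k : ℝ) / (m₁ k + m₂ k)) atTop (𝓝 ρ₂)) :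
    Tendsto (fun k => ‖pseudoValue d (z k) (w k)‖ / √(Fintype.card (Fin (m₁ k) ⊕ Fin (m₂ k)) : ℝ))
      atTop (𝓝 0) := by
  have hsc : ∀ {ν : Measure (ℝ × ℝ)} {F : Fin 2 → ℝ × ℝ → ℝ} {m : ℕ → ℕ}
      {v : ∀ k, Fin (m k) → ℝ × ℝ} (c : ℝ), IsTypical ν F m v → ∀ a,
      Tendsto (fun k => ‖fun i => c * F a (v k i)‖ / √(m k : ℝ)) atTop (𝓝 0) := by
    intro ν F m v c h a
    have := (h.norm a).const_mul ‖c‖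
    rw [mul_zero] at this
    refine this.congr fun k => ?_
    rw [← mul_div_assoc, ← norm_smul]
    rfl
  have t₁ := fun a => tendsto_norm_of_avg
    (tendsto_avg_pseudoValue_inl h₁ h₂ (hG a) (h0 a) hρ₁ hr₁) (hsc _ h₁ a)
  have t₂ := fun a => tendsto_norm_of_avg
    (tendsto_avg_pseudoValue_inr h₁ h₂ (hK a) (h0 a) hρ₂ hr₂) (hsc _ h₂ a)
  have t := ((t₁ 0).add (t₁ 1)).add ((t₂ 0).add (t₂ 1))
  simp only [add_zero] at t
  refine squeeze_zero' (Eventually.of_forall fun k => by positivity)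
    (((h₁.tendsto_size.eventually_gt_atTop 0).and
    (h₂.tendsto_size.eventually_gt_atTop 0)).mono fun k hk => ?_) t
  have hk₁ : (0 : ℝ) < m₁ k := by exact_mod_cast hk.1
  have hk₂ : (0 : ℝ) < m₂ k := by exact_mod_cast hk.2
  set V := pseudoValue d (z k) (w k)
  set n : ℝ := (Fintype.card (Fin (m₁ k) ⊕ Fin (m₂ k)) : ℝ) with hn
  have hn' : n = (m₁ k : ℝ) + m₂ k := by simp [hn]
  have hn0 : 0 < √n := Real.sqrt_pos.2 (by linarith)
  have hle₁ : √(m₁ k : ℝ) ≤ √n := Real.sqrt_le_sqrt (by linarith)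
  have hle₂ : √(m₂ k : ℝ) ≤ √n := Real.sqrt_le_sqrt (by linarith)
  have b₁ : ∀ a, ‖fun i => V (Sum.inl i) a‖ / √n ≤ ‖fun i => V (Sum.inl i) a‖ / √(m₁ k : ℝ) :=
    fun a => div_le_div_of_nonneg_left (norm_nonneg _) (Real.sqrt_pos.2 hk₁) hle₁
  have b₂ : ∀ a, ‖fun i => V (Sum.inr i) a‖ / √n ≤ ‖fun i => V (Sum.inr i) a‖ / √(m₂ k : ℝ) :=
    fun a => div_le_div_of_nonneg_left (norm_nonneg _) (Real.sqrt_pos.2 hk₂) hle₂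
  have hV : ‖V‖ ≤ (‖fun i => V (Sum.inl i) 0‖ + ‖fun i => V (Sum.inl i) 1‖) +
      (‖fun i => V (Sum.inr i) 0‖ + ‖fun i => V (Sum.inr i) 1‖) := by
    set B := (‖fun i => V (Sum.inl i) 0‖ + ‖fun i => V (Sum.inl i) 1‖) +
      (‖fun i => V (Sum.inr i) 0‖ + ‖fun i => V (Sum.inr i) 1‖) with hB
    refine (pi_norm_le_iff_of_nonneg (by positivity)).2 fun s =>
      (pi_norm_le_iff_of_nonneg (by positivity)).2 fun a => ?_
    have n₁ := fun a => norm_nonneg fun i => V (Sum.inl i) a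
    have n₂ := fun a => norm_nonneg fun i => V (Sum.inr i) a
    have c₁ : ∀ a, ‖fun i => V (Sum.inl i) a‖ ≤ B :=
      Fin.forall_fin_two.2 ⟨by linarith [n₁ 1, n₂ 0, n₂ 1], by linarith [n₁ 0, n₂ 0, n₂ 1]⟩
    have c₂ : ∀ a, ‖fun i => V (Sum.inr i) a‖ ≤ B :=
      Fin.forall_fin_two.2 ⟨by linarith [n₁ 0, n₁ 1, n₂ 1], by linarith [n₁ 0, n₁ 1, n₂ 0]⟩
    rcases s with i | j
    · exact (norm_le_pi_norm (fun i => V (Sum.inl i) a) i).trans (c₁ a)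
    · exact (norm_le_pi_norm (fun i => V (Sum.inr i) a) j).trans (c₂ a)
  calc ‖V‖ / √n ≤ _ := div_le_div_of_nonneg_right hV hn0.le
    _ ≤ _ := by
      rw [add_div, add_div, add_div]
      exact add_le_add (add_le_add (b₁ 0) (b₁ 1)) (add_le_add (b₂ 0) (b₂ 1))

/-- The linear expansion of the normalized sum of the pseudo-values. -/
lemma tendsto_scaledSum_sub (h₁ : IsTypical P G m₁ z) (h₂ : IsTypical Q K m₂ w)
    (hG : ∀ a x, G a x = gform (d a) (proj P (crossKernel a) x) (proj P (selfKernel a) x)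
      (kmean Q (crossKernel a)) (kmean Q (selfKernel a)))
    (hK : ∀ a x, K a x = gform (d a) (kmean P (crossKernel a)) (kmean P (selfKernel a))
      (proj Q (crossKernel a) x) (proj Q (selfKernel a) x))
    (h0 : ∀ a, gform (d a) (kmean P (crossKernel a)) (kmean P (selfKernel a))
      (kmean Q (crossKernel a)) (kmean Q (selfKernel a)) = 0)
    (hρ₁ : 0 < ρ₁) (hρ₂ : 0 < ρ₂)
    (hr₁ : Tendsto (fun k => (m₁ k : ℝ) / (m₁ k + m₂ k)) atTop (𝓝 ρ₁))
    (hr₂ : Tendsto (fun k => (m₂ k : ℝ) / (m₁ k + m₂ k)) atTop (𝓝 ρ₂)) (a : Fin 2) :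
    Tendsto (fun k => scaledSum (pseudoValue d (z k) (w k)) a -
      (2 / √((m₁ k : ℝ) / (m₁ k + m₂ k)) * ((√(m₁ k : ℝ))⁻¹ * ∑ i, G a (z k i)) +
        2 / √((m₂ k : ℝ) / (m₁ k + m₂ k)) * ((√(m₂ k : ℝ))⁻¹ * ∑ j, K a (w k j)))) atTop
      (𝓝 0) := by
  have s₁ : Tendsto (fun k => (√((m₁ k : ℝ) / (m₁ k + m₂ k)))⁻¹) atTop (𝓝 (√ρ₁)⁻¹) :=
    hr₁.sqrt.inv₀ (Real.sqrt_pos.2 hρ₁).ne'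
  have s₂ : Tendsto (fun k => (√((m₂ k : ℝ) / (m₁ k + m₂ k)))⁻¹) atTop (𝓝 (√ρ₂)⁻¹) :=
    hr₂.sqrt.inv₀ (Real.sqrt_pos.2 hρ₂).ne'
  -- `√n` times the statistic splits around the means. The parts linear in one sample leave the
  -- Hoeffding remainders `t₁` and `t₂`; the part `t₃`, linear in the errors of both, is covered by
  -- two fourth-root rates.
  have t₁ := s₁.mul (tendsto_gform (d := d a) (h₁.hoeffding a (1 - a)) (h₁.hoeffding a a)
    (tendsto_const_nhds (x := kmean Q (crossKernel a)))
    (tendsto_const_nhds (x := kmean Q (selfKernel a))))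
  have t₂ := s₂.mul (tendsto_gform (d := d a)
    (tendsto_const_nhds (x := kmean P (crossKernel a)))
    (tendsto_const_nhds (x := kmean P (selfKernel a)))
    (h₂.hoeffding a (1 - a)) (h₂.hoeffding a a))
  have t₃ := (s₁.sqrt.mul s₂.sqrt).mul (tendsto_gform (d := d a) (h₁.ustat a (1 - a))
    (h₁.ustat a a) (h₂.ustat a (1 - a)) (h₂.ustat a a))
  have t := (t₁.add t₂).add t₃
  have e0 : gform (d a) 0 0 (kmean Q (crossKernel a)) (kmean Q (selfKernel a)) = 0 ∧
      gform (d a) (kmean P (crossKernel a)) (kmean P (selfKernel a)) 0 0 = 0 ∧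
      gform (d a) 0 0 0 0 = 0 := by
    simp [gform]
  rw [e0.1, e0.2.1, e0.2.2] at t
  simp only [mul_zero, add_zero] at t
  refine t.congr' (((h₁.tendsto_size.eventually_ge_atTop 3).and
    (h₂.tendsto_size.eventually_ge_atTop 3)).mono fun k hk => ?_)
  have hk₁ : (0 : ℝ) < m₁ k := by exact_mod_cast (by omega : 0 < m₁ k)
  have hk₂ : (0 : ℝ) < m₂ k := by exact_mod_cast (by omega : 0 < m₂ k)
  have hn : 0 < (m₁ k : ℝ) + m₂ k := by linarith
  have hU : scaledSum (pseudoValue d (z k) (w k)) a = √((m₁ k : ℝ) + m₂ k) *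
      twoSampleU d (z k) (w k) Finset.univ Finset.univ a := by
    rw [scaledSum, sum_pseudoValue d (z k) (w k) hk.1 hk.2, Fintype.card_sum, Fintype.card_fin,
      Fintype.card_fin, Nat.cast_add, ← mul_assoc]
    congr 1
    rw [inv_mul_eq_div, Real.div_sqrt]
  beta_reduce
  rw [hU, twoSampleU_apply]
  have hGsum : ∑ i, G a (z k i) = gform (d a)
      (∑ i, (proj P (crossKernel a) (z k i) - kmean P (crossKernel a)))
      (∑ i, (proj P (selfKernel a) (z k i) - kmean P (selfKernel a)))
      (kmean Q (crossKernel a)) (kmean Q (selfKernel a)) := by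
    rw [← sum_gform_left]
    refine Finset.sum_congr rfl fun i _ => ?_
    rw [hG, ← sub_eq_zero, ← h0 a]
    simp only [gform]
    ring
  have hKsum : ∑ i, K a (w k i) = gform (d a) (kmean P (crossKernel a)) (kmean P (selfKernel a))
      (∑ i, (proj Q (crossKernel a) (w k i) - kmean Q (crossKernel a)))
      (∑ i, (proj Q (selfKernel a) (w k i) - kmean Q (selfKernel a))) := by
    rw [← sum_gform_right]
    refine Finset.sum_congr rfl fun i _ => ?_
    rw [hK, ← sub_eq_zero, ← h0 a]
    simp only [gform]
    ring
  rw [hGsum, hKsum]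
  have h0a := h0 a
  change _ * gform (d a) (√(m₁ k : ℝ) * (sampleU (crossKernel a) (z k) Finset.univ -
      kmean P (crossKernel a) - 2 / (m₁ k : ℝ) *
      ∑ i, (proj P (crossKernel a) (z k i) - kmean P (crossKernel a))))
    (√(m₁ k : ℝ) * (sampleU (selfKernel a) (z k) Finset.univ -
      kmean P (selfKernel a) - 2 / (m₁ k : ℝ) *
      ∑ i, (proj P (selfKernel a) (z k i) - kmean P (selfKernel a)))) _ _ + _ * gform (d a) _ _
    (√(m₂ k : ℝ) * (sampleU (crossKernel a) (w k) Finset.univ -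
      kmean Q (crossKernel a) - 2 / (m₂ k : ℝ) *
      ∑ i, (proj Q (crossKernel a) (w k i) - kmean Q (crossKernel a))))
    (√(m₂ k : ℝ) * (sampleU (selfKernel a) (w k) Finset.univ -
      kmean Q (selfKernel a) - 2 / (m₂ k : ℝ) *
      ∑ i, (proj Q (selfKernel a) (w k i) - kmean Q (selfKernel a)))) + _ * gform (d a)
    (√√(m₁ k : ℝ) * (sampleU (crossKernel a) (z k) Finset.univ - kmean P (crossKernel a)))
    (√√(m₁ k : ℝ) * (sampleU (selfKernel a) (z k) Finset.univ - kmean P (selfKernel a)))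
    (√√(m₂ k : ℝ) * (sampleU (crossKernel a) (w k) Finset.univ - kmean Q (crossKernel a)))
    (√√(m₂ k : ℝ) * (sampleU (selfKernel a) (w k) Finset.univ - kmean Q (selfKernel a))) = _
  generalize ∑ i, (proj P (crossKernel a) (z k i) - kmean P (crossKernel a)) = S₁
  generalize ∑ i, (proj P (selfKernel a) (z k i) - kmean P (selfKernel a)) = S₂
  generalize ∑ i, (proj Q (crossKernel a) (w k i) - kmean Q (crossKernel a)) = T₁
  generalize ∑ i, (proj Q (selfKernel a) (w k i) - kmean Q (selfKernel a)) = T₂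
  generalize sampleU (crossKernel a) (z k) Finset.univ = u₁
  generalize sampleU (selfKernel a) (z k) Finset.univ = u₂
  generalize sampleU (crossKernel a) (w k) Finset.univ = v₁
  generalize sampleU (selfKernel a) (w k) Finset.univ = v₂
  generalize kmean P (crossKernel a) = p₁ at *
  generalize kmean P (selfKernel a) = p₂ at *
  generalize kmean Q (crossKernel a) = q₁ at *
  generalize kmean Q (selfKernel a) = q₂ at *
  rw [Real.sqrt_inv, Real.sqrt_inv, Real.sqrt_div hk₁.le, Real.sqrt_div hk₂.le,
    Real.sqrt_div (Real.sqrt_nonneg _), Real.sqrt_div (Real.sqrt_nonneg _)]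
  have hs₁ : 0 < √(m₁ k : ℝ) := Real.sqrt_pos.2 hk₁
  have hs₂ : 0 < √(m₂ k : ℝ) := Real.sqrt_pos.2 hk₂
  have hsn : 0 < √((m₁ k : ℝ) + m₂ k) := Real.sqrt_pos.2 hn
  have e₁ : (m₁ k : ℝ) = √(m₁ k : ℝ) ^ 2 := (Real.sq_sqrt hk₁.le).symm
  have e₂ : (m₂ k : ℝ) = √(m₂ k : ℝ) ^ 2 := (Real.sq_sqrt hk₂.le).symm
  have f₁ : √(m₁ k : ℝ) = √√(m₁ k : ℝ) ^ 2 := (Real.sq_sqrt hs₁.le).symm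
  have f₂ : √(m₂ k : ℝ) = √√(m₂ k : ℝ) ^ 2 := (Real.sq_sqrt hs₂.le).symm
  have fn : √((m₁ k : ℝ) + m₂ k) = √√((m₁ k : ℝ) + m₂ k) ^ 2 := (Real.sq_sqrt hsn.le).symm
  have p1 : 0 < √√(m₁ k : ℝ) := Real.sqrt_pos.2 hs₁
  have p2 : 0 < √√(m₂ k : ℝ) := Real.sqrt_pos.2 hs₂
  have pn : 0 < √√((m₁ k : ℝ) + m₂ k) := Real.sqrt_pos.2 hsn
  -- In terms of the fourth roots of the sample sizes all scalings are rational, and the identity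
  -- becomes one of fields.
  generalize √√((m₁ k : ℝ) + m₂ k) = c at *
  generalize √√(m₁ k : ℝ) = c₁ at *
  generalize √√(m₂ k : ℝ) = c₂ at *
  have g₁ : (m₁ k : ℝ) = c₁ ^ 4 := by rw [e₁, f₁]; ring
  have g₂ : (m₂ k : ℝ) = c₂ ^ 4 := by rw [e₂, f₂]; ring
  rw [fn, f₁, f₂, g₁, g₂]
  clear e₁ e₂ f₁ f₂ fn g₁ g₂ hs₁ hs₂ hsn hk₁ hk₂ hn
  have key : gform (d a) u₁ u₂ v₁ v₂ = gform (d a) p₁ p₂ q₁ q₂ + gform (d a) (u₁ - p₁) (u₂ - p₂) q₁ q₂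
      + gform (d a) p₁ p₂ (v₁ - q₁) (v₂ - q₂) +
      gform (d a) (u₁ - p₁) (u₂ - p₂) (v₁ - q₁) (v₂ - q₂) := by
    simp only [gform]
    ring
  rw [key, h0a]
  generalize u₁ - p₁ = u₁
  generalize u₂ - p₂ = u₂
  generalize v₁ - q₁ = v₁
  generalize v₂ - q₂ = v₂
  simp only [gform]
  field_simp
  ring

end Deterministic

end GiniJEL

/-! ### Transfer to random samples, sample sizes and whitening. -/

namespace GiniJEL

section Measurability

variable {Ω : Type*} [MeasurableSpace Ω] {m m₁ m₂ : ℕ} {Z W : ℕ → Ω → ℝ × ℝ}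

lemma measurable_sampleU (hZ : ∀ i, Measurable (Z i)) (a b : Fin 2) (A : Finset (Fin m)) :
    Measurable fun ω => sampleU (giniKernel (coord a) (coord b)) (fun i : Fin m => Z i ω) A := by
  unfold sampleU ustat
  refine Measurable.const_mul (Finset.measurable_sum _ fun i _ =>
    Finset.measurable_sum _ fun j _ => ?_) _
  exact (measurable_giniKernel (measurable_coord a) (measurable_coord b)).comp
    ((hZ i).prodMk (hZ j))

lemma measurable_twoSampleU (hZ : ∀ i, Measurable (Z i)) (hW : ∀ i, Measurable (W i))
    (d : Fin 2 → ℝ) (A : Finset (Fin m₁)) (B : Finset (Fin m₂)) :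
    Measurable fun ω => twoSampleU d (fun i : Fin m₁ => Z i ω) (fun j : Fin m₂ => W j ω) A B := by
  refine measurable_pi_lambda _ fun a => ?_
  simp only [twoSampleU_apply, gform]
  have h := fun b => measurable_sampleU hZ a b A
  have h' := fun b => measurable_sampleU hW a b B
  exact ((((h a).mul (h' a)).mul_const _).sub ((h (1 - a)).mul (h' a))).add
    ((h a).mul (h' (1 - a)))

lemma measurable_pseudoValue (hZ : ∀ i, Measurable (Z i)) (hW : ∀ i, Measurable (W i))
    (d : Fin 2 → ℝ) : Measurable fun ω =>
      pseudoValue d (fun i : Fin m₁ => Z i ω) (fun j : Fin m₂ => W j ω) := by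
  refine measurable_pi_lambda _ fun s => ?_
  have h := measurable_twoSampleU (m₁ := m₁) (m₂ := m₂) hZ hW d
  rcases s with i | j
  · exact ((h Finset.univ Finset.univ).const_smul ((m₁ : ℝ) + m₂)).sub
      ((h (Finset.univ.erase i) Finset.univ).const_smul ((m₁ : ℝ) + m₂ - 1))
  · exact ((h Finset.univ Finset.univ).const_smul ((m₁ : ℝ) + m₂)).sub
      ((h Finset.univ (Finset.univ.erase j)).const_smul ((m₁ : ℝ) + m₂ - 1))

end Measurability

section Typical

variable {Ω : Type*} [MeasurableSpace Ω] {μ : Measure Ω}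
  {P Q : Measure (ℝ × ℝ)} [IsProbabilityMeasure P] [IsProbabilityMeasure Q]
  {Z W : ℕ → Ω → ℝ × ℝ} {G K : Fin 2 → ℝ × ℝ → ℝ}

/-- The remainders in the expansions of the Gini kernels that vanish in probability. -/
noncomputable def remainder (P : Measure (ℝ × ℝ)) {m : ℕ} (z : Fin m → ℝ × ℝ)
    (s : Fin 3 × Fin 2 × Fin 2) : ℝ :=
  ![(m : ℝ)⁻¹ * ∑ i, (rowMean (fun i j => giniKernel (coord s.2.1) (coord s.2.2) (z i) (z j)) i -
        proj P (giniKernel (coord s.2.1) (coord s.2.2)) (z i)) ^ 2,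
    √√(m : ℝ) * (sampleU (giniKernel (coord s.2.1) (coord s.2.2)) z Finset.univ -
        kmean P (giniKernel (coord s.2.1) (coord s.2.2))),
    √(m : ℝ) * (sampleU (giniKernel (coord s.2.1) (coord s.2.2)) z Finset.univ -
        kmean P (giniKernel (coord s.2.1) (coord s.2.2)) - 2 / (m : ℝ) *
          ∑ i, (proj P (giniKernel (coord s.2.1) (coord s.2.2)) (z i) -
            kmean P (giniKernel (coord s.2.1) (coord s.2.2))))] s.1

/-- The laws of large numbers hold almost surely along the whole sequence. Only the remainders,
which vanish merely in probability, have to be assumed along the subsequence. -/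
lemma IsIID.ae_isTypical (hZ : IsIID P Z μ) (hP : ∀ a, MemLp (coord a) 2 P)
    (hG : ∀ a, Measurable (G a)) (hG2 : ∀ a, MemLp (G a) 2 P) {n : ℕ → ℕ}
    (hn : Tendsto n atTop atTop) :
    ∀ᵐ ω ∂μ, ∀ ns : ℕ → ℕ, StrictMono ns →
      (∀ s, Tendsto (fun k => remainder P (fun i : Fin (n (ns k)) => Z i ω) s) atTop (𝓝 0)) →
        IsTypical P G (fun k => n (ns k)) (fun _ i => Z i ω) := by
  have hk : ∀ a b, IsSymmKernel P (giniKernel (coord a) (coord b)) := fun a b =>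
    isSymmKernel_giniKernel (measurable_coord a) (measurable_coord b) (hP a)
  have h1 := ae_all_iff.2 fun a => ae_all_iff.2 fun b => hZ.tendsto_mean
    (φ := fun x => proj P (giniKernel (coord a) (coord b)) x ^ 2)
    ((hk a b).measurable_proj.pow_const 2) (hk a b).memLp_proj.integrable_sq
  have h2 := ae_all_iff.2 fun a => ae_all_iff.2 fun b => hZ.tendsto_mean
    (φ := fun x => G a x * G b x) ((hG a).mul (hG b)) ((hG2 a).integrable_mul (hG2 b))
  have h3 := ae_all_iff.2 fun a => hZ.tendsto_norm_div_sqrt (hG a) (hG2 a)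
  filter_upwards [h1, h2, h3] with ω h1 h2 h3 ns hns h
  have ht : Tendsto (fun k => n (ns k)) atTop atTop := hn.comp hns.tendsto_atTop
  exact ⟨ht, fun a b => h (0, a, b), fun a b => h (1, a, b), fun a b => h (2, a, b),
    fun a b => (h1 a b).comp ht, fun a b => (h2 a b).comp ht, fun a => (h3 a).comp ht⟩

variable [IsProbabilityMeasure μ]

lemma IsIID.tendstoInMeasure_remainder (hZ : IsIID P Z μ) (hP : ∀ a, MemLp (coord a) 2 P)
    {n : ℕ → ℕ} (hn : Tendsto n atTop atTop) (s : Fin 3 × Fin 2 × Fin 2) :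
    TendstoInMeasure μ (fun k ω => remainder P (fun i : Fin (n k) => Z i ω) s) atTop
      (fun _ => 0) := by
  obtain ⟨c, a, b⟩ := s
  have hk : IsSymmKernel P (giniKernel (coord a) (coord b)) :=
    isSymmKernel_giniKernel (measurable_coord a) (measurable_coord b) (hP a)
  fin_cases c
  · exact (hZ.tendstoInMeasure_rowMean hk).comp hn
  · exact (hZ.tendstoInMeasure_ustat hk).comp hn
  · exact (hZ.tendstoInMeasure_hoeffding hk).comp hn

/-- Convergence along typical observations implies convergence in probability. -/
lemma tendstoInMeasure_of_isTypical (hZ : IsIID P Z μ) (hW : IsIID Q W μ)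
    (hP : ∀ a, MemLp (coord a) 2 P) (hQ : ∀ a, MemLp (coord a) 2 Q)
    (hG : ∀ a, Measurable (G a)) (hG2 : ∀ a, MemLp (G a) 2 P)
    (hK : ∀ a, Measurable (K a)) (hK2 : ∀ a, MemLp (K a) 2 Q) {n₁ n₂ : ℕ → ℕ}
    (hn₁ : Tendsto n₁ atTop atTop) (hn₂ : Tendsto n₂ atTop atTop) {F : ℕ → Ω → ℝ} {f : ℝ}
    (hF : ∀ k, Measurable (F k))
    (h : ∀ ω, ∀ ns : ℕ → ℕ, StrictMono ns →
      IsTypical P G (fun k => n₁ (ns k)) (fun _ i => Z i ω) →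
      IsTypical Q K (fun k => n₂ (ns k)) (fun _ i => W i ω) →
        Tendsto (fun k => F (ns k) ω) atTop (𝓝 f)) :
    TendstoInMeasure μ F atTop (fun _ => f) := by
  refine tendstoInMeasure_of_forall_subseq
    (X := Sum.elim (fun s k ω => remainder P (fun i : Fin (n₁ k) => Z i ω) s)
      (fun s k ω => remainder Q (fun i : Fin (n₂ k) => W i ω) s)) (c := fun _ => 0)
    (fun s => ?_) (fun k => (hF k).aestronglyMeasurable) ?_
  · rcases s with s | s
    · exact hZ.tendstoInMeasure_remainder hP hn₁ s
    · exact hW.tendstoInMeasure_remainder hQ hn₂ s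
  · filter_upwards [hZ.ae_isTypical hP hG hG2 hn₁, hW.ae_isTypical hQ hK hK2 hn₂]
      with ω h1 h2 ns hns hs
    exact h ω ns hns (h1 ns hns fun s => hs (Sum.inl s)) (h2 ns hns fun s => hs (Sum.inr s))

end Typical

section SampleSizes

variable {n₁ n₂ : ℕ → ℕ} {r : ℝ}

lemma tendsto_sizes (hr : 0 < r) (hn : Tendsto (fun k => n₁ k + n₂ k) atTop atTop)
    (hratio : Tendsto (fun k => (n₁ k : ℝ) / (n₂ k : ℝ)) atTop (𝓝 r)) :
    Tendsto n₁ atTop atTop ∧ Tendsto n₂ atTop atTop := by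
  have hN : Tendsto (fun k => (n₁ k : ℝ) + n₂ k) atTop atTop := by
    have := tendsto_natCast_atTop_atTop (R := ℝ) |>.comp hn
    simpa [Function.comp_def] using this
  have hlow := hratio.eventually_const_lt (half_lt_self hr)
  have hup := hratio.eventually_lt_const (lt_add_one r)
  -- Division by `n₂ k = 0` would give the ratio `0`, which is below `r / 2`.
  have hpos : ∀ᶠ k in atTop, (0 : ℝ) < n₂ k := by
    filter_upwards [hlow] with k hk
    refine lt_of_le_of_ne (Nat.cast_nonneg _) fun h => ?_
    rw [← h, div_zero] at hk
    linarith
  -- Eventually `n₁ < (r + 1) n₂`, hence `n₁ + n₂ ≤ (r + 2) n₂`.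
  have h2 : Tendsto (fun k => (n₂ k : ℝ)) atTop atTop := by
    refine tendsto_atTop_mono' _ ?_ (hN.const_mul_atTop (r := (r + 2)⁻¹) (by positivity))
    filter_upwards [hup, hpos] with k hk hk0
    rw [div_lt_iff₀ hk0] at hk
    rw [inv_mul_le_iff₀ (by positivity)]
    linarith
  have h1 : Tendsto (fun k => (n₁ k : ℝ)) atTop atTop := by
    refine tendsto_atTop_mono' _ ?_ (h2.const_mul_atTop (r := r / 2) (by positivity))
    filter_upwards [hlow, hpos] with k hk hk0
    rw [lt_div_iff₀ hk0] at hk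
    exact hk.le
  exact ⟨tendsto_natCast_atTop_iff.1 h1, tendsto_natCast_atTop_iff.1 h2⟩

lemma tendsto_proportions (hr : 0 < r) (hn₂ : Tendsto n₂ atTop atTop)
    (hratio : Tendsto (fun k => (n₁ k : ℝ) / (n₂ k : ℝ)) atTop (𝓝 r)) :
    Tendsto (fun k => (n₁ k : ℝ) / (n₁ k + n₂ k)) atTop (𝓝 (r / (r + 1))) ∧
      Tendsto (fun k => (n₂ k : ℝ) / (n₁ k + n₂ k)) atTop (𝓝 (1 / (r + 1))) := by
  have h1 : r + 1 ≠ 0 := by positivity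
  constructor
  · refine (hratio.div (hratio.add_const 1) h1).congr'
      ((hn₂.eventually_gt_atTop 0).mono fun k hk => ?_)
    have hk' : (0 : ℝ) < n₂ k := by exact_mod_cast hk
    have : (0 : ℝ) < n₁ k + n₂ k := by positivity
    simp only [Pi.div_apply]
    field_simp
  · refine ((tendsto_const_nhds (x := (1 : ℝ))).div (hratio.add_const 1) h1).congr'
      ((hn₂.eventually_gt_atTop 0).mono fun k hk => ?_)
    have hk' : (0 : ℝ) < n₂ k := by exact_mod_cast hk
    have : (0 : ℝ) < n₁ k + n₂ k := by positivity
    simp only [Pi.div_apply]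
    field_simp

end SampleSizes

open scoped MatrixOrder Matrix.Norms.L2Operator in
/-- A positive definite matrix can be whitened. -/
lemma exists_whitening {C : Matrix (Fin 2) (Fin 2) ℝ} (hC : C.PosDef) :
    ∃ A : Matrix (Fin 2) (Fin 2) ℝ, IsUnit A ∧ A * C * A.transpose = 1 := by
  -- Write `C = Bᵀ B`; definiteness makes `B` invertible, and `(Bᵀ)⁻¹` whitens `C`.
  obtain ⟨B, hB⟩ := CStarAlgebra.nonneg_iff_eq_star_mul_self.1 hC.posSemidef.nonneg
  rw [Matrix.star_eq_conjTranspose, Matrix.conjTranspose_eq_transpose_of_trivial] at hB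
  have hdet : IsUnit B.det := by
    have h := (Matrix.isUnit_iff_isUnit_det _).1 hC.isUnit
    rw [hB, Matrix.det_mul] at h
    exact isUnit_of_mul_isUnit_right h
  have hdet' : IsUnit B.transpose.det := by rwa [Matrix.det_transpose]
  refine ⟨B.transpose⁻¹, ?_, ?_⟩
  · rw [Matrix.isUnit_nonsing_inv_iff]
    exact (Matrix.isUnit_iff_isUnit_det _).2 hdet'
  · rw [hB, Matrix.nonsing_inv_mul_cancel_left _ _ hdet', Matrix.transpose_nonsing_inv,
      Matrix.transpose_transpose, Matrix.mul_nonsing_inv _ hdet]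

end GiniJEL

/-! ### Assembly of the theorem. -/

namespace GiniJEL

variable {Ω : Type*} [MeasurableSpace Ω] {μ : Measure Ω} [IsProbabilityMeasure μ]
  {P Q : Measure (ℝ × ℝ)} {Z W : ℕ → Ω → ℝ × ℝ}

/-- A sequence of random vectors converges to zero in probability if its components do. -/
lemma tendstoInMeasure_mulVec (A : Matrix (Fin 2) (Fin 2) ℝ) {F : ℕ → Ω → Fin 2 → ℝ}
    (hF : ∀ k, Measurable (F k))
    (h : ∀ a, TendstoInMeasure μ (fun k ω => F k ω a) atTop (fun _ => 0)) :
    TendstoInMeasure μ (fun k ω => A.mulVec (F k ω)) atTop 0 := by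
  have hc : Continuous fun x : Fin 2 → ℝ => A.mulVec x := Continuous.matrix_mulVec (by fun_prop)
    (by fun_prop)
  have hnorm : TendstoInMeasure μ (fun k ω => ‖A.mulVec (F k ω)‖) atTop (fun _ => 0) := by
    refine tendstoInMeasure_of_forall_subseq h
      (fun k => (hc.norm.measurable.comp (hF k)).aestronglyMeasurable)
      (ae_of_all _ fun ω ns _ hs => ?_)
    have h1 : Tendsto (fun k => F (ns k) ω) atTop (𝓝 0) := tendsto_pi_nhds.2 hs
    have h2 := (hc.norm.tendsto 0).comp h1
    rwa [Matrix.mulVec_zero, norm_zero] at h2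
  rw [tendstoInMeasure_iff_norm] at hnorm ⊢
  simpa using hnorm

/-- A random multiple of an asymptotically normal sequence by deterministic numbers tending to zero
converges to zero in probability. -/
lemma IsIID.tendstoInMeasure_mul_sum (hZ : IsIID P Z μ) {φ : ℝ × ℝ → ℝ} (hφ : Measurable φ)
    (hi : MemLp φ 2 P) (h0 : ∫ z, φ z ∂P = 0) {n : ℕ → ℕ} (hn : Tendsto n atTop atTop)
    {c : ℕ → ℝ} (hc : Tendsto c atTop (𝓝 0)) :
    TendstoInMeasure μ (fun k ω => (√(n k : ℝ))⁻¹ * (∑ i : Fin (n k), φ (Z i ω)) * c k) atTop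
      (fun _ => 0) := by
  have hX := hZ.tendstoInDistribution hφ hi h0
  have hX' : TendstoInDistribution (fun k ω => (√(n k : ℝ))⁻¹ * ∑ i : Fin (n k), φ (Z i ω))
      atTop (fun x : ℝ => x) (fun _ => μ) (gaussianReal 0 (∫ z, φ z ^ 2 ∂P).toNNReal) :=
    ⟨fun k => hX.forall_aemeasurable (n k), hX.aemeasurable_limit, hX.tendsto.comp hn⟩
  refine tendstoInMeasure_mul_of_tendstoInDistribution hX' (Y := fun k _ => c k) ?_
    fun _ => aemeasurable_const
  exact tendstoInMeasure_of_tendsto_ae (fun _ => aestronglyMeasurable_const)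
    (ae_of_all _ fun _ => hc)

variable [IsProbabilityMeasure P] [IsProbabilityMeasure Q]

lemma covMatrix_apply_of_integral_eq_zero {f : ℝ × ℝ → Fin 2 → ℝ}
    (hf : ∀ a, MemLp (fun z => f z a) 2 P) (h0 : ∀ a, ∫ z, f z a ∂P = 0) (a b : Fin 2) :
    covMatrix P f a b = ∫ z, f z a * f z b ∂P := by
  rw [covMatrix, Matrix.of_apply, covariance_eq_sub (hf a) (hf b), h0 a, zero_mul, sub_zero]
  rfl

/-- **Wilks' theorem** for the jackknife empirical likelihood of the differences of the Gini
correlations of two independent samples. -/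
theorem tendstoInDistribution_negTwoLog_jelRatio (hZ : IsIID P Z μ) (hW : IsIID Q W μ)
    (hZW : iIndepFun (fun s : ℕ ⊕ ℕ => Sum.elim Z W s) μ)
    (hP : ∀ a, MemLp (coord a) 2 P) (hQ : ∀ a, MemLp (coord a) 2 Q)
    (hPc : ∀ a, Continuous (cdf (P.map (coord a)))) (hQc : ∀ a, Continuous (cdf (Q.map (coord a))))
    (hcov₁₀ : (covMatrix P (g₁₀ P Q (giniDiff P Q))).PosDef)
    (hcov₀₁ : (covMatrix Q (g₀₁ P Q (giniDiff P Q))).PosDef)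
    {n₁ n₂ : ℕ → ℕ} {r : ℝ} (hr : 0 < r)
    (hn : Tendsto (fun k => n₁ k + n₂ k) atTop atTop)
    (hratio : Tendsto (fun k => (n₁ k : ℝ) / (n₂ k : ℝ)) atTop (𝓝 r)) :
    TendstoInDistribution (fun (k : ℕ) (ω : Ω) => negTwoLog (jelRatio (giniDiff P Q)
        (fun i : Fin (n₁ k) => Z i ω) (fun j : Fin (n₂ k) => W j ω)))
      atTop (fun x : ℝ => (x : EReal)) (fun _ => μ) (chiSquare 2) := by
  set d := giniDiff P Q with hd
  obtain ⟨hn₁, hn₂⟩ := tendsto_sizes hr hn hratio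
  obtain ⟨hr₁, hr₂⟩ := tendsto_proportions hr hn₂ hratio
  set ρ₁ := r / (r + 1)
  set ρ₂ := 1 / (r + 1)
  have hρ₁ : 0 < ρ₁ := by positivity
  have hρ₂ : 0 < ρ₂ := by positivity
  -- the projections
  set G : Fin 2 → ℝ × ℝ → ℝ := fun a z => g₁₀ P Q d z a with hGdef
  set K : Fin 2 → ℝ × ℝ → ℝ := fun a w => g₀₁ P Q d w a with hKdef
  have hG : ∀ a x, G a x = gform (d a) (proj P (crossKernel a) x) (proj P (selfKernel a) x)
      (kmean Q (crossKernel a)) (kmean Q (selfKernel a)) := fun a x => g₁₀_apply hP hQ d x a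
  have hK : ∀ a x, K a x = gform (d a) (kmean P (crossKernel a)) (kmean P (selfKernel a))
      (proj Q (crossKernel a) x) (proj Q (selfKernel a) x) := fun a x => g₀₁_apply hP hQ d x a
  have h0 : ∀ a, gform (d a) (kmean P (crossKernel a)) (kmean P (selfKernel a))
      (kmean Q (crossKernel a)) (kmean Q (selfKernel a)) = 0 := gform_giniDiff hP hQ hPc hQc
  have hGf := fun a => funext (hG a)
  have hKf := fun a => funext (hK a)
  have hP1 := isSymmKernel_crossKernel hP
  have hP2 := isSymmKernel_selfKernel hP
  have hQ1 := isSymmKernel_crossKernel hQ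
  have hQ2 := isSymmKernel_selfKernel hQ
  have mG : ∀ a, Measurable (G a) := by
    intro a
    rw [hGf]
    have h1 := (hP1 a).measurable_proj
    have h2 := (hP2 a).measurable_proj
    simp only [gform]
    fun_prop
  have mK : ∀ a, Measurable (K a) := by
    intro a
    rw [hKf]
    have h1 := (hQ1 a).measurable_proj
    have h2 := (hQ2 a).measurable_proj
    simp only [gform]
    fun_prop
  have hG2 : ∀ a, MemLp (G a) 2 P := by
    intro a
    rw [hGf]
    have h1 := (hP1 a).memLp_proj
    have h2 := (hP2 a).memLp_proj
    simp only [gform]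
    exact (((h2.mul_const _).mul_const _).sub (h1.mul_const _)).add (h2.mul_const _)
  have hK2 : ∀ a, MemLp (K a) 2 Q := by
    intro a
    rw [hKf]
    have h1 := (hQ1 a).memLp_proj
    have h2 := (hQ2 a).memLp_proj
    simp only [gform]
    exact (((h2.const_mul _).mul_const _).sub (h2.const_mul _)).add (h1.const_mul _)
  have hG0 : ∀ a, ∫ z, G a z ∂P = 0 := by
    intro a
    simp_rw [hG]
    rw [← h0 a]
    have h1 := (hP1 a).integrable_proj
    have h2 := (hP2 a).integrable_proj
    simp only [gform]
    rw [integral_sub_add ((h2.mul_const _).mul_const _) (h1.mul_const _) (h2.mul_const _)]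
    simp only [integral_mul_const, kmean]
  have hK0 : ∀ a, ∫ z, K a z ∂Q = 0 := by
    intro a
    simp_rw [hK]
    rw [← h0 a]
    have h1 := (hQ1 a).integrable_proj
    have h2 := (hQ2 a).integrable_proj
    simp only [gform]
    rw [integral_sub_add ((h2.const_mul _).mul_const _) (h2.const_mul _) (h1.const_mul _)]
    simp only [integral_mul_const, integral_const_mul, kmean]
  -- the limit covariance
  obtain ⟨A, hA, hAC⟩ := exists_whitening
    ((hcov₁₀.smul (by positivity : 0 < 4 / ρ₁)).add (hcov₀₁.smul (by positivity : 0 < 4 / ρ₂)))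
  set C := (4 / ρ₁) • covMatrix P (g₁₀ P Q d) + (4 / ρ₂) • covMatrix Q (g₀₁ P Q d) with hCdef
  have hC : ∀ a b, C a b = 4 / ρ₁ * (∫ x, G a x * G b x ∂P) + 4 / ρ₂ * ∫ x, K a x * K b x ∂Q := by
    intro a b
    simp only [hCdef, Matrix.add_apply, Matrix.smul_apply, smul_eq_mul,
      covMatrix_apply_of_integral_eq_zero hG2 hG0, covMatrix_apply_of_integral_eq_zero hK2 hK0,
      hGdef, hKdef]
  -- The limits of the coefficients `2 / √(n₁ / n)` and `2 / √(n₂ / n)` in the linear expansion;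
  -- their squares are the weights `4 / ρ₁` and `4 / ρ₂` in `C`.
  set κ₁ := 2 / √ρ₁ with hκ₁
  set κ₂ := 2 / √ρ₂ with hκ₂
  have hC' : ∀ a b, C a b = κ₁ ^ 2 * (∫ x, G a x * G b x ∂P) +
      κ₂ ^ 2 * ∫ x, K a x * K b x ∂Q := by
    intro a b
    rw [hC, hκ₁, hκ₂, div_pow, div_pow, Real.sq_sqrt hρ₁.le, Real.sq_sqrt hρ₂.le]
    norm_num
  have hclt := tendstoInDistribution_two_sample hZ hW hZW mG mK hG2 hK2 hG0 hK0 hAC hC' hn₁ hn₂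
  -- the pseudo-values
  set V : ∀ k, Ω → Fin (n₁ k) ⊕ Fin (n₂ k) → Fin 2 → ℝ := fun k ω =>
    pseudoValue d (fun i : Fin (n₁ k) => Z i ω) (fun j : Fin (n₂ k) => W j ω) with hVdef
  have mV : ∀ k, Measurable (V k) := fun k =>
    measurable_pseudoValue hZ.measurable hW.measurable d
  have hcard : Tendsto (fun k => Fintype.card (Fin (n₁ k) ⊕ Fin (n₂ k))) atTop atTop := by
    simpa using hn
  set L : ℕ → Ω → Fin 2 → ℝ := fun k ω a =>
    κ₁ * ((√(n₁ k : ℝ))⁻¹ * ∑ i : Fin (n₁ k), G a (Z i ω)) +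
      κ₂ * ((√(n₂ k : ℝ))⁻¹ * ∑ j : Fin (n₂ k), K a (W j ω)) with hL
  have mX : ∀ k a, Measurable fun ω => ∑ i : Fin (n₁ k), G a (Z i ω) := fun k a =>
    Finset.measurable_sum _ fun i _ => (mG a).comp (hZ.measurable i)
  have mY : ∀ k a, Measurable fun ω => ∑ j : Fin (n₂ k), K a (W j ω) := fun k a =>
    Finset.measurable_sum _ fun j _ => (mK a).comp (hW.measurable j)
  have mS : ∀ k, Measurable fun ω => scaledSum (V k ω) := fun k => measurable_scaledSum.comp (mV k)
  have mSa : ∀ k a, Measurable fun ω => scaledSum (V k ω) a := fun k a =>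
    (measurable_pi_apply a).comp (mS k)
  have mL : ∀ k, Measurable (L k) := fun k => measurable_pi_lambda _ fun a =>
    (((mX k a).const_mul _).const_mul _).add (((mY k a).const_mul _).const_mul _)
  have hres : ∀ a, TendstoInMeasure μ (fun k ω => (scaledSum (V k ω) - L k ω) a) atTop
      (fun _ => 0) := by
    intro a
    have R₁ := tendstoInMeasure_of_isTypical hZ hW hP hQ mG hG2 mK hK2 hn₁ hn₂ (f := 0)
      (F := fun k ω => scaledSum (V k ω) a -
        (2 / √((n₁ k : ℝ) / (n₁ k + n₂ k)) *
            ((√(n₁ k : ℝ))⁻¹ * ∑ i : Fin (n₁ k), G a (Z i ω)) +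
          2 / √((n₂ k : ℝ) / (n₁ k + n₂ k)) *
            ((√(n₂ k : ℝ))⁻¹ * ∑ j : Fin (n₂ k), K a (W j ω))))
      (fun k => (mSa k a).sub ((((mX k a).const_mul _).const_mul _).add
        (((mY k a).const_mul _).const_mul _)))
      (fun ω ns hns h₁ h₂ => tendsto_scaledSum_sub h₁ h₂ hG hK h0 hρ₁ hρ₂
        (hr₁.comp hns.tendsto_atTop) (hr₂.comp hns.tendsto_atTop) a)
    have hc₁ : Tendsto (fun k => 2 / √((n₁ k : ℝ) / (n₁ k + n₂ k)) - κ₁) atTop (𝓝 0) := by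
      have := ((tendsto_const_nhds (x := (2 : ℝ))).div hr₁.sqrt (Real.sqrt_pos.2 hρ₁).ne').sub_const κ₁
      rwa [sub_self] at this
    have hc₂ : Tendsto (fun k => 2 / √((n₂ k : ℝ) / (n₁ k + n₂ k)) - κ₂) atTop (𝓝 0) := by
      have := ((tendsto_const_nhds (x := (2 : ℝ))).div hr₂.sqrt (Real.sqrt_pos.2 hρ₂).ne').sub_const κ₂
      rwa [sub_self] at this
    have R₂ := hZ.tendstoInMeasure_mul_sum (mG a) (hG2 a) (hG0 a) hn₁ hc₁
    have R₃ := hW.tendstoInMeasure_mul_sum (mK a) (hK2 a) (hK0 a) hn₂ hc₂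
    -- The residual is the error of the linear expansion plus the errors of replacing the two
    -- coefficients by their limits.
    refine tendstoInMeasure_of_forall_subseq (I := Fin 3) (c := fun _ => 0)
      (X := ![_, _, _]) (Fin.forall_fin_succ.2 ⟨R₁, Fin.forall_fin_two.2 ⟨R₂, R₃⟩⟩)
      (fun k => ((mSa k a).sub ((measurable_pi_apply a).comp (mL k))).aestronglyMeasurable)
      (ae_of_all _ fun ω ns _ hs => ?_)
    have hsum := ((hs 0).add (hs 1)).add (hs 2)
    simp only [add_zero] at hsum
    refine hsum.congr fun k => ?_
    simp only [hL, Pi.sub_apply, Matrix.cons_val]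
    ring
  have hsum : TendstoInDistribution (fun k ω => A.mulVec (scaledSum (V k ω))) atTop
      (fun x : Fin 2 → ℝ => x) (fun _ => μ) (Measure.pi fun _ => gaussianReal 0 1) := by
    refine tendstoInDistribution_of_tendstoInMeasure_sub _ _ hclt ?_ fun k => ?_
    · have h := tendstoInMeasure_mulVec A (fun k => (mS k).sub (mL k)) hres
      refine h.congr_left fun k => ae_of_all _ fun ω => ?_
      simp only [Pi.sub_apply, ← Matrix.mulVec_sub]
      rfl
    · have hc : Continuous fun x : Fin 2 → ℝ => A.mulVec x :=
        Continuous.matrix_mulVec (by fun_prop) (by fun_prop)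
      exact (hc.measurable.comp (mS k)).aemeasurable
  refine tendstoInDistribution_negTwoLog_elRatio mV hcard hA hAC hsum (fun a b => ?_) ?_
  · rw [hC]
    exact tendstoInMeasure_of_isTypical hZ hW hP hQ mG hG2 mK hK2 hn₁ hn₂
      (fun k => (measurable_secondMoment a b).comp (mV k))
      (fun ω ns hns h₁ h₂ => tendsto_secondMoment_pseudoValue h₁ h₂ hG hK h0 hρ₁ hρ₂
        (hr₁.comp hns.tendsto_atTop) (hr₂.comp hns.tendsto_atTop) a b)
  · exact tendstoInMeasure_of_isTypical hZ hW hP hQ mG hG2 mK hK2 hn₁ hn₂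
      (fun k => (mV k).norm.div_const _)
      (fun ω ns hns h₁ h₂ => tendsto_norm_pseudoValue h₁ h₂ hG hK h0 hρ₁ hρ₂
        (hr₁.comp hns.tendsto_atTop) (hr₂.comp hns.tendsto_atTop))

end GiniJEL

theorem theorem3 {Ω : Type*} [MeasurableSpace Ω] (μ : Measure Ω) [IsProbabilityMeasure μ]
    (H M : Measure (ℝ × ℝ)) [IsProbabilityMeasure H] [IsProbabilityMeasure M]
    -- the marginal distribution functions are continuous
    (hH₁ : Continuous (cdf (H.map Prod.fst))) (hH₂ : Continuous (cdf (H.map Prod.snd)))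
    (hM₁ : Continuous (cdf (M.map Prod.fst))) (hM₂ : Continuous (cdf (M.map Prod.snd)))
    -- two independent i.i.d. samples, from the laws `H` and `M`
    (Z W : ℕ → Ω → ℝ × ℝ)
    (hZ : ∀ i, HasLaw (Z i) H μ) (hW : ∀ j, HasLaw (W j) M μ)
    (hindep : iIndepFun (fun s : ℕ ⊕ ℕ => Sum.elim Z W s) μ)
    -- finite second moments
    (hX₁ : Integrable (fun z : ℝ × ℝ => z.1 ^ 2) H) (hY₁ : Integrable (fun z : ℝ × ℝ => z.2 ^ 2) H)
    (hX₂ : Integrable (fun z : ℝ × ℝ => z.1 ^ 2) M) (hY₂ : Integrable (fun z : ℝ × ℝ => z.2 ^ 2) M)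
    -- positive definite covariance matrices of the projections
    (hcov₁₀ : (GiniJEL.covMatrix H (GiniJEL.g₁₀ H M (GiniJEL.giniDiff H M))).PosDef)
    (hcov₀₁ : (GiniJEL.covMatrix M (GiniJEL.g₀₁ H M (GiniJEL.giniDiff H M))).PosDef)
    -- the sample sizes
    (n₁ n₂ : ℕ → ℕ) (r : ℝ) (hr : 0 < r)
    (hn : Tendsto (fun k => n₁ k + n₂ k) atTop atTop)
    (hratio : Tendsto (fun k => (n₁ k : ℝ) / (n₂ k : ℝ)) atTop (𝓝 r)) :
    TendstoInDistribution
      (fun (k : ℕ) (ω : Ω) => GiniJEL.negTwoLog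
        (GiniJEL.jelRatio (GiniJEL.giniDiff H M)
          (fun i : Fin (n₁ k) => Z i ω) (fun j : Fin (n₂ k) => W j ω)))
      atTop (fun x : ℝ => (x : EReal)) (fun _ => μ) (GiniJEL.chiSquare 2) := by
  -- `HasLaw` provides only almost everywhere measurability. Measurable versions have the same laws
  -- and independence, and almost surely give the same statistics for every `k`.
  set Z' : ℕ → Ω → ℝ × ℝ := fun i => (hZ i).aemeasurable.mk
  set W' : ℕ → Ω → ℝ × ℝ := fun i => (hW i).aemeasurable.mk
  have eZ : ∀ i, Z i =ᵐ[μ] Z' i := fun i => (hZ i).aemeasurable.ae_eq_mk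
  have eW : ∀ i, W i =ᵐ[μ] W' i := fun i => (hW i).aemeasurable.ae_eq_mk
  have hindep' : iIndepFun (fun s : ℕ ⊕ ℕ => Sum.elim Z' W' s) μ :=
    hindep.congr fun s => by
      rcases s with i | j
      · exact eZ i
      · exact eW j
  have iZ : GiniJEL.IsIID H Z' μ :=
    ⟨fun i => (hZ i).aemeasurable.measurable_mk,
      fun i => (Measure.map_congr (eZ i)).symm.trans (hZ i).map_eq,
      hindep'.precomp Sum.inl_injective⟩
  have iW : GiniJEL.IsIID M W' μ :=
    ⟨fun i => (hW i).aemeasurable.measurable_mk,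
      fun i => (Measure.map_congr (eW i)).symm.trans (hW i).map_eq,
      hindep'.precomp Sum.inr_injective⟩
  have h := GiniJEL.tendstoInDistribution_negTwoLog_jelRatio iZ iW hindep'
    (GiniJEL.memLp_coord hX₁ hY₁) (GiniJEL.memLp_coord hX₂ hY₂)
    (Fin.forall_fin_two.2 ⟨hH₁, hH₂⟩) (Fin.forall_fin_two.2 ⟨hM₁, hM₂⟩) hcov₁₀ hcov₀₁ hr hn hratio
  refine h.congr (fun k => ?_) (ae_of_all _ fun _ => rfl)
  filter_upwards [ae_all_iff.2 eZ, ae_all_iff.2 eW] with ω h1 h2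
  simp only [h1, h2]
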